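/- **Setting.** Let $d\ge 1$, let $\mathcal P=\{(p_z)_{z\in\mathbb Z^d}: p_z\ge 0,\ \sum_z p_z=1\}$, let $\Omega=\mathcal P^{\mathbb Z^d}$ with its product $\sigma$-field $\mathfrak S$, and for $\omega=(\omega_x)_{x\in\mathbb Z^d}\in\Omega$ put $\pi_{x,y}(\omega)=\omega_{x,y-x}$. The shifts $T_z$ are given by $\pi_{x,y}(T_z\omega)=\pi_{x+z,y+z}(\omega)$. For $\omega\in\Omega$ and $z\in\mathbb Z^d$ let $P^\omega_z$ be the law of the Markov chain $(X_n)_{n\ge0}$ on $\mathbb Z^d$ with $X_0=z$ and transition probabilities $\pi_{x,y}(\omega)$. Given a probability measure $\mathbb P$ on $\Omega$, let $P_0(dX,d\omega)=P_0^\omega(dX)\,\mathbb P(d\omega)$ be the averaged measure on paths and environments. Let $\Pi(\omega,A)=P_0^\omega(T_{X_1}\omega\in A)$ be the transition kernel of the environment process. Fix $\hat u\in\mathbb Z^d\setminus\{0\}$ and for $\ell\in\mathbb R$ let $\mathfrak S_\ell=\sigma\{\omega_x: x\cdot\hat u\ge\ell\}$. Write $d_{\rm Var}(\mu,\nu)=\sup_A\{\mu(A)-\nu(A)\}$.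 A probability measure $\mu$ on $\Omega$ satisfies * **(N)** if there is $\delta>0$ with $\sum_z z\cdot\hat u\,\pi_{0,z}(\omega)\ge\delta$ for $\mu$-a.e. $\omega$ (the sum converging absolutely); * **(M)** if there are $M,s_0>0$ with $\sum_z e^{s_0|z|}\pi_{0,z}(\omega)\le e^{s_0M}$ for $\mu$-a.e. $\omega$. **Theorem.** Let $\mathbb P$ be an i.i.d. product measure on $\Omega=\mathcal P^{\mathbb Z^d}$ that satisfies (N) and (M). Then there exists a probability measure $\mathbb P_\infty$ on $\Omega$ with the following properties: 1. $\mathbb P_\infty$ is invariant and ergodic for $\Pi$ (ergodic: every measurable $A$ with $\Pi(\omega,A)=\mathbf 1_A(\omega)$ for $\mathbb P_\infty$-a.e. $\omega$ has $\mathbb P_\infty(A)\in\{0,1\}$); 2. there are constants $0<c,C<\infty$ such that $d_{\rm Var}(\mathbb P_\infty|_{\mathfrak S_\ell},\mathbb P|_{\mathfrak S_\ell})\le Ce^{-c\ell}$ for all $\ell\ge0$; 3. $\mathbb P_\infty$ satisfies (N), with the same $\hat u$, and (M). Moreover, for every such $\mathbb P_\infty$, every finite $a$ and every bounded $\mathfrak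 S_{-a}$-measurable function $\Psi:\Omega\to\mathbb R$, $$\lim_{n\to\infty}\frac1n\sum_{j=0}^{n-1}\Psi(T_{X_j}\omega)=\mathbb E_\infty\Psi\qquad P_0\text{-almost surely},$$ where $\mathbb E_\infty$ denotes expectation under $\mathbb P_\infty$. -/

import Mathlib

open MeasureTheory ProbabilityTheory Filter Topology
open scoped ENNReal

namespace RWRE

/-- The integer lattice `ℤ^d`. -/
abbrev Site (d : ℕ) : Type := Fin d → ℤ

/-- The simplex of all probability vectors on `ℤ^d`, with the σ-field inherited from the product
σ-field of `ℝ^(ℤ^d)`. -/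
abbrev ProbVec (d : ℕ) : Type := {p : Site d → ℝ // (∀ z, 0 ≤ p z) ∧ HasSum p 1}

/-- Environments: a probability vector at every site, with the product σ-field. -/
abbrev Env (d : ℕ) : Type := Site d → ProbVec d

/-- Infinite lattice paths, with the product σ-field. -/
abbrev Path (d : ℕ) : Type := ℕ → Site d

/-- The scalar product of two lattice vectors. -/
def dot {d : ℕ} (x y : Site d) : ℤ := ∑ i, x i * y i

/-- The Euclidean norm of a lattice vector. -/
noncomputable def eNorm {d : ℕ} (z : Site d) : ℝ := Real.sqrt (∑ i, (z i : ℝ) ^ 2)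

/-- The transition probability `π_{x,y}(ω) = ω_{x,y-x}`. -/
def trans {d : ℕ} (ω : Env d) (x y : Site d) : ℝ := (ω x).1 (y - x)

/-- The shift `T_z`, characterized by `π_{x,y}(T_z ω) = π_{x+z,y+z}(ω)`. -/
def shift {d : ℕ} (z : Site d) (ω : Env d) : Env d := fun x => ω (x + z)

theorem trans_shift {d : ℕ} (z : Site d) (ω : Env d) (x y : Site d) :
    trans (shift z ω) x y = trans ω (x + z) (y + z) := by
  simp [trans, shift]

/-- The law of one step of the walk in the environment `ω` from the site `x`. -/
noncomputable def stepMeasure {d : ℕ} (ω : Env d) (x : Site d) : Measure (Site d) :=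
  Measure.sum fun y => ENNReal.ofReal (trans ω x y) • Measure.dirac y

theorem stepMeasure_singleton {d : ℕ} (ω : Env d) (x y : Site d) :
    stepMeasure ω x {y} = ENNReal.ofReal (trans ω x y) := by
  classical
  rw [stepMeasure, Measure.sum_apply _ (measurableSet_singleton y), tsum_eq_single y]
  · simp
  · intro b hb
    simp [hb]

instance {d : ℕ} (ω : Env d) (x : Site d) : IsProbabilityMeasure (stepMeasure ω x) := by
  constructor
  rw [stepMeasure, Measure.sum_apply _ MeasurableSet.univ]
  have h : HasSum (fun y => trans ω x y) 1 := by
    have := (Equiv.subRight x).hasSum_iff.mpr (ω x).2.2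
    exact this
  have h0 : ∀ y, 0 ≤ trans ω x y := fun y => (ω x).2.1 _
  simp only [Measure.smul_apply, measure_univ, smul_eq_mul, mul_one]
  rw [← ENNReal.ofReal_tsum_of_nonneg h0 h.summable, h.tsum_eq]
  simp

/-- The Markovian step of the walk in the environment `ω`: given the path up to time `n`, jump
from the current site with the transition probabilities found there. -/
noncomputable def stepKernel {d : ℕ} (ω : Env d) (n : ℕ) :
    Kernel ((i : Finset.Iic n) → (fun _ : ℕ => Site d) i) (Site d) :=
  Kernel.ofFunOfCountable fun h => stepMeasure ω (h ⟨n, Finset.mem_Iic.2 le_rfl⟩)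

instance {d : ℕ} (ω : Env d) (n : ℕ) : IsMarkovKernel (stepKernel ω n) :=
  ⟨fun h => inferInstanceAs
    (IsProbabilityMeasure (stepMeasure ω (h ⟨n, Finset.mem_Iic.2 le_rfl⟩)))⟩

/-- The quenched path measure `P_z^ω`: the law of the Markov chain started at `z` with transition
probabilities `π_{x,y}(ω)`. -/
noncomputable def quenched {d : ℕ} (ω : Env d) (z : Site d) : Measure (Path d) :=
  Kernel.trajMeasure (X := fun _ : ℕ => Site d) (Measure.dirac z) (stepKernel ω)

instance {d : ℕ} (ω : Env d) (z : Site d) : IsProbabilityMeasure (quenched ω z) := by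
  unfold quenched; infer_instance

/-- Paths that agree with `x` up to time `n`. -/
def cyl {d : ℕ} (x : Path d) (n : ℕ) : Set (Path d) := {X | ∀ i ≤ n, X i = x i}

theorem measurableSet_cyl {d : ℕ} (x : Path d) (n : ℕ) : MeasurableSet (cyl x n) := by
  have : cyl x n = ⋂ i, ⋂ (_ : i ≤ n), (fun X : Path d => X i) ⁻¹' {x i} := by
    ext X; simp [cyl]
  rw [this]
  exact MeasurableSet.iInter fun i => MeasurableSet.iInter fun _ =>
    measurable_pi_apply i (measurableSet_singleton _)

theorem quenched_cyl_zero {d : ℕ} (ω : Env d) (z : Site d) (x : Path d) :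
    quenched ω z (cyl x 0) = Measure.dirac z {x 0} := by
  have h1 : (Kernel.traj (X := fun _ : ℕ => Site d) (stepKernel ω) 0).map
      (Preorder.frestrictLe 0) = Kernel.id := by
    rw [Kernel.traj_map_frestrictLe, Kernel.partialTraj_self]
  have h2 : (quenched ω z).map (Preorder.frestrictLe (π := fun _ : ℕ => Site d) 0)
      = (Measure.dirac z).map
        (MeasurableEquiv.piUnique (fun i : Finset.Iic 0 => (fun _ : ℕ => Site d) i)).symm := by
    rw [quenched, Kernel.trajMeasure, Measure.map_comp _ _ (by fun_prop), h1]
    exact Measure.id_comp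
  have h3 : cyl x 0 = Preorder.frestrictLe (π := fun _ : ℕ => Site d) 0 ⁻¹'
      ((fun h => h ⟨0, Finset.mem_Iic.2 le_rfl⟩) ⁻¹' {x 0}) := by
    ext X; simp [cyl]
  have hm : MeasurableSet ((fun h : (i : Finset.Iic 0) → (fun _ : ℕ => Site d) i =>
      h ⟨0, Finset.mem_Iic.2 le_rfl⟩) ⁻¹' {x 0}) :=
    measurable_pi_apply _ (measurableSet_singleton _)
  rw [h3, ← Measure.map_apply (by fun_prop) hm, h2, Measure.map_apply (by fun_prop) hm]
  rfl

theorem quenched_cyl_succ {d : ℕ} (ω : Env d) (z : Site d) (x : Path d) (n : ℕ) :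
    quenched ω z (cyl x (n + 1))
      = quenched ω z (cyl x n) * ENNReal.ofReal (trans ω (x n) (x (n + 1))) := by
  have h := Kernel.map_frestrictLe_trajMeasure_compProd_eq_map_trajMeasure
    (X := fun _ : ℕ => Site d) (μ₀ := Measure.dirac z) (κ := stepKernel ω) (a := n)
  set r : (i : Finset.Iic n) → (fun _ : ℕ => Site d) i :=
    Preorder.frestrictLe (π := fun _ : ℕ => Site d) n x with hr
  have hms : MeasurableSet ({r} : Set ((i : Finset.Iic n) → (fun _ : ℕ => Site d) i)) :=
    measurableSet_singleton r
  have hp := congrArg (fun μ => μ ({r} ×ˢ {x (n + 1)})) h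
  have hc : cyl x n = Preorder.frestrictLe (π := fun _ : ℕ => Site d) n ⁻¹' {r} := by
    ext X
    simp only [cyl, Set.mem_ofPred_eq, Set.mem_preimage, Set.mem_singleton_iff, hr, funext_iff]
    exact ⟨fun h i => h i.1 (Finset.mem_Iic.1 i.2), fun h i hi => h ⟨i, Finset.mem_Iic.2 hi⟩⟩
  have hc' : cyl x (n + 1) = (fun X : Path d =>
      (Preorder.frestrictLe (π := fun _ : ℕ => Site d) n X, X (n + 1))) ⁻¹'
        ({r} ×ˢ {x (n + 1)}) := by
    ext X
    have : X ∈ cyl x (n + 1) ↔ X ∈ cyl x n ∧ X (n + 1) = x (n + 1) := by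
      simp only [cyl, Set.mem_ofPred_eq, Nat.le_succ_iff]
      constructor
      · exact fun h => ⟨fun i hi => h i (Or.inl hi), h _ (Or.inr rfl)⟩
      · rintro ⟨h, h'⟩ i (hi | rfl)
        exacts [h i hi, h']
    rw [this, hc]
    simp
  have e1 : stepKernel ω n r {x (n + 1)} = ENNReal.ofReal (trans ω (x n) (x (n + 1))) :=
    stepMeasure_singleton ω (x n) (x (n + 1))
  have hms' : MeasurableSet (({r} : Set ((i : Finset.Iic n) → (fun _ : ℕ => Site d) i)) ×ˢ
      {x (n + 1)}) := hms.prod (measurableSet_singleton _)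
  rw [hc', hc, quenched, ← Measure.map_apply (by fun_prop) hms',
    ← Measure.map_apply (by fun_prop) hms, ← h,
    Measure.compProd_apply_prod hms (measurableSet_singleton _), lintegral_singleton, e1, mul_comm]

theorem measurable_quenched_cyl {d : ℕ} (z : Site d) (x : Path d) (n : ℕ) :
    Measurable fun ω : Env d => quenched ω z (cyl x n) := by
  induction n with
  | zero => simp only [quenched_cyl_zero]; exact measurable_const
  | succ n ih =>
    simp only [quenched_cyl_succ]
    refine ih.mul (ENNReal.measurable_ofReal.comp ?_)
    exact (measurable_pi_apply _).comp (measurable_subtype_coe.comp (measurable_pi_apply _))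

theorem measurable_quenched {d : ℕ} (z : Site d) :
    Measurable fun ω : Env d => quenched ω z := by
  refine .measure_of_isPiSystem_of_isProbabilityMeasure
    (S := {A | A = ∅ ∨ ∃ x n, A = cyl x n}) ?_ ?_ ?_
  · refine le_antisymm ?_ ?_
    · refine iSup_le fun n => ?_
      rintro _ ⟨B, -, rfl⟩
      let T : Set ((i : Fin (n + 1)) → Site d) := {h | h (Fin.last n) ∈ B}
      have : (fun X : Path d => X n) ⁻¹' B
          = ⋃ h ∈ T, cyl (fun i => if hi : i < n + 1 then h ⟨i, hi⟩ else 0) n := by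
        ext X
        simp only [Set.mem_preimage, Set.mem_iUnion, exists_prop, cyl, Set.mem_ofPred_eq, T]
        constructor
        · intro hX
          refine ⟨fun i => X i, hX, fun i hi => ?_⟩
          simp [Nat.lt_succ_of_le hi]
        · rintro ⟨h, hh, hX⟩
          have := hX n le_rfl
          simp only [Nat.lt_succ_self, dif_pos] at this
          rw [this]; exact hh
      refine this ▸ ?_
      exact MeasurableSet.biUnion (Set.to_countable T) fun h _ =>
        MeasurableSpace.measurableSet_generateFrom (Or.inr ⟨_, _, rfl⟩)
    · refine MeasurableSpace.generateFrom_le ?_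
      rintro _ (rfl | ⟨x, n, rfl⟩)
      exacts [MeasurableSet.empty, measurableSet_cyl x n]
  · have key : ∀ (x y : Path d) (m n : ℕ), m ≤ n → (cyl x m ∩ cyl y n).Nonempty →
        cyl x m ∩ cyl y n = cyl y n := by
      rintro x y m n hmn ⟨X, hX, hY⟩
      refine Set.inter_eq_right.2 fun Z hZ i hi => ?_
      rw [hZ i (hi.trans hmn), ← hY i (hi.trans hmn), hX i hi]
    rintro _ (rfl | ⟨x, m, rfl⟩) _ (rfl | ⟨y, n, rfl⟩) hne
    · simp at hne
    · simp at hne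
    · simp at hne
    · rcases le_total m n with h | h
      · exact Or.inr ⟨y, n, key x y m n h hne⟩
      · rw [Set.inter_comm] at hne ⊢
        exact Or.inr ⟨x, m, key y x n m h hne⟩
  · rintro _ (rfl | ⟨x, n, rfl⟩)
    · simp
    · exact measurable_quenched_cyl z x n

/-- The quenched path measure as a kernel from environments to paths. -/
noncomputable def quenchedKernel {d : ℕ} (z : Site d) : Kernel (Env d) (Path d) where
  toFun ω := quenched ω z
  measurable' := measurable_quenched z

instance {d : ℕ} (z : Site d) : IsMarkovKernel (quenchedKernel z) :=
  ⟨fun ω => inferInstanceAs (IsProbabilityMeasure (quenched ω z))⟩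

/-- The joint law `P_z(dX, dω) = P_z^ω(dX) P(dω)` of the environment and the walk, as a measure
on pairs `(ω, X)`. -/
noncomputable def averaged {d : ℕ} (P : Measure (Env d)) (z : Site d) :
    Measure (Env d × Path d) :=
  P ⊗ₘ quenchedKernel z

theorem measurable_shift_path {d : ℕ} (n : ℕ) :
    Measurable fun p : Env d × Path d => shift (p.2 n) p.1 := by
  have h : Measurable fun q : Env d × Site d => shift q.2 q.1 :=
    measurable_from_prod_countable_left fun z =>
      measurable_pi_lambda _ fun x => measurable_pi_apply (x + z)
  exact h.comp (measurable_fst.prodMk ((measurable_pi_apply n).comp measurable_snd))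

/-- The transition kernel `Π(ω, A) = P_0^ω(T_{X_1} ω ∈ A)` of the environment process. -/
noncomputable def envKernel (d : ℕ) : Kernel (Env d) (Env d) where
  toFun ω := (quenched ω 0).map fun X => shift (X 1) ω
  measurable' := by
    refine Measure.measurable_of_measurable_coe _ fun A hA => ?_
    have h : ∀ ω : Env d, Measurable fun X : Path d => shift (X 1) ω := fun ω =>
      (measurable_shift_path 1).comp measurable_prodMk_left
    have e : (fun ω : Env d => ((quenched ω 0).map fun X => shift (X 1) ω) A)
        = fun ω => quenchedKernel (0 : Site d) ω
          (Prod.mk ω ⁻¹' ((fun p : Env d × Path d => shift (p.2 1) p.1) ⁻¹' A)) :=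
      funext fun ω => Measure.map_apply (h ω) hA
    rw [e]
    exact Kernel.measurable_kernel_prodMk_left (measurable_shift_path 1 hA)

/-- Ergodicity of `μ` for a Markov kernel `κ`: almost surely invariant events are trivial. -/
def IsErgodicFor {α : Type*} [MeasurableSpace α] (κ : Kernel α α) (μ : Measure α) : Prop :=
  ∀ A : Set α, MeasurableSet A → (∀ᵐ a ∂μ, κ a A = A.indicator 1 a) → μ A = 0 ∨ μ A = 1

/-- `𝔖_ℓ = σ{ω_x : x · u ≥ ℓ}`. -/
@[reducible] def levelSigma {d : ℕ} (u : Site d) (ℓ : ℝ) : MeasurableSpace (Env d) :=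
  ⨆ x : {x : Site d // ℓ ≤ (dot x u : ℝ)},
    MeasurableSpace.comap (fun ω : Env d => ω x.1) inferInstance

/-- The variation distance `sup {μ(A) - ν(A)}` of the restrictions of `μ` and `ν` to the
σ-algebra `m`. -/
noncomputable def dVar {α : Type*} (m : MeasurableSpace α) [MeasurableSpace α]
    (μ ν : Measure α) : ℝ :=
  ⨆ A : {A : Set α // MeasurableSet[m] A}, (μ.real A.1 - ν.real A.1)

/-- Non-nestling in direction `u`: the quenched drift in direction `u` is almost surely bounded
below by a positive constant. -/
def HypothesisN {d : ℕ} (u : Site d) (P : Measure (Env d)) : Prop :=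
  ∃ δ : ℝ, 0 < δ ∧
    ∀ᵐ ω ∂P, Summable (fun z : Site d => (dot z u : ℝ) * trans ω 0 z) ∧
      δ ≤ ∑' z : Site d, (dot z u : ℝ) * trans ω 0 z

/-- The uniform exponential moment bound on the steps. -/
def HypothesisM {d : ℕ} (P : Measure (Env d)) : Prop :=
  ∃ M s₀ : ℝ, 0 < M ∧ 0 < s₀ ∧
    ∀ᵐ ω ∂P, Summable (fun z : Site d => Real.exp (s₀ * eNorm z) * trans ω 0 z) ∧
      ∑' z : Site d, Real.exp (s₀ * eNorm z) * trans ω 0 z ≤ Real.exp (s₀ * M)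

/-- The defining properties of the invariant measure `P_∞` of the environment process that is
naturally related to `P`: it is invariant and ergodic for `Π`, its variation distance from `P`
on `𝔖_ℓ` decays exponentially in `ℓ ≥ 0`, and it satisfies the non-nestling and the moment
hypothesis. -/
structure IsInvariantLimit {d : ℕ} (u : Site d) (P Pinf : Measure (Env d)) : Prop where
  prob : IsProbabilityMeasure Pinf
  invariant : Kernel.Invariant (envKernel d) Pinf
  ergodic : IsErgodicFor (envKernel d) Pinf
  close : ∃ c C : ℝ, 0 < c ∧ 0 < C ∧
    ∀ ℓ : ℝ, 0 ≤ ℓ → dVar (levelSigma u ℓ) Pinf P ≤ C * Real.exp (-c * ℓ)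
  nonnestling : HypothesisN u Pinf
  moment : HypothesisM Pinf

end RWRE

/-!
The environment seen from the walk, `shift (X n) ω`, is studied through its laws `envLaw μ n`, for
the walk in a random environment with law `μ`. The limit law is built as a Cesàro limit of these
laws, started from the product law, and it is then identified by a loss of memory.

The non-nestling and the moment hypothesis give a contraction: for a small `s > 0`, the quenched
mean of `exp (-s X₁ · u)` is at most some `ρ < 1` (`exists_expDrift`). Hence backtracking is exponentially
unlikely, uniformly in time, and the walk is transient in the direction `u`. At a time when the
walk is at a new maximum, up to `ℓ` levels, the environment ahead is fresh and independent of the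
past (`averaged_fresh`); this compares `envLaw P n` with `P` on the half-space above level `ℓ`, with
an error of order `exp (-s ℓ)` (`envLaw_iidLaw_le`).

At a regeneration time the walk reaches a strict record and never goes below it again. Decomposing
at the last regeneration that lies at depth at least `b` below the current position turns the
probability of a half-space event of the environment seen from the walk into a convolution of a
renewal sequence with a summable one. It follows that these probabilities converge in Cesàro
average, and that the limit is not influenced by the environment at time zero in a lower half-space
(`exists_local_limit`). The local limits are consistent and extend to one law (`exists_limit_law`).

By approximation in `L¹`, the same limit is reached from every law that is absolutely continuous
with respect to the product law on half-spaces and for which the walk has bounded backtracking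
(`IsLimitLaw.tendsto_envLaw`). This loss of memory gives ergodicity, on starting from the limit law
conditioned on an invariant event, and uniqueness: an invariant measure that is exponentially close
to `P` far up is absolutely continuous on half-spaces (`IsInvariantLimit.measure_eq_zero`), hence
equal to the limit law.

For the law of large numbers, Birkhoff's theorem applies to the walk started from the invariant
measure (`ergodic_pairShift`, `ae_tendsto_birkhoff`). The environments from which a walk that does
not backtrack far has divergent averages form a half-space event that is null for the invariant
measure; under `P` the walk seldom sees such environments at late times, and divergence is a tail
property, so it has probability zero under `P` too (`IsLimitLaw.averaged_diverges`).
-/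

namespace RWRE

/-! ### Half-space measurability of environments -/

@[simp] theorem dot_zero_left {d : ℕ} (u : Site d) : dot 0 u = 0 := by simp [dot]

theorem dot_add_left {d : ℕ} (x y u : Site d) : dot (x + y) u = dot x u + dot y u := by
  simp [dot, add_mul, Finset.sum_add_distrib]

theorem dot_sub_left {d : ℕ} (x y u : Site d) : dot (x - y) u = dot x u - dot y u := by
  simp [dot, sub_mul, Finset.sum_sub_distrib]

/-- The point mass at the origin: an arbitrary probability vector that serves as a filler. -/
noncomputable def filler (d : ℕ) : ProbVec d := by
  classical
  exact ⟨Pi.single 0 1, fun z => by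
    by_cases h : z = 0
    · subst h; simp
    · simp [h], hasSum_pi_single 0 1⟩

/-- The environment `ω` on the half-space `{x · u ≥ ℓ}`, and `filler` elsewhere. -/
noncomputable def trunc {d : ℕ} (u : Site d) (ℓ : ℤ) (ω : Env d) : Env d :=
  fun x => if ℓ ≤ dot x u then ω x else filler d

theorem trunc_apply_of_le {d : ℕ} {u : Site d} {ℓ : ℤ} (ω : Env d) {x : Site d}
    (h : ℓ ≤ dot x u) : trunc u ℓ ω x = ω x := if_pos h

theorem measurable_trunc {d : ℕ} (u : Site d) (ℓ : ℤ) : Measurable (trunc u ℓ) := by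
  refine measurable_pi_lambda _ fun x => ?_
  unfold trunc
  split_ifs
  · exact measurable_pi_apply x
  · exact measurable_const

theorem trunc_trunc {d : ℕ} (u : Site d) {ℓ ℓ' : ℤ} (h : ℓ ≤ ℓ') (ω : Env d) :
    trunc u ℓ' (trunc u ℓ ω) = trunc u ℓ' ω := by
  ext1 x
  unfold trunc
  split_ifs <;> first | rfl | omega

theorem shift_trunc {d : ℕ} (u z : Site d) (ℓ : ℤ) (ω : Env d) :
    shift z (trunc u (ℓ + dot z u) ω) = trunc u ℓ (shift z ω) := by
  ext1 x
  simp only [shift, trunc, dot_add_left, add_le_add_iff_right]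

theorem shift_shift {d : ℕ} (y z : Site d) (ω : Env d) :
    shift y (shift z ω) = shift (y + z) ω := by
  ext1 x
  simp [shift, add_assoc]

@[simp] theorem shift_zero {d : ℕ} (ω : Env d) : shift 0 ω = ω := by
  ext1 x
  simp [shift]

theorem measurable_shift {d : ℕ} (z : Site d) : Measurable (shift z : Env d → Env d) :=
  measurable_pi_lambda _ fun x => measurable_pi_apply (x + z)

/-- `A` is an event that depends on the environment on the half-space `{x · u ≥ ℓ}` only. -/
def IsHalf {d : ℕ} (u : Site d) (ℓ : ℤ) (A : Set (Env d)) : Prop :=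
  MeasurableSet A ∧ trunc u ℓ ⁻¹' A = A

theorem IsHalf.mono {d : ℕ} {u : Site d} {ℓ ℓ' : ℤ} {A : Set (Env d)} (hA : IsHalf u ℓ A)
    (h : ℓ' ≤ ℓ) : IsHalf u ℓ' A := by
  refine ⟨hA.1, ?_⟩
  conv_lhs => rw [← hA.2]
  ext ω
  simp only [Set.mem_preimage, trunc_trunc u h]
  exact Set.ext_iff.1 hA.2 ω

theorem IsHalf.compl {d : ℕ} {u : Site d} {ℓ : ℤ} {A : Set (Env d)} (hA : IsHalf u ℓ A) :
    IsHalf u ℓ Aᶜ := ⟨hA.1.compl, by rw [Set.preimage_compl, hA.2]⟩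

theorem IsHalf.inter {d : ℕ} {u : Site d} {ℓ : ℤ} {A B : Set (Env d)} (hA : IsHalf u ℓ A)
    (hB : IsHalf u ℓ B) : IsHalf u ℓ (A ∩ B) :=
  ⟨hA.1.inter hB.1, by rw [Set.preimage_inter, hA.2, hB.2]⟩

theorem isHalf_univ {d : ℕ} (u : Site d) (ℓ : ℤ) : IsHalf u ℓ (Set.univ : Set (Env d)) :=
  ⟨MeasurableSet.univ, rfl⟩

theorem isHalf_preimage_trunc {d : ℕ} (u : Site d) (ℓ : ℤ) {B : Set (Env d)}
    (hB : MeasurableSet B) : IsHalf u ℓ (trunc u ℓ ⁻¹' B) := by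
  refine ⟨measurable_trunc u ℓ hB, ?_⟩
  ext ω
  simp [trunc_trunc u le_rfl]

theorem IsHalf.mem_iff {d : ℕ} {u : Site d} {ℓ : ℤ} {A : Set (Env d)} (hA : IsHalf u ℓ A)
    (ω : Env d) : trunc u ℓ ω ∈ A ↔ ω ∈ A := Set.ext_iff.1 hA.2 ω

theorem IsHalf.preimage_shift {d : ℕ} {u : Site d} {ℓ : ℤ} {A : Set (Env d)} (hA : IsHalf u ℓ A)
    (z : Site d) : IsHalf u (ℓ + dot z u) (shift z ⁻¹' A) := by
  refine ⟨measurable_shift z hA.1, ?_⟩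
  ext ω
  simp only [Set.mem_preimage, shift_trunc]
  exact hA.mem_iff _

theorem isHalf_of_measurable {d : ℕ} {u : Site d} {ℓ : ℤ} {β : Type*} [MeasurableSpace β]
    {f : Env d → β} (hf : Measurable f) (h : ∀ ω, f (trunc u ℓ ω) = f ω) {B : Set β}
    (hB : MeasurableSet B) : IsHalf u ℓ (f ⁻¹' B) := by
  refine ⟨hf hB, ?_⟩
  ext ω
  simp [h]

theorem isHalf_biUnion {d : ℕ} {u : Site d} {ℓ : ℤ} {ι : Type*} (s : Set ι) (hs : s.Countable)
    {A : ι → Set (Env d)} (hA : ∀ i ∈ s, IsHalf u ℓ (A i)) : IsHalf u ℓ (⋃ i ∈ s, A i) := by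
  refine ⟨MeasurableSet.biUnion hs fun i hi => (hA i hi).1, ?_⟩
  simp only [Set.preimage_iUnion]
  exact Set.iUnion₂_congr fun i hi => (hA i hi).2

theorem ceil_le_dot_iff {d : ℕ} (u x : Site d) (r : ℝ) : ⌈r⌉ ≤ dot x u ↔ r ≤ (dot x u : ℝ) :=
  Int.ceil_le

theorem comap_trunc {d : ℕ} (u : Site d) (r : ℝ) :
    levelSigma u r = MeasurableSpace.comap (trunc u ⌈r⌉) inferInstance := by
  apply le_antisymm
  · refine iSup_le fun x => ?_
    rw [← measurable_iff_comap_le]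
    have h : (fun ω : Env d => ω x.1) = (fun ω : Env d => ω x.1) ∘ trunc u ⌈r⌉ := by
      ext1 ω
      simp [trunc_apply_of_le ω ((ceil_le_dot_iff u x.1 r).2 x.2)]
    rw [h]
    exact (measurable_pi_apply x.1).comp (comap_measurable _)
  · rw [← measurable_iff_comap_le]
    refine @measurable_pi_lambda _ _ _ (levelSigma u r) _ _ fun x => ?_
    by_cases hx : ⌈r⌉ ≤ dot x u
    · simp only [trunc, if_pos hx]
      have h1 : MeasurableSpace.comap (fun ω : Env d => ω x) inferInstance ≤ levelSigma u r :=
        le_iSup (fun x : {x : Site d // r ≤ (dot x u : ℝ)} =>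
          MeasurableSpace.comap (fun ω : Env d => ω x.1) inferInstance)
          ⟨x, (ceil_le_dot_iff u x r).1 hx⟩
      exact (comap_measurable _).mono h1 le_rfl
    · simp only [trunc, if_neg hx]
      exact @measurable_const _ _ _ (levelSigma u r) _

theorem measurableSet_levelSigma_iff {d : ℕ} (u : Site d) (r : ℝ) (A : Set (Env d)) :
    MeasurableSet[levelSigma u r] A ↔ IsHalf u ⌈r⌉ A := by
  rw [comap_trunc]
  constructor
  · rintro ⟨B, hB, rfl⟩
    exact isHalf_preimage_trunc u _ hB
  · rintro ⟨h1, h2⟩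
    exact ⟨A, h1, h2⟩

theorem measurable_levelSigma {d : ℕ} {u : Site d} {r : ℝ} {f : Env d → ℝ}
    (hf : Measurable[levelSigma u r] f) : Measurable f ∧ ∀ ω, f (trunc u ⌈r⌉ ω) = f ω := by
  constructor
  · intro B hB
    exact ((measurableSet_levelSigma_iff u r _).1 (hf hB)).1
  · intro ω
    exact ((measurableSet_levelSigma_iff u r _).1 (hf (measurableSet_singleton (f ω)))).mem_iff ω
      |>.2 rfl

theorem isPiSystem_isHalf {d : ℕ} (u : Site d) :
    IsPiSystem {A : Set (Env d) | ∃ b : ℕ, IsHalf u (-b) A} := by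
  rintro A ⟨a, hA⟩ B ⟨b, hB⟩ -
  refine ⟨max a b, ?_⟩
  exact (hA.mono (by push_cast; omega)).inter (hB.mono (by push_cast; omega))

theorem generateFrom_isHalf {d : ℕ} (u : Site d) :
    (inferInstance : MeasurableSpace (Env d))
      = MeasurableSpace.generateFrom {A : Set (Env d) | ∃ b : ℕ, IsHalf u (-b) A} := by
  apply le_antisymm
  · refine iSup_le fun x => ?_
    rintro _ ⟨B, hB, rfl⟩
    refine MeasurableSpace.measurableSet_generateFrom ⟨(-dot x u).toNat, ?_⟩
    refine isHalf_of_measurable (measurable_pi_apply x) (fun ω => ?_) hB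
    exact trunc_apply_of_le ω (by omega)
  · refine MeasurableSpace.generateFrom_le ?_
    rintro A ⟨b, hA⟩
    exact hA.1

theorem env_measure_ext {d : ℕ} (u : Site d) {μ μ' : Measure (Env d)} [IsProbabilityMeasure μ]
    [IsProbabilityMeasure μ'] (h : ∀ (b : ℕ) (A : Set (Env d)), IsHalf u (-b) A → μ A = μ' A) :
    μ = μ' :=
  ext_of_generate_finite _ (generateFrom_isHalf u) (isPiSystem_isHalf u)
    (fun A ⟨b, hA⟩ => h b A hA) (by simp)

/-! ### Path measures and the Markov property -/

/-- The walk after time `n`, seen from its position at that time. -/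
def tail {d : ℕ} (n : ℕ) (X : Path d) : Path d := fun k => X (n + k) - X n

theorem measurable_tail {d : ℕ} (n : ℕ) : Measurable (tail n : Path d → Path d) :=
  measurable_pi_lambda _ fun k => (measurable_pi_apply (n + k)).sub (measurable_pi_apply n)

@[simp] theorem tail_zero_apply {d : ℕ} (n : ℕ) (X : Path d) : tail n X 0 = 0 := by simp [tail]

theorem tail_tail {d : ℕ} (m n : ℕ) (X : Path d) : tail m (tail n X) = tail (n + m) X := by
  ext1 k
  simp [tail, add_assoc]

theorem isPiSystem_cyl {d : ℕ} :
    IsPiSystem {A : Set (Path d) | ∃ x n, A = cyl x n} := by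
  have key : ∀ (x y : Path d) (m n : ℕ), m ≤ n → (cyl x m ∩ cyl y n).Nonempty →
      cyl x m ∩ cyl y n = cyl y n := by
    rintro x y m n hmn ⟨X, hX, hY⟩
    refine Set.inter_eq_right.2 fun Z hZ i hi => ?_
    rw [hZ i (hi.trans hmn), ← hY i (hi.trans hmn), hX i hi]
  rintro _ ⟨x, m, rfl⟩ _ ⟨y, n, rfl⟩ hne
  rcases le_total m n with h | h
  · exact ⟨y, n, key x y m n h hne⟩
  · rw [Set.inter_comm] at hne ⊢
    exact ⟨x, m, key y x n m h hne⟩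

/-- The extension of a finite path by the origin. -/
def extend {d : ℕ} {n : ℕ} (h : (i : Finset.Iic n) → Site d) : Path d :=
  fun i => if hi : i ≤ n then h ⟨i, Finset.mem_Iic.2 hi⟩ else 0

theorem mem_cyl_extend_iff {d : ℕ} {n : ℕ} (h : (i : Finset.Iic n) → Site d) (X : Path d) :
    X ∈ cyl (extend h) n ↔ Preorder.frestrictLe (π := fun _ : ℕ => Site d) n X = h := by
  simp only [cyl, Set.mem_ofPred_eq, funext_iff, extend]
  constructor
  · rintro hX ⟨i, hi⟩
    have := hX i (Finset.mem_Iic.1 hi)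
    rw [dif_pos (Finset.mem_Iic.1 hi)] at this
    exact this
  · intro hX i hi
    rw [dif_pos hi]
    exact hX ⟨i, Finset.mem_Iic.2 hi⟩

theorem generateFrom_cyl {d : ℕ} : (inferInstance : MeasurableSpace (Path d))
    = MeasurableSpace.generateFrom {A : Set (Path d) | ∃ x n, A = cyl x n} := by
  refine le_antisymm ?_ ?_
  · refine iSup_le fun n => ?_
    rintro _ ⟨B, -, rfl⟩
    have : (fun X : Path d => X n) ⁻¹' B
        = ⋃ h ∈ {h : (i : Finset.Iic n) → Site d | h ⟨n, Finset.mem_Iic.2 le_rfl⟩ ∈ B},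
          cyl (extend h) n := by
      ext X
      simp only [Set.mem_preimage, Set.mem_iUnion, mem_cyl_extend_iff, exists_prop,
        Set.mem_ofPred_eq, exists_eq_right']
      rfl
    refine this ▸ ?_
    exact MeasurableSet.biUnion (Set.to_countable _) fun h _ =>
      MeasurableSpace.measurableSet_generateFrom ⟨_, _, rfl⟩
  · refine MeasurableSpace.generateFrom_le ?_
    rintro _ ⟨x, n, rfl⟩
    exact measurableSet_cyl x n

theorem path_measure_ext {d : ℕ} {μ μ' : Measure (Path d)} [IsFiniteMeasure μ]
    (h : ∀ x n, μ (cyl x n) = μ' (cyl x n)) (hu : μ Set.univ = μ' Set.univ) : μ = μ' :=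
  ext_of_generate_finite _ generateFrom_cyl isPiSystem_cyl
    (fun _ ⟨x, n, hA⟩ => hA ▸ h x n) hu

theorem quenched_cyl_of_ne {d : ℕ} (ω : Env d) {z : Site d} {x : Path d} (n : ℕ) (h : x 0 ≠ z) :
    quenched ω z (cyl x n) = 0 := by
  refine measure_mono_null (t := cyl x 0) (fun X hX i hi => hX i (by omega)) ?_
  rw [quenched_cyl_zero]
  simp [h.symm]

theorem ae_quenched_zero {d : ℕ} (ω : Env d) (z : Site d) : ∀ᵐ X ∂(quenched ω z), X 0 = z := by
  have h : quenched ω z (cyl (fun _ => z) 0) = 1 := by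
    rw [quenched_cyl_zero]; simp
  have h2 := (prob_compl_eq_zero_iff (measurableSet_cyl (fun _ => z) 0)).2 h
  filter_upwards [measure_eq_zero_iff_ae_notMem.1 h2] with X hX
  by_contra hne
  exact hX (fun hc => hne (hc 0 le_rfl))

/-- The Markov property at time `n`, on cylinders. -/
theorem quenched_cyl_inter_tail_cyl {d : ℕ} (ω : Env d) (x y : Path d) (n m : ℕ) :
    quenched ω 0 (cyl x n ∩ tail n ⁻¹' (cyl y m))
      = quenched ω 0 (cyl x n) * quenched (shift (x n) ω) 0 (cyl y m) := by
  by_cases hy : y 0 = 0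
  swap
  · rw [quenched_cyl_of_ne _ _ hy, mul_zero]
    refine measure_mono_null ?_ measure_empty
    rintro X ⟨-, hX⟩
    exact hy ((hX 0 (Nat.zero_le _)).symm.trans (tail_zero_apply n X))
  let w : Path d := fun i => if i ≤ n then x i else x n + y (i - n)
  have hw : ∀ k, w (n + k) = x n + y k := by
    intro k
    rcases Nat.eq_zero_or_pos k with rfl | hk
    · simp [w, hy]
    · simp only [w]
      rw [if_neg (by omega)]
      congr 2
      omega
  have hw' : ∀ i ≤ n, w i = x i := fun i hi => if_pos hi
  have hset : ∀ m, cyl x n ∩ tail n ⁻¹' (cyl y m) = cyl w (n + m) := by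
    intro m
    ext X
    simp only [cyl, Set.mem_inter_iff, Set.mem_ofPred_eq, Set.mem_preimage, tail]
    constructor
    · rintro ⟨h1, h2⟩ i hi
      rcases le_total i n with h | h
      · rw [hw' i h, h1 i h]
      · obtain ⟨k, rfl⟩ := Nat.exists_eq_add_of_le h
        rw [hw, ← h2 k (by omega), h1 n le_rfl]
        abel
    · intro h
      refine ⟨fun i hi => (h i (by omega)).trans (hw' i hi), fun i hi => ?_⟩
      rw [h _ (by omega), hw, h n (by omega), hw' n le_rfl]
      abel
  rw [hset]
  induction m with
  | zero =>
    rw [quenched_cyl_zero, hy]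
    simp only [add_zero]
    have : cyl w n = cyl x n := by
      ext X
      simp only [cyl, Set.mem_ofPred_eq]
      exact forall₂_congr fun i hi => by rw [hw' i hi]
    simp [this]
  | succ m ih =>
    rw [← add_assoc, quenched_cyl_succ, quenched_cyl_succ, ih, hw, add_assoc n m 1, hw,
      trans_shift, mul_assoc, add_comm (x n), add_comm (x n)]

theorem quenched_cyl_inter_tail {d : ℕ} (ω : Env d) (x : Path d) (n : ℕ) {B : Set (Path d)}
    (hB : MeasurableSet B) :
    quenched ω 0 (cyl x n ∩ tail n ⁻¹' B)
      = quenched ω 0 (cyl x n) * quenched (shift (x n) ω) 0 B := by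
  have h : ((quenched ω 0).restrict (cyl x n)).map (tail n)
      = quenched ω 0 (cyl x n) • quenched (shift (x n) ω) 0 := by
    refine path_measure_ext (fun y m => ?_) ?_
    · rw [Measure.map_apply (measurable_tail n) (measurableSet_cyl y m),
        Measure.restrict_apply (measurable_tail n (measurableSet_cyl y m)), Set.inter_comm,
        quenched_cyl_inter_tail_cyl]
      rfl
    · rw [Measure.map_apply (measurable_tail n) MeasurableSet.univ]
      simp
  have h2 := congrArg (fun μ => μ B) h
  simp only [Measure.map_apply (measurable_tail n) hB,
    Measure.restrict_apply (measurable_tail n hB)] at h2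
  rw [Set.inter_comm, h2]
  rfl

/-- Decomposition of a path measure along the values of the path up to time `n`. -/
theorem measure_path_eq_tsum {d : ℕ} (μ : Measure (Path d)) (n : ℕ) {S : Set (Path d)}
    (hS : MeasurableSet S) :
    μ S = ∑' h : (i : Finset.Iic n) → Site d, μ (S ∩ cyl (extend h) n) := by
  rw [← measure_iUnion]
  · congr 1
    ext X
    simp [mem_cyl_extend_iff]
  · intro h h' hne
    refine Set.disjoint_left.2 fun X hX hX' => hne ?_
    rw [← (mem_cyl_extend_iff h X).1 hX.2, ← (mem_cyl_extend_iff h' X).1 hX'.2]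
  · exact fun h => hS.inter (measurableSet_cyl _ _)

theorem lintegral_path_eq_tsum {d : ℕ} (μ : Measure (Path d)) (n : ℕ) (f : Path d → ℝ≥0∞) :
    ∫⁻ X, f X ∂μ = ∑' h : (i : Finset.Iic n) → Site d, ∫⁻ X in cyl (extend h) n, f X ∂μ := by
  rw [← lintegral_iUnion]
  · have : (⋃ h : (i : Finset.Iic n) → Site d, cyl (extend h) n) = Set.univ := by
      ext X
      simp [mem_cyl_extend_iff]
    rw [this, Measure.restrict_univ]
  · exact fun h => measurableSet_cyl _ _
  · intro h h' hne
    refine Set.disjoint_left.2 fun X hX hX' => hne ?_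
    rw [← (mem_cyl_extend_iff h X).1 hX, ← (mem_cyl_extend_iff h' X).1 hX']

/-- The Markov property of the quenched walk at time `n`. -/
theorem lintegral_quenched_markov {d : ℕ} (ω : Env d) (n : ℕ) {f : Path d → ℝ≥0∞}
    (hfp : ∀ X Y : Path d, (∀ i ≤ n, X i = Y i) → f X = f Y)
    {F : Site d → Path d → ℝ≥0∞} (hF : ∀ z, Measurable (F z)) :
    ∫⁻ X, f X * F (X n) (tail n X) ∂(quenched ω 0)
      = ∫⁻ X, f X * (∫⁻ Y, F (X n) Y ∂(quenched (shift (X n) ω) 0)) ∂(quenched ω 0) := by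
  rw [lintegral_path_eq_tsum _ n, lintegral_path_eq_tsum (quenched ω 0) n
    (fun X => f X * (∫⁻ Y, F (X n) Y ∂(quenched (shift (X n) ω) 0)))]
  refine tsum_congr fun h => ?_
  set x := extend h
  have e1 : ∫⁻ X in cyl x n, f X * F (X n) (tail n X) ∂(quenched ω 0)
      = ∫⁻ X in cyl x n, f x * F (x n) (tail n X) ∂(quenched ω 0) := by
    refine setLIntegral_congr_fun (measurableSet_cyl x n) fun X hX => ?_
    rw [hfp X x hX, hX n le_rfl]
  have e2 : ∫⁻ X in cyl x n, f X * (∫⁻ Y, F (X n) Y ∂(quenched (shift (X n) ω) 0)) ∂(quenched ω 0)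
      = ∫⁻ X in cyl x n, f x * (∫⁻ Y, F (x n) Y ∂(quenched (shift (x n) ω) 0))
        ∂(quenched ω 0) := by
    refine setLIntegral_congr_fun (measurableSet_cyl x n) fun X hX => ?_
    rw [hfp X x hX, hX n le_rfl]
  have hmap : ((quenched ω 0).restrict (cyl x n)).map (tail n)
      = quenched ω 0 (cyl x n) • quenched (shift (x n) ω) 0 := by
    ext B hB
    rw [Measure.map_apply (measurable_tail n) hB, Measure.restrict_apply (measurable_tail n hB),
      Set.inter_comm, quenched_cyl_inter_tail _ _ _ hB]
    rfl
  rw [e1, e2, lintegral_const_mul (f := fun X => F (x n) (tail n X)) _ ((hF _).comp (measurable_tail n)),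
    ← lintegral_map (hF _) (measurable_tail n), hmap, lintegral_smul_measure, lintegral_const]
  simp [mul_assoc, mul_comm]

/-! ### The environment seen from the walk -/

/-- The pair (environment, walk) seen from the walk at time `n`. -/
def pairShift {d : ℕ} (n : ℕ) (p : Env d × Path d) : Env d × Path d :=
  (shift (p.2 n) p.1, tail n p.2)

theorem measurable_pairShift {d : ℕ} (n : ℕ) :
    Measurable (pairShift n : Env d × Path d → Env d × Path d) :=
  (measurable_shift_path n).prodMk ((measurable_tail n).comp measurable_snd)

theorem pairShift_pairShift {d : ℕ} (m n : ℕ) (p : Env d × Path d) :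
    pairShift m (pairShift n p) = pairShift (n + m) p := by
  simp [pairShift, tail_tail, shift_shift, tail]

theorem shift_pairShift {d : ℕ} (m n : ℕ) (p : Env d × Path d) :
    shift ((pairShift n p).2 m) (pairShift n p).1 = shift (p.2 (n + m)) p.1 := by
  simp [pairShift, shift_shift, tail]

/-- The law of the environment seen from the walk at time `n`, with initial law `μ`. -/
noncomputable def envLaw {d : ℕ} (μ : Measure (Env d)) (n : ℕ) : Measure (Env d) :=
  (averaged μ 0).map fun p => shift (p.2 n) p.1

instance {d : ℕ} (μ : Measure (Env d)) [IsProbabilityMeasure μ] (z : Site d) :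
    IsProbabilityMeasure (averaged μ z) := by
  unfold averaged; infer_instance

instance {d : ℕ} (μ : Measure (Env d)) [IsProbabilityMeasure μ] (n : ℕ) :
    IsProbabilityMeasure (envLaw μ n) :=
  Measure.isProbabilityMeasure_map (measurable_shift_path n).aemeasurable

theorem lintegral_averaged {d : ℕ} (μ : Measure (Env d)) [SFinite μ] {f : Env d × Path d → ℝ≥0∞}
    (hf : Measurable f) :
    ∫⁻ p, f p ∂(averaged μ 0) = ∫⁻ ω, ∫⁻ X, f (ω, X) ∂(quenched ω 0) ∂μ := by
  rw [averaged, Measure.lintegral_compProd hf]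
  rfl

theorem averaged_apply {d : ℕ} (μ : Measure (Env d)) [SFinite μ] {S : Set (Env d × Path d)}
    (hS : MeasurableSet S) :
    averaged μ 0 S = ∫⁻ ω, quenched ω 0 (Prod.mk ω ⁻¹' S) ∂μ := by
  rw [averaged, Measure.compProd_apply hS]
  rfl

theorem measurable_quenched_slice {d : ℕ} {S : Set (Env d × Path d)} (hS : MeasurableSet S) :
    Measurable fun ω : Env d => quenched ω 0 (Prod.mk ω ⁻¹' S) :=
  Kernel.measurable_kernel_prodMk_left (κ := quenchedKernel (0 : Site d)) hS

theorem measurable_lintegral_quenched {d : ℕ} {f : Env d × Path d → ℝ≥0∞} (hf : Measurable f) :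
    Measurable fun ω : Env d => ∫⁻ X, f (ω, X) ∂(quenched ω 0) :=
  Measurable.lintegral_kernel_prod_right' (κ := quenchedKernel (0 : Site d)) hf

/-- The Markov property of the walk under the averaged measure. -/
theorem lintegral_averaged_markov {d : ℕ} (μ : Measure (Env d)) [SFinite μ] (n : ℕ)
    {f : Env d × Path d → ℝ≥0∞} (hf : Measurable f)
    (hfp : ∀ ω, ∀ X Y : Path d, (∀ i ≤ n, X i = Y i) → f (ω, X) = f (ω, Y))
    {F : Env d × Path d → ℝ≥0∞} (hF : Measurable F) :
    ∫⁻ p, f p * F (pairShift n p) ∂(averaged μ 0)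
      = ∫⁻ p, f p * (∫⁻ Y, F (shift (p.2 n) p.1, Y) ∂(quenched (shift (p.2 n) p.1) 0))
        ∂(averaged μ 0) := by
  rw [lintegral_averaged (f := fun p => f p * F (pairShift n p)) _
      (hf.mul (hF.comp (measurable_pairShift n))),
    lintegral_averaged (f := fun p => f p *
      (∫⁻ Y, F (shift (p.2 n) p.1, Y) ∂(quenched (shift (p.2 n) p.1) 0))) _ (hf.mul
      ((measurable_lintegral_quenched hF).comp (measurable_shift_path n)))]
  refine lintegral_congr fun ω => ?_
  exact lintegral_quenched_markov ω n (hfp ω)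
    (F := fun z Y => F (shift z ω, Y)) (fun z => hF.comp measurable_prodMk_left)

theorem averaged_markov {d : ℕ} (μ : Measure (Env d)) [SFinite μ] (n : ℕ)
    {S : Set (Env d × Path d)} (hS : MeasurableSet S)
    (hSp : ∀ ω, ∀ X Y : Path d, (∀ i ≤ n, X i = Y i) → ((ω, X) ∈ S ↔ (ω, Y) ∈ S))
    {F : Set (Env d × Path d)} (hF : MeasurableSet F) :
    averaged μ 0 (S ∩ pairShift n ⁻¹' F)
      = ∫⁻ p in S, quenched (shift (p.2 n) p.1) 0 (Prod.mk (shift (p.2 n) p.1) ⁻¹' F)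
        ∂(averaged μ 0) := by
  classical
  have h := lintegral_averaged_markov μ n (f := S.indicator 1) (measurable_one.indicator hS)
    (fun ω X Y hXY => by
      simp only [Set.indicator, hSp ω X Y hXY, Pi.one_apply])
    (F := F.indicator 1) (measurable_one.indicator hF)
  rw [← lintegral_indicator_one (hS.inter (measurable_pairShift n hF)),
    ← lintegral_indicator hS]
  refine Eq.trans ?_ (h.trans ?_)
  · refine lintegral_congr fun p => ?_
    rw [Set.inter_indicator_one]
    rfl
  · refine lintegral_congr fun p => ?_
    have e : ∫⁻ Y, F.indicator 1 (shift (p.2 n) p.1, Y) ∂(quenched (shift (p.2 n) p.1) 0)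
        = quenched (shift (p.2 n) p.1) 0 (Prod.mk (shift (p.2 n) p.1) ⁻¹' F) := by
      rw [← lintegral_indicator_one (measurable_prodMk_left hF)]
      rfl
    rw [e]
    by_cases hp : p ∈ S <;> simp [hp]

theorem map_pairShift {d : ℕ} (μ : Measure (Env d)) [SFinite μ] (n : ℕ) :
    (averaged μ 0).map (pairShift n) = averaged (envLaw μ n) 0 := by
  ext F hF
  have : SFinite (envLaw μ n) := by unfold envLaw averaged; infer_instance
  have h := averaged_markov μ n MeasurableSet.univ (by simp) hF
  rw [Set.univ_inter, Measure.restrict_univ] at h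
  rw [Measure.map_apply (measurable_pairShift n) hF, h, averaged_apply _ hF, envLaw,
    lintegral_map (measurable_quenched_slice hF) (measurable_shift_path n)]

theorem envLaw_add {d : ℕ} (μ : Measure (Env d)) [SFinite μ] (n m : ℕ) :
    envLaw μ (n + m) = envLaw (envLaw μ n) m := by
  conv_rhs => rw [envLaw, ← map_pairShift, Measure.map_map (measurable_shift_path m)
    (measurable_pairShift n)]
  rw [envLaw]
  congr 1
  ext1 p
  exact (shift_pairShift m n p).symm

theorem averaged_fst {d : ℕ} (μ : Measure (Env d)) [SFinite μ] :
    (averaged μ 0).map Prod.fst = μ :=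
  Measure.fst_compProd μ (quenchedKernel 0)

theorem ae_averaged_zero {d : ℕ} (μ : Measure (Env d)) [SFinite μ] :
    ∀ᵐ p ∂(averaged μ 0), p.2 0 = 0 := by
  refine (Measure.ae_compProd_iff ?_).2 (Eventually.of_forall fun ω => ae_quenched_zero ω 0)
  exact ((measurable_pi_apply 0).comp measurable_snd) (measurableSet_singleton 0)

theorem envLaw_zero {d : ℕ} (μ : Measure (Env d)) [SFinite μ] : envLaw μ 0 = μ := by
  rw [envLaw]
  conv_rhs => rw [← averaged_fst μ]
  refine Measure.map_congr ?_
  filter_upwards [ae_averaged_zero μ] with p hp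
  simp [hp]

theorem envLaw_apply {d : ℕ} (μ : Measure (Env d)) [SFinite μ] (n : ℕ) {A : Set (Env d)}
    (hA : MeasurableSet A) :
    envLaw μ n A = averaged μ 0 {p | shift (p.2 n) p.1 ∈ A} :=
  Measure.map_apply (measurable_shift_path n) hA

theorem envKernel_apply {d : ℕ} (ω : Env d) {A : Set (Env d)} (hA : MeasurableSet A) :
    envKernel d ω A = quenched ω 0 {X | shift (X 1) ω ∈ A} := by
  have h : Measurable fun X : Path d => shift (X 1) ω :=
    (measurable_shift_path 1).comp measurable_prodMk_left
  exact Measure.map_apply h hA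

theorem envLaw_one_apply {d : ℕ} (μ : Measure (Env d)) [SFinite μ] {A : Set (Env d)}
    (hA : MeasurableSet A) : envLaw μ 1 A = ∫⁻ ω, envKernel d ω A ∂μ := by
  have hS : MeasurableSet {p : Env d × Path d | shift (p.2 1) p.1 ∈ A} :=
    measurable_shift_path 1 hA
  rw [envLaw_apply _ _ hA, averaged_apply _ hS]
  exact lintegral_congr fun ω => (envKernel_apply ω hA).symm

theorem bind_envKernel {d : ℕ} (μ : Measure (Env d)) [SFinite μ] :
    μ.bind (envKernel d) = envLaw μ 1 := by
  ext A hA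
  rw [Measure.bind_apply hA (Kernel.aemeasurable _), envLaw_one_apply _ hA]

theorem invariant_iff {d : ℕ} (μ : Measure (Env d)) [SFinite μ] :
    Kernel.Invariant (envKernel d) μ ↔ envLaw μ 1 = μ := by
  rw [← bind_envKernel, Kernel.Invariant]

instance {d : ℕ} (μ : Measure (Env d)) [SFinite μ] (n : ℕ) : SFinite (envLaw μ n) := by
  unfold envLaw averaged; infer_instance

theorem envLaw_of_invariant {d : ℕ} {μ : Measure (Env d)} [SFinite μ] (h : envLaw μ 1 = μ)
    (n : ℕ) : envLaw μ n = μ := by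
  induction n with
  | zero => exact envLaw_zero μ
  | succ n ih => rw [envLaw_add, ih, h]

theorem averaged_absolutelyContinuous {d : ℕ} {μ μ' : Measure (Env d)} [SFinite μ] [SFinite μ']
    (h : μ ≪ μ') : averaged μ 0 ≪ averaged μ' 0 :=
  h.compProd_left _

theorem envLaw_absolutelyContinuous {d : ℕ} {μ μ' : Measure (Env d)} [SFinite μ] [SFinite μ']
    (h : μ ≪ μ') (n : ℕ) : envLaw μ n ≪ envLaw μ' n :=
  (averaged_absolutelyContinuous h).map (measurable_shift_path n)

theorem averaged_preimage_pairShift {d : ℕ} (μ : Measure (Env d)) [SFinite μ] (n : ℕ)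
    {F : Set (Env d × Path d)} (hF : MeasurableSet F) :
    averaged μ 0 (pairShift n ⁻¹' F) = averaged (envLaw μ n) 0 F := by
  rw [← map_pairShift, Measure.map_apply (measurable_pairShift n) hF]

/-! ### Locality of the quenched path measures -/

theorem quenched_cyl_congr {d : ℕ} {ω ω' : Env d} {x : Path d} {n : ℕ}
    (h : ∀ i < n, ω (x i) = ω' (x i)) : quenched ω 0 (cyl x n) = quenched ω' 0 (cyl x n) := by
  induction n with
  | zero => simp only [quenched_cyl_zero]
  | succ n ih =>
    rw [quenched_cyl_succ, quenched_cyl_succ, ih fun i hi => h i (by omega)]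
    simp [trans, h n (by omega)]

/-- The event that the walk stays in the half-space `{x · u ≥ ℓ}`. -/
def staysAbove {d : ℕ} (u : Site d) (ℓ : ℤ) : Set (Path d) := {X | ∀ j, ℓ ≤ dot (X j) u}

theorem measurable_dot_path {d : ℕ} (u : Site d) (n : ℕ) :
    Measurable fun X : Path d => dot (X n) u :=
  (measurable_of_countable fun x : Site d => dot x u).comp (measurable_pi_apply n)

theorem measurableSet_staysAbove {d : ℕ} (u : Site d) (ℓ : ℤ) :
    MeasurableSet (staysAbove u ℓ) := by
  have : staysAbove u ℓ = ⋂ j, {X : Path d | ℓ ≤ dot (X j) u} := by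
    ext X; simp [staysAbove]
  rw [this]
  exact MeasurableSet.iInter fun j => measurableSet_le measurable_const (measurable_dot_path u j)

/-- Restricted to the event of staying in a half-space, the quenched law depends on the
environment in that half-space only. -/
theorem quenched_restrict_staysAbove {d : ℕ} (u : Site d) (ℓ : ℤ) {ω ω' : Env d}
    (h : ∀ x, ℓ ≤ dot x u → ω x = ω' x) :
    (quenched ω 0).restrict (staysAbove u ℓ) = (quenched ω' 0).restrict (staysAbove u ℓ) := by
  let D : ℕ → Set (Path d) := fun m => {X | ∀ j < m, ℓ ≤ dot (X j) u}
  have hDm : ∀ m, MeasurableSet (D m) := by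
    intro m
    have : D m = ⋂ j, ⋂ (_ : j < m), {X : Path d | ℓ ≤ dot (X j) u} := by
      ext X; simp [D]
    rw [this]
    exact MeasurableSet.iInter fun j => MeasurableSet.iInter fun _ =>
      measurableSet_le measurable_const (measurable_dot_path u j)
  have hDa : Antitone D := fun m m' hm X hX j hj => hX j (by omega)
  have hDi : staysAbove u ℓ = ⋂ m, D m := by
    ext X
    simp only [staysAbove, D, Set.mem_ofPred_eq, Set.mem_iInter]
    exact ⟨fun h m j _ => h j, fun h j => h (j + 1) j (by omega)⟩
  -- Sum over the initial segments of `m` steps that stay above the level; the probability of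
  -- each of them reads the environment only there.
  have key : ∀ (S : Set (Path d)) (n : ℕ), MeasurableSet S →
      (∀ X Y : Path d, (∀ i ≤ n, X i = Y i) → (X ∈ S ↔ Y ∈ S)) → ∀ m, n ≤ m →
      quenched ω 0 (S ∩ D m) = quenched ω' 0 (S ∩ D m) := by
    intro S n hS hSp m hm
    rw [measure_path_eq_tsum _ m (hS.inter (hDm m)),
      measure_path_eq_tsum (quenched ω' 0) m (hS.inter (hDm m))]
    refine tsum_congr fun h' => ?_
    by_cases hh : extend h' ∈ S ∩ D m
    · have : S ∩ D m ∩ cyl (extend h') m = cyl (extend h') m := by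
        refine Set.inter_eq_right.2 fun X hX => ⟨?_, fun j hj => ?_⟩
        · exact (hSp X _ fun i hi => hX i (by omega)).2 hh.1
        · rw [hX j hj.le]
          exact hh.2 j hj
      rw [this]
      exact quenched_cyl_congr fun i hi => h _ (hh.2 i hi)
    · have : S ∩ D m ∩ cyl (extend h') m = ∅ := by
        refine Set.eq_empty_of_forall_notMem fun X hX => hh ⟨?_, fun j hj => ?_⟩
        · exact (hSp X _ fun i hi => hX.2 i (by omega)).1 hX.1.1
        · rw [← hX.2 j hj.le]
          exact hX.1.2 j hj
      rw [this, measure_empty, measure_empty]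
  -- Let the time horizon of the constraint tend to infinity.
  have key2 : ∀ (S : Set (Path d)) (n : ℕ), MeasurableSet S →
      (∀ X Y : Path d, (∀ i ≤ n, X i = Y i) → (X ∈ S ↔ Y ∈ S)) →
      quenched ω 0 (S ∩ staysAbove u ℓ) = quenched ω' 0 (S ∩ staysAbove u ℓ) := by
    intro S n hS hSp
    have hlim : ∀ ω : Env d, Tendsto (fun m => quenched ω 0 (S ∩ D m)) atTop
        (𝓝 (quenched ω 0 (S ∩ staysAbove u ℓ))) := by
      intro ω
      rw [hDi, Set.inter_iInter]
      exact tendsto_measure_iInter_atTop (fun m => (hS.inter (hDm m)).nullMeasurableSet)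
        (fun m m' hm => Set.inter_subset_inter_right S (hDa hm)) ⟨0, measure_ne_top _ _⟩
    refine tendsto_nhds_unique (hlim ω) ((hlim ω').congr' ?_)
    filter_upwards [eventually_ge_atTop n] with m hm
    exact (key S n hS hSp m hm).symm
  refine path_measure_ext (fun x n => ?_) ?_
  · rw [Measure.restrict_apply (measurableSet_cyl x n), Measure.restrict_apply
      (measurableSet_cyl x n)]
    refine key2 _ n (measurableSet_cyl x n) fun X Y hXY => ?_
    simp only [cyl, Set.mem_ofPred_eq]
    exact forall₂_congr fun i hi => by rw [hXY i hi]
  · rw [Measure.restrict_apply MeasurableSet.univ, Measure.restrict_apply MeasurableSet.univ]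
    exact key2 _ 0 MeasurableSet.univ (by simp)

theorem quenched_inter_staysAbove_congr {d : ℕ} (u : Site d) (ℓ : ℤ) {ω ω' : Env d}
    (h : ∀ x, ℓ ≤ dot x u → ω x = ω' x) {B : Set (Path d)} (hB : MeasurableSet B) :
    quenched ω 0 (B ∩ staysAbove u ℓ) = quenched ω' 0 (B ∩ staysAbove u ℓ) := by
  rw [← Measure.restrict_apply hB, quenched_restrict_staysAbove u ℓ h, Measure.restrict_apply hB]

theorem quenched_trunc_staysAbove {d : ℕ} (u : Site d) (ℓ : ℤ) (ω : Env d) {B : Set (Path d)}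
    (hB : MeasurableSet B) :
    quenched (trunc u ℓ ω) 0 (B ∩ staysAbove u ℓ) = quenched ω 0 (B ∩ staysAbove u ℓ) :=
  quenched_inter_staysAbove_congr u ℓ (fun _ hx => trunc_apply_of_le ω hx) hB

/-! ### Independence under the product measure -/

/-- The environment that agrees with `ω` below level `m` and with `ω'` from level `m` on. -/
def glue {d : ℕ} (u : Site d) (m : ℤ) (p : Env d × Env d) : Env d :=
  fun x => if dot x u < m then p.1 x else p.2 x

theorem measurable_glue {d : ℕ} (u : Site d) (m : ℤ) :
    Measurable (glue u m : Env d × Env d → Env d) := by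
  refine measurable_pi_lambda _ fun x => ?_
  unfold glue
  split_ifs
  · exact (measurable_pi_apply x).comp measurable_fst
  · exact (measurable_pi_apply x).comp measurable_snd

/-- The product law of i.i.d. environments. -/
noncomputable abbrev iidLaw {d : ℕ} (ν : Measure (ProbVec d)) [IsProbabilityMeasure ν] :
    Measure (Env d) := Measure.infinitePi fun _ : Site d => ν

theorem map_glue {d : ℕ} (ν : Measure (ProbVec d)) [IsProbabilityMeasure ν] (u : Site d) (m : ℤ) :
    ((iidLaw ν).prod (iidLaw ν)).map (glue u m) = iidLaw ν := by
  classical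
  refine Measure.eq_infinitePi _ fun s t ht => ?_
  rw [Measure.map_apply (measurable_glue u m) (MeasurableSet.pi (Finset.countable_toSet s)
    fun i _ => ht i)]
  have e : glue u m ⁻¹' (Set.pi s t)
      = (Set.pi (s.filter fun x => dot x u < m : Finset (Site d)) t)
        ×ˢ (Set.pi (s.filter fun x => ¬ dot x u < m : Finset (Site d)) t) := by
    ext p
    simp only [Set.mem_preimage, Set.mem_pi, Set.mem_prod, Finset.coe_filter, Set.mem_ofPred_eq,
      glue]
    constructor
    · intro h
      refine ⟨fun i hi => ?_, fun i hi => ?_⟩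
      · simpa [hi.2] using h i hi.1
      · simpa [hi.2] using h i hi.1
    · rintro ⟨h1, h2⟩ i hi
      split_ifs with hc
      · exact h1 i ⟨hi, hc⟩
      · exact h2 i ⟨hi, hc⟩
  rw [e, Measure.prod_prod, Measure.infinitePi_pi _ fun i _ => ht i,
    Measure.infinitePi_pi _ fun i _ => ht i]
  exact Finset.prod_filter_mul_prod_filter_not s _ _

/-- Functions of the environment below level `m` and from level `m` on are independent. -/
theorem lintegral_mul_of_local {d : ℕ} (ν : Measure (ProbVec d)) [IsProbabilityMeasure ν]
    (u : Site d) (m : ℤ) {f g : Env d → ℝ≥0∞} (hf : Measurable f) (hg : Measurable g)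
    (hfl : ∀ ω ω' : Env d, (∀ x, dot x u < m → ω x = ω' x) → f ω = f ω')
    (hgl : ∀ ω ω' : Env d, (∀ x, m ≤ dot x u → ω x = ω' x) → g ω = g ω') :
    ∫⁻ ω, f ω * g ω ∂(iidLaw ν) = (∫⁻ ω, f ω ∂(iidLaw ν)) * ∫⁻ ω, g ω ∂(iidLaw ν) := by
  conv_lhs => rw [← map_glue ν u m]
  rw [lintegral_map (f := fun ω => f ω * g ω) (hf.mul hg) (measurable_glue u m),
    ← lintegral_prod_mul hf.aemeasurable hg.aemeasurable]
  refine lintegral_congr fun p => ?_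
  congr 1
  · exact hfl _ _ fun x hx => if_pos hx
  · exact hgl _ _ fun x hx => if_neg (not_lt.2 hx)

theorem map_shift_iidLaw {d : ℕ} (ν : Measure (ProbVec d)) [IsProbabilityMeasure ν] (z : Site d) :
    (iidLaw ν).map (shift z) = iidLaw ν := by
  classical
  refine Measure.eq_infinitePi _ fun s t ht => ?_
  rw [Measure.map_apply (measurable_shift z) (MeasurableSet.pi (Finset.countable_toSet s)
    fun i _ => ht i)]
  have e : shift z ⁻¹' (Set.pi s t)
      = Set.pi (s.map (Equiv.addRight z).toEmbedding : Finset (Site d)) fun x => t (x - z) := by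
    ext ω
    simp only [Set.mem_preimage, Set.mem_pi, Finset.mem_coe, Finset.mem_map_equiv, shift]
    constructor
    · intro h x hx
      simpa [sub_eq_add_neg] using h _ hx
    · intro h x hx
      simpa using h (x + z) (by simpa using hx)
  rw [e, Measure.infinitePi_pi _ fun i _ => ht _]
  simp

theorem envLaw_iidLaw_absolutelyContinuous {d : ℕ} (ν : Measure (ProbVec d))
    [IsProbabilityMeasure ν] (n : ℕ) : envLaw (iidLaw ν) n ≪ iidLaw ν := by
  refine Measure.AbsolutelyContinuous.mk fun A hA h0 => ?_
  rw [envLaw_apply _ _ hA]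
  refine measure_mono_null (t := Prod.fst ⁻¹' (⋃ z : Site d, shift z ⁻¹' A)) ?_ ?_
  · intro p hp
    exact Set.mem_iUnion.2 ⟨p.2 n, hp⟩
  · have hm : MeasurableSet (⋃ z : Site d, shift z ⁻¹' A) :=
      MeasurableSet.iUnion fun z => measurable_shift z hA
    rw [← Measure.map_apply measurable_fst hm, averaged_fst]
    refine measure_iUnion_null fun z => ?_
    rw [← Measure.map_apply (measurable_shift z) hA, map_shift_iidLaw, h0]

/-- If an event `S` of the past of time `n` reads the environment only below the level
`X_n · u + ℓ`, then what happens after time `n` in the half-space above that level is independent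
of `S`, and distributed as from time `0`. -/
theorem averaged_fresh {d : ℕ} (ν : Measure (ProbVec d)) [IsProbabilityMeasure ν]
    (u : Site d) (n : ℕ) (ℓ : ℤ) {S F : Set (Env d × Path d)} (hS : MeasurableSet S)
    (hSp : ∀ ω, ∀ X Y : Path d, (∀ i ≤ n, X i = Y i) → ((ω, X) ∈ S ↔ (ω, Y) ∈ S))
    (hSlt : ∀ ω X, (ω, X) ∈ S → ∀ j < n, dot (X j) u < dot (X n) u + ℓ)
    (hSloc : ∀ ω ω' X, (∀ x, dot x u < dot (X n) u + ℓ → ω x = ω' x) →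
      ((ω, X) ∈ S ↔ (ω', X) ∈ S))
    (hF : MeasurableSet F)
    (hFloc : ∀ ω, quenched (trunc u ℓ ω) 0 (Prod.mk (trunc u ℓ ω) ⁻¹' F)
      = quenched ω 0 (Prod.mk ω ⁻¹' F)) :
    averaged (iidLaw ν) 0 (S ∩ pairShift n ⁻¹' F)
      = averaged (iidLaw ν) 0 S * averaged (iidLaw ν) 0 F := by
  classical
  set P := iidLaw ν
  set G : Env d → ℝ≥0∞ := fun ω => quenched ω 0 (Prod.mk ω ⁻¹' F) with hG
  have hGm : Measurable G := measurable_quenched_slice hF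
  have hslice : ∀ ω, MeasurableSet (Prod.mk ω ⁻¹' S : Set (Path d)) :=
    fun ω => measurable_prodMk_left hS
  -- the contribution of each initial segment of the path
  let f : ((i : Finset.Iic n) → Site d) → Env d → ℝ≥0∞ :=
    fun h ω => quenched ω 0 (Prod.mk ω ⁻¹' S ∩ cyl (extend h) n)
  have hfm : ∀ h, Measurable (f h) := by
    intro h
    have hm : MeasurableSet (S ∩ Prod.snd ⁻¹' (cyl (extend h) n)) :=
      hS.inter (measurable_snd (measurableSet_cyl _ _))
    have e : ∀ ω : Env d, Prod.mk ω ⁻¹' S ∩ cyl (extend h) n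
        = Prod.mk ω ⁻¹' (S ∩ Prod.snd ⁻¹' (cyl (extend h) n)) := fun ω => rfl
    simp only [f, e]
    exact measurable_quenched_slice hm
  -- The factor of the past reads the environment strictly below the level `ℓ` above the
  -- endpoint, the factor of the future at or above it: they are independent.
  have hfloc : ∀ h ω ω', (∀ x, dot x u < dot (extend h n) u + ℓ → ω x = ω' x) →
      f h ω = f h ω' := by
    intro h ω ω' hω
    have key : ∀ ω, Prod.mk ω ⁻¹' S ∩ cyl (extend h) n
        = if (ω, extend h) ∈ S then cyl (extend h) n else ∅ := by
      intro ω
      split_ifs with hc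
      · refine Set.inter_eq_right.2 fun X hX => ?_
        exact (hSp ω X _ hX).2 hc
      · refine Set.eq_empty_of_forall_notMem fun X hX => hc ?_
        exact (hSp ω X _ hX.2).1 hX.1
    simp only [f, key]
    by_cases hc : (ω, extend h) ∈ S
    · rw [if_pos hc, if_pos ((hSloc ω ω' _ hω).1 hc)]
      exact quenched_cyl_congr fun i hi => hω _ (hSlt ω _ hc i hi)
    · rw [if_neg hc, if_neg fun h' => hc ((hSloc ω ω' _ hω).2 h')]
      simp
  have hGloc : ∀ (z : Site d) (ω ω' : Env d), (∀ x, dot z u + ℓ ≤ dot x u → ω x = ω' x) →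
      G (shift z ω) = G (shift z ω') := by
    intro z ω ω' hω
    simp only [hG]
    rw [← hFloc (shift z ω), ← hFloc (shift z ω')]
    have : trunc u ℓ (shift z ω) = trunc u ℓ (shift z ω') := by
      ext1 x
      unfold trunc
      split_ifs with hx
      · exact hω _ (by rw [dot_add_left]; omega)
      · rfl
    rw [this]
  have e1 : averaged P 0 (S ∩ pairShift n ⁻¹' F)
      = ∫⁻ ω, ∑' h, f h ω * G (shift (extend h n) ω) ∂P := by
    rw [averaged_markov P n hS hSp hF, ← lintegral_indicator hS, lintegral_averaged]
    · refine lintegral_congr fun ω => ?_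
      rw [lintegral_path_eq_tsum _ n]
      refine tsum_congr fun h => ?_
      have : ∫⁻ X in cyl (extend h) n, S.indicator (fun p => quenched (shift (p.2 n) p.1) 0
            (Prod.mk (shift (p.2 n) p.1) ⁻¹' F)) (ω, X) ∂(quenched ω 0)
          = ∫⁻ X in cyl (extend h) n, (Prod.mk ω ⁻¹' S).indicator
            (fun _ => G (shift (extend h n) ω)) X ∂(quenched ω 0) := by
        refine setLIntegral_congr_fun (measurableSet_cyl _ n) fun X hX => ?_
        rw [← hX n le_rfl]
        rfl
      rw [this, lintegral_indicator_const (hslice ω), Measure.restrict_apply (hslice ω), mul_comm]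
    · exact (hGm.comp (measurable_shift_path n)).indicator hS
  have e2 : averaged P 0 S = ∫⁻ ω, ∑' h, f h ω ∂P := by
    rw [averaged_apply _ hS]
    exact lintegral_congr fun ω => measure_path_eq_tsum _ n (hslice ω)
  rw [e1, e2, lintegral_tsum fun h => (hfm h).aemeasurable, lintegral_tsum
      (f := fun h ω => f h ω * G (shift (extend h n) ω)) fun h =>
    ((hfm h).mul (hGm.comp (measurable_shift _))).aemeasurable, ← ENNReal.tsum_mul_right]
  refine tsum_congr fun h => ?_
  rw [lintegral_mul_of_local ν u (dot (extend h n) u + ℓ) (hfm h)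
    (g := fun ω => G (shift (extend h n) ω)) (hGm.comp (measurable_shift _)) (hfloc h)
    (hGloc (extend h n)),
    ← lintegral_map hGm (measurable_shift _), map_shift_iidLaw, averaged_apply _ hF]

/-! ### Exponential estimates for the non-nestling walk -/

/-- The weight `exp (-s z · u)`. -/
noncomputable def expWeight {d : ℕ} (u : Site d) (s : ℝ) (z : Site d) : ℝ≥0∞ :=
  ENNReal.ofReal (Real.exp (-s * dot z u))

/-- The quenched exponential moment of one step against the direction `u` is at most `ρ`. -/
def ExpDrift {d : ℕ} (u : Site d) (s : ℝ) (ρ : ℝ≥0∞) (ω : Env d) : Prop :=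
  ∑' z, ENNReal.ofReal (trans ω 0 z) * expWeight u s z ≤ ρ

/-- `ExpDrift` along the whole environment process started from `μ`. -/
def UniformDrift {d : ℕ} (u : Site d) (s : ℝ) (ρ : ℝ≥0∞) (μ : Measure (Env d)) : Prop :=
  ∀ n, ∀ᵐ ω ∂(envLaw μ n), ExpDrift u s ρ ω

theorem quenched_step {d : ℕ} (ω : Env d) (z : Site d) :
    quenched ω 0 {X | X 1 = z} = ENNReal.ofReal (trans ω 0 z) := by
  let x : Path d := fun i => if i = 0 then 0 else z
  have h : quenched ω 0 (cyl x 1) = ENNReal.ofReal (trans ω 0 z) := by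
    rw [quenched_cyl_succ, quenched_cyl_zero]
    simp [x]
  rw [← h]
  refine measure_congr ?_
  filter_upwards [ae_quenched_zero ω 0] with X hX
  refine propext ⟨fun h1 i hi => ?_, fun h1 => h1 1 le_rfl⟩
  have h1' : X 1 = z := h1
  rcases Nat.le_one_iff_eq_zero_or_eq_one.1 hi with rfl | rfl
  · simp [x, hX]
  · simp [x, h1']

theorem lintegral_quenched_step {d : ℕ} (ω : Env d) (f : Site d → ℝ≥0∞) :
    ∫⁻ X, f (X 1) ∂(quenched ω 0) = ∑' z, ENNReal.ofReal (trans ω 0 z) * f z := by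
  rw [← lintegral_map (f := f) (measurable_of_countable f) (measurable_pi_apply 1),
    lintegral_countable']
  refine tsum_congr fun z => ?_
  rw [Measure.map_apply (measurable_pi_apply 1) (measurableSet_singleton z), mul_comm]
  congr 1
  exact quenched_step ω z

theorem measurable_trans {d : ℕ} (x y : Site d) : Measurable fun ω : Env d => trans ω x y :=
  (measurable_pi_apply _).comp (measurable_subtype_coe.comp (measurable_pi_apply _))

theorem isHalf_expDrift {d : ℕ} (u : Site d) (s : ℝ) (ρ : ℝ≥0∞) :
    IsHalf u 0 {ω : Env d | ExpDrift u s ρ ω} := by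
  have hm : Measurable fun ω : Env d => ∑' z, ENNReal.ofReal (trans ω 0 z) * expWeight u s z :=
    Measurable.tsum fun z => (measurable_trans 0 z).ennreal_ofReal.mul_const _
  refine isHalf_of_measurable hm (fun ω => ?_) measurableSet_Iic
  simp [trans, trunc_apply_of_le]

theorem expWeight_add {d : ℕ} (u : Site d) (s : ℝ) (y z : Site d) :
    expWeight u s (y + z) = expWeight u s y * expWeight u s z := by
  rw [expWeight, expWeight, expWeight, ← ENNReal.ofReal_mul (Real.exp_pos _).le, ← Real.exp_add,
    dot_add_left]
  congr 2
  push_cast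
  ring

theorem measurable_expWeight_path {d : ℕ} (u : Site d) (s : ℝ) (n : ℕ) :
    Measurable fun p : Env d × Path d => expWeight u s (p.2 n) :=
  (measurable_of_countable (expWeight u s)).comp ((measurable_pi_apply n).comp measurable_snd)

theorem UniformDrift.envLaw {d : ℕ} {u : Site d} {s : ℝ} {ρ : ℝ≥0∞} {μ : Measure (Env d)}
    [SFinite μ] (h : UniformDrift u s ρ μ) (n : ℕ) : UniformDrift u s ρ (envLaw μ n) := by
  intro m
  rw [← envLaw_add]
  exact h (n + m)

theorem lintegral_expWeight_le {d : ℕ} {u : Site d} {s : ℝ} {ρ : ℝ≥0∞} {μ : Measure (Env d)}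
    [IsProbabilityMeasure μ] (h : UniformDrift u s ρ μ) (n : ℕ) :
    ∫⁻ p, expWeight u s (p.2 n) ∂(averaged μ 0) ≤ ρ ^ n := by
  induction n with
  | zero =>
    have : ∫⁻ p, expWeight u s (p.2 0) ∂(averaged μ 0) = ∫⁻ _, 1 ∂(averaged μ 0) := by
      refine lintegral_congr_ae ?_
      filter_upwards [ae_averaged_zero μ] with p hp
      simp [hp, expWeight]
    rw [this]
    simp
  | succ n ih =>
    have e : ∀ p : Env d × Path d, expWeight u s (p.2 (n + 1))
        = expWeight u s (p.2 n) * expWeight u s ((pairShift n p).2 1) := by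
      intro p
      rw [← expWeight_add]
      simp [pairShift, tail]
    simp_rw [e]
    rw [lintegral_averaged_markov μ n (measurable_expWeight_path u s n)
      (fun ω X Y hXY => by simp [hXY n le_rfl]) (measurable_expWeight_path u s 1)]
    calc _ ≤ ∫⁻ p, expWeight u s (p.2 n) * ρ ∂(averaged μ 0) := by
          refine lintegral_mono_ae ?_
          filter_upwards [ae_of_ae_map (measurable_shift_path n).aemeasurable (h n)] with p hp
          gcongr
          have := lintegral_quenched_step (shift (p.2 n) p.1) (expWeight u s)
          exact this.trans_le hp
      _ ≤ ρ ^ (n + 1) := by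
          rw [lintegral_mul_const _ (measurable_expWeight_path u s n), pow_succ]
          gcongr

theorem one_le_mul_expWeight {d : ℕ} {u : Site d} {s : ℝ} (hs : 0 ≤ s) {L : ℝ} {z : Site d}
    (h : (dot z u : ℝ) ≤ -L) : 1 ≤ ENNReal.ofReal (Real.exp (-s * L)) * expWeight u s z := by
  rw [expWeight, ← ENNReal.ofReal_mul (Real.exp_pos _).le, ← Real.exp_add, ENNReal.one_le_ofReal]
  refine Real.one_le_exp ?_
  nlinarith

theorem measurableSet_dot {d : ℕ} (u : Site d) (n : ℕ) (B : Set ℤ) :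
    MeasurableSet {p : Env d × Path d | dot (p.2 n) u ∈ B} :=
  ((measurable_dot_path u n).comp measurable_snd) (Set.to_countable B).measurableSet

theorem averaged_dot_le {d : ℕ} {u : Site d} {s : ℝ} (hs : 0 ≤ s) {ρ : ℝ≥0∞}
    {μ : Measure (Env d)} [IsProbabilityMeasure μ] (h : UniformDrift u s ρ μ) (n : ℕ) (L : ℝ) :
    averaged μ 0 {p | (dot (p.2 n) u : ℝ) ≤ -L}
      ≤ ENNReal.ofReal (Real.exp (-s * L)) * ρ ^ n := by
  have hm : MeasurableSet {p : Env d × Path d | (dot (p.2 n) u : ℝ) ≤ -L} :=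
    measurableSet_dot u n {k : ℤ | (k : ℝ) ≤ -L}
  calc averaged μ 0 {p | (dot (p.2 n) u : ℝ) ≤ -L}
      = ∫⁻ _ in {p : Env d × Path d | (dot (p.2 n) u : ℝ) ≤ -L}, 1 ∂(averaged μ 0) := by simp
    _ ≤ ∫⁻ p in {p : Env d × Path d | (dot (p.2 n) u : ℝ) ≤ -L},
          ENNReal.ofReal (Real.exp (-s * L)) * expWeight u s (p.2 n) ∂(averaged μ 0) :=
        setLIntegral_mono' hm fun p hp => one_le_mul_expWeight hs hp
    _ ≤ ∫⁻ p, ENNReal.ofReal (Real.exp (-s * L)) * expWeight u s (p.2 n) ∂(averaged μ 0) :=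
        setLIntegral_le_lintegral _ _
    _ ≤ _ := by
        rw [lintegral_const_mul _ (measurable_expWeight_path u s n)]
        gcongr
        exact lintegral_expWeight_le h n

theorem averaged_exists_dot_le {d : ℕ} {u : Site d} {s : ℝ} (hs : 0 ≤ s) {ρ : ℝ≥0∞}
    {μ : Measure (Env d)} [IsProbabilityMeasure μ] (h : UniformDrift u s ρ μ) (L : ℝ) :
    averaged μ 0 {p | ∃ n, (dot (p.2 n) u : ℝ) ≤ -L}
      ≤ ENNReal.ofReal (Real.exp (-s * L)) * (1 - ρ)⁻¹ := by
  rw [Set.ofPred_exists]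
  refine (measure_iUnion_le _).trans ?_
  rw [← ENNReal.tsum_geometric, ← ENNReal.tsum_mul_left]
  exact ENNReal.tsum_le_tsum fun n => averaged_dot_le hs h n L

theorem averaged_exists_overshoot {d : ℕ} {u : Site d} {s : ℝ} (hs : 0 ≤ s) {ρ : ℝ≥0∞}
    {μ : Measure (Env d)} [IsProbabilityMeasure μ] (h : UniformDrift u s ρ μ) (n : ℕ) (L : ℝ) :
    averaged μ 0 {p | ∃ j < n, (dot (p.2 n) u : ℝ) + L ≤ dot (p.2 j) u}
      ≤ ENNReal.ofReal (Real.exp (-s * L)) * (1 - ρ)⁻¹ := by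
  have hj : ∀ j < n, averaged μ 0 {p | (dot (p.2 n) u : ℝ) + L ≤ dot (p.2 j) u}
      ≤ ENNReal.ofReal (Real.exp (-s * L)) * ρ ^ (n - j) := by
    intro j hj
    have e : {p : Env d × Path d | (dot (p.2 n) u : ℝ) + L ≤ dot (p.2 j) u}
        = pairShift j ⁻¹' {p | (dot (p.2 (n - j)) u : ℝ) ≤ -L} := by
      ext p
      simp only [pairShift, tail, Set.mem_ofPred_eq, Set.mem_preimage, dot_sub_left,
        Nat.add_sub_cancel' hj.le, Int.cast_sub]
      constructor <;> intro h <;> linarith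
    have hm : MeasurableSet {p : Env d × Path d | (dot (p.2 (n - j)) u : ℝ) ≤ -L} :=
      measurableSet_dot u (n - j) {k : ℤ | (k : ℝ) ≤ -L}
    rw [e, averaged_preimage_pairShift _ _ hm]
    exact averaged_dot_le hs (h.envLaw j) _ _
  have e : {p : Env d × Path d | ∃ j < n, (dot (p.2 n) u : ℝ) + L ≤ dot (p.2 j) u}
      = ⋃ j ∈ Finset.range n, {p | (dot (p.2 n) u : ℝ) + L ≤ dot (p.2 j) u} := by
    ext p; simp
  rw [e]
  refine (measure_biUnion_finset_le _ _).trans ?_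
  calc _ ≤ ∑ j ∈ Finset.range n, ENNReal.ofReal (Real.exp (-s * L)) * ρ ^ (n - j) :=
        Finset.sum_le_sum fun j hj' => hj j (Finset.mem_range.1 hj')
    _ = ENNReal.ofReal (Real.exp (-s * L)) * ∑ j ∈ Finset.range n, ρ ^ (j + 1) := by
        rw [← Finset.mul_sum, ← Finset.sum_range_reflect]
        congr 1
        refine Finset.sum_congr rfl fun j hj => ?_
        have := Finset.mem_range.1 hj
        congr 1
        omega
    _ ≤ _ := by
        gcongr
        rw [← ENNReal.tsum_geometric]
        exact (ENNReal.sum_le_tsum (f := fun j => ρ ^ (j + 1)) _).trans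
          (ENNReal.tsum_comp_le_tsum_of_injective (add_left_injective 1) (fun n => ρ ^ n))

theorem one_sub_inv_ne_top {ρ : ℝ≥0∞} (hρ : ρ < 1) : (1 - ρ)⁻¹ ≠ ∞ :=
  ENNReal.inv_ne_top.2 (tsub_pos_of_lt hρ).ne'

/-- The walk is transient in the direction `u`. -/
theorem ae_tendsto_dot {d : ℕ} {u : Site d} {s : ℝ} (hs : 0 ≤ s) {ρ : ℝ≥0∞} (hρ : ρ < 1)
    {μ : Measure (Env d)} [IsProbabilityMeasure μ] (h : UniformDrift u s ρ μ) :
    ∀ᵐ p ∂(averaged μ 0), Tendsto (fun n => dot (p.2 n) u) atTop atTop := by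
  have hK : ∀ K : ℕ, ∀ᵐ p ∂(averaged μ 0), ∀ᶠ n in atTop, ¬ ((dot (p.2 n) u : ℝ) ≤ -(-K : ℝ)) := by
    intro K
    refine ae_eventually_notMem (s := fun n => {p : Env d × Path d |
      (dot (p.2 n) u : ℝ) ≤ -(-K : ℝ)}) (ne_top_of_le_ne_top ?_
        (ENNReal.tsum_le_tsum fun n => averaged_dot_le hs h n (-K)))
    rw [ENNReal.tsum_mul_left, ENNReal.tsum_geometric]
    exact ENNReal.mul_ne_top ENNReal.ofReal_ne_top (one_sub_inv_ne_top hρ)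
  filter_upwards [ae_all_iff.2 hK] with p hp
  refine tendsto_atTop.2 fun b => ?_
  filter_upwards [hp b.toNat] with n hn
  simp only [neg_neg, not_le] at hn
  have h2 : (b.toNat : ℤ) < dot (p.2 n) u := by exact_mod_cast hn
  omega

theorem quenched_step_up {d : ℕ} {u : Site d} {s : ℝ} (hs : 0 ≤ s) {ρ : ℝ≥0∞} {ω : Env d}
    (h : ExpDrift u s ρ ω) : 1 - ρ ≤ quenched ω 0 {X | 1 ≤ dot (X 1) u} := by
  have hm : MeasurableSet {X : Path d | 1 ≤ dot (X 1) u} :=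
    measurableSet_le measurable_const (measurable_dot_path u 1)
  have hc : quenched ω 0 {X | 1 ≤ dot (X 1) u}ᶜ ≤ ρ := by
    calc _ = ∫⁻ _ in {X : Path d | 1 ≤ dot (X 1) u}ᶜ, 1 ∂(quenched ω 0) := by simp
      _ ≤ ∫⁻ X in {X : Path d | 1 ≤ dot (X 1) u}ᶜ, expWeight u s (X 1) ∂(quenched ω 0) := by
          refine setLIntegral_mono' hm.compl fun X hX => ?_
          have hX' : dot (X 1) u < 1 := not_le.1 hX
          have h0 : dot (X 1) u ≤ 0 := by omega
          have := one_le_mul_expWeight (u := u) (L := 0) (z := X 1) hs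
            (by simpa using (Int.cast_le (R := ℝ)).2 h0)
          simpa using this
      _ ≤ ∫⁻ X, expWeight u s (X 1) ∂(quenched ω 0) := setLIntegral_le_lintegral _ _
      _ ≤ ρ := (lintegral_quenched_step ω _).trans_le h
  rw [← compl_compl {X : Path d | 1 ≤ dot (X 1) u}, prob_compl_eq_one_sub hm.compl]
  exact tsub_le_tsub_left hc 1

/-- The event that all levels visited before time `n` are less than `k` levels above the position
at time `n`; for `k = 0`, the walk is at a strict record. -/
def nearRecord {d : ℕ} (u : Site d) (k : ℤ) (n : ℕ) : Set (Path d) :=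
  {X | ∀ j < n, dot (X j) u < dot (X n) u + k}

theorem measurableSet_nearRecord {d : ℕ} (u : Site d) (k : ℤ) (n : ℕ) :
    MeasurableSet (nearRecord u k n) := by
  have : nearRecord u k n = ⋂ j, ⋂ (_ : j < n), {X : Path d | dot (X j) u < dot (X n) u + k} := by
    ext X; simp [nearRecord]
  rw [this]
  exact MeasurableSet.iInter fun j => MeasurableSet.iInter fun _ =>
    measurableSet_lt (measurable_dot_path u j) ((measurable_dot_path u n).add_const k)

theorem nearRecord_congr {d : ℕ} {u : Site d} {k : ℤ} {n : ℕ} {X Y : Path d}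
    (h : ∀ i ≤ n, X i = Y i) : X ∈ nearRecord u k n ↔ Y ∈ nearRecord u k n := by
  simp only [nearRecord, Set.mem_ofPred_eq, h n le_rfl]
  exact forall₂_congr fun j hj => by rw [h j hj.le]

theorem averaged_nearRecord_succ {d : ℕ} {u : Site d} {s : ℝ} (hs : 0 ≤ s) {ρ : ℝ≥0∞}
    {μ : Measure (Env d)} [IsProbabilityMeasure μ] (h : UniformDrift u s ρ μ) (n k : ℕ) :
    (1 - ρ) * averaged μ 0 (Prod.snd ⁻¹' nearRecord u (k + 1) n)
      ≤ averaged μ 0 (Prod.snd ⁻¹' nearRecord u k (n + 1)) := by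
  have hS : MeasurableSet (Prod.snd ⁻¹' nearRecord u (k + 1) n : Set (Env d × Path d)) :=
    measurable_snd (measurableSet_nearRecord u _ n)
  have hF : MeasurableSet {p : Env d × Path d | 1 ≤ dot (p.2 1) u} :=
    measurableSet_dot u 1 (Set.Ici 1)
  have hsub : Prod.snd ⁻¹' nearRecord u (k + 1) n
      ∩ pairShift n ⁻¹' {p : Env d × Path d | 1 ≤ dot (p.2 1) u}
      ⊆ Prod.snd ⁻¹' nearRecord u k (n + 1) := by
    rintro p ⟨h1, h2⟩ j hj
    simp only [pairShift, tail, Set.mem_preimage, Set.mem_ofPred_eq, dot_sub_left] at h2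
    rcases Nat.lt_succ_iff_lt_or_eq.1 hj with hj | rfl
    · have := h1 j hj
      omega
    · omega
  refine le_trans ?_ (measure_mono hsub)
  rw [averaged_markov μ n hS (fun ω X Y hXY => nearRecord_congr hXY) hF, ← setLIntegral_const]
  refine lintegral_mono_ae ?_
  filter_upwards [ae_restrict_of_ae
    (ae_of_ae_map (measurable_shift_path n).aemeasurable (h n))] with p hp
  exact quenched_step_up hs hp

/-- Strict records have probability bounded below at all large times. -/
theorem exists_le_averaged_record {d : ℕ} {u : Site d} {s : ℝ} (hs : 0 < s) {ρ : ℝ≥0∞}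
    (hρ : ρ < 1) {μ : Measure (Env d)} [IsProbabilityMeasure μ] (h : UniformDrift u s ρ μ) :
    ∃ c : ℝ≥0∞, 0 < c ∧ ∃ n₀ : ℕ, ∀ n, n₀ ≤ n →
      c ≤ averaged μ 0 (Prod.snd ⁻¹' nearRecord u 0 n) := by
  have hlim : Tendsto (fun K : ℕ => ENNReal.ofReal (Real.exp (-s * K)) * (1 - ρ)⁻¹) atTop
      (𝓝 0) := by
    have h1 : Tendsto (fun K : ℕ => ENNReal.ofReal (Real.exp (-s * K))) atTop (𝓝 0) := by
      rw [← ENNReal.ofReal_zero]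
      refine ENNReal.tendsto_ofReal ?_
      refine Real.tendsto_exp_atBot.comp ?_
      exact tendsto_natCast_atTop_atTop.const_mul_atTop_of_neg (by linarith)
    have := ENNReal.Tendsto.mul_const h1 (Or.inr (one_sub_inv_ne_top hρ))
    simpa using this
  obtain ⟨K, hK⟩ := (hlim.eventually_lt_const (u := (2⁻¹ : ℝ≥0∞))
    (ENNReal.inv_pos.2 ENNReal.ofNat_ne_top)).exists
  -- `K` is so large that a lead of more than `K` levels of an earlier maximum over the
  -- current position has probability at most `1/2`.
  have hbase : ∀ n, 2⁻¹ ≤ averaged μ 0 (Prod.snd ⁻¹' nearRecord u K n) := by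
    intro n
    have hm : MeasurableSet (Prod.snd ⁻¹' nearRecord u K n : Set (Env d × Path d)) :=
      measurable_snd (measurableSet_nearRecord u _ n)
    have hc : averaged μ 0 (Prod.snd ⁻¹' nearRecord u K n)ᶜ ≤ 2⁻¹ := by
      refine le_trans (measure_mono ?_) ((averaged_exists_overshoot hs.le h n K).trans hK.le)
      intro p hp
      simp only [nearRecord, Set.mem_compl_iff, Set.mem_preimage, Set.mem_ofPred_eq, not_forall,
        not_lt] at hp
      obtain ⟨j, hj, hle⟩ := hp
      exact ⟨j, hj, by exact_mod_cast hle⟩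
    rw [← compl_compl (Prod.snd ⁻¹' nearRecord u K n), prob_compl_eq_one_sub hm.compl,
      ← ENNReal.one_sub_inv_two]
    exact tsub_le_tsub_left hc 1
  have hstep : ∀ i, i ≤ K → ∀ n,
      (1 - ρ) ^ i * 2⁻¹ ≤ averaged μ 0 (Prod.snd ⁻¹' nearRecord u ((K - i : ℕ) : ℤ) (n + i)) := by
    intro i
    induction i with
    | zero => intro _ n; simpa using hbase n
    | succ i ih =>
      intro hi n
      have h1 := ih (by omega) n
      have h2 := averaged_nearRecord_succ hs.le h (n + i) (K - (i + 1))
      have e : ((K - (i + 1) : ℕ) : ℤ) + 1 = ((K - i : ℕ) : ℤ) := by omega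
      rw [e] at h2
      refine le_trans ?_ h2
      rw [pow_succ', mul_assoc]
      gcongr
  refine ⟨(1 - ρ) ^ K * 2⁻¹, ?_, K, fun n hn => ?_⟩
  · refine ENNReal.mul_pos (pow_ne_zero _ (tsub_pos_of_lt hρ).ne') (by simp)
  · have := hstep K le_rfl (n - K)
    simpa [Nat.sub_add_cancel hn] using this

/-! ### The exponential drift condition from the hypotheses on the steps -/

theorem abs_dot_le {d : ℕ} (x y : Site d) : |(dot x y : ℝ)| ≤ eNorm x * eNorm y := by
  rw [eNorm, eNorm, ← Real.sqrt_mul (Finset.sum_nonneg fun i _ => sq_nonneg _)]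
  refine Real.abs_le_sqrt ?_
  have := Finset.sum_mul_sq_le_sq_mul_sq Finset.univ (fun i => (x i : ℝ)) (fun i => (y i : ℝ))
  simpa [dot] using this

theorem exp_neg_le {x : ℝ} : Real.exp (-x) ≤ 1 - x + x ^ 2 * Real.exp |x| := by
  have h := Complex.norm_exp_sub_sum_le_norm_mul_exp ((-x : ℝ) : ℂ) 2
  have e : Complex.exp ((-x : ℝ) : ℂ)
      - ∑ m ∈ Finset.range 2, ((-x : ℝ) : ℂ) ^ m / (m.factorial : ℂ)
      = ((Real.exp (-x) - (1 - x) : ℝ) : ℂ) := by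
    simp [Finset.sum_range_succ]
    ring
  rw [e, Complex.norm_real, Complex.norm_real, Real.norm_eq_abs, Real.norm_eq_abs, abs_neg,
    sq_abs] at h
  linarith [(abs_le.1 h).2]

/-- Second-order expansion of `exp (-s X₁ · u)`: the drift contributes `-s δ`, and `s` is chosen so
small that the quadratic term, controlled by the exponential moment, is at most half of that. -/
theorem exists_expDrift {d : ℕ} {u : Site d} {μ : Measure (Env d)} (hN : HypothesisN u μ)
    (hM : HypothesisM μ) :
    ∃ (s : ℝ) (ρ : ℝ≥0∞), 0 < s ∧ ρ < 1 ∧ ∀ᵐ ω ∂μ, ExpDrift u s ρ ω := by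
  obtain ⟨δ, hδ, hN⟩ := hN
  obtain ⟨M, s₀, hM0, hs₀, hM⟩ := hM
  set V : ℝ := eNorm u + 1 with hV
  have hV0 : 0 < V := by
    have : 0 ≤ eNorm u := Real.sqrt_nonneg _
    linarith
  set C : ℝ := 8 * V ^ 2 / s₀ ^ 2 with hC
  have hC0 : 0 < C := by positivity
  set E : ℝ := Real.exp (s₀ * M) with hE
  have hE0 : 0 < E := Real.exp_pos _
  set s : ℝ := min (s₀ / (2 * V)) (δ / (2 * C * E)) with hs
  have hs0 : 0 < s := by positivity
  have hs1 : s * V ≤ s₀ / 2 := by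
    have : s ≤ s₀ / (2 * V) := min_le_left _ _
    calc s * V ≤ s₀ / (2 * V) * V := by gcongr
      _ = s₀ / 2 := by field_simp
  have hs2 : s * (C * E) ≤ δ / 2 := by
    have : s ≤ δ / (2 * C * E) := min_le_right _ _
    calc s * (C * E) ≤ δ / (2 * C * E) * (C * E) := by gcongr
      _ = δ / 2 := by field_simp
  refine ⟨s, ENNReal.ofReal (1 - s * δ / 2), hs0, ?_, ?_⟩
  · rw [ENNReal.ofReal_lt_one]
    have : 0 < s * δ := by positivity
    linarith
  filter_upwards [hN, hM] with ω hNω hMω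
  have h0 : ∀ z, 0 ≤ trans ω 0 z := fun z => (ω 0).2.1 _
  have h1 : HasSum (fun z => trans ω 0 z) 1 := by
    simpa [trans] using (ω 0).2.2
  have hpt : ∀ z : Site d, trans ω 0 z * Real.exp (-s * dot z u)
      ≤ trans ω 0 z - s * ((dot z u : ℝ) * trans ω 0 z)
        + s ^ 2 * C * (Real.exp (s₀ * eNorm z) * trans ω 0 z) := by
    intro z
    have hz : 0 ≤ eNorm z := Real.sqrt_nonneg _
    have ht : |(dot z u : ℝ)| ≤ V * eNorm z := by
      refine (abs_dot_le z u).trans ?_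
      nlinarith
    have ha := exp_neg_le (x := s * dot z u)
    have hb : Real.exp |s * (dot z u : ℝ)| ≤ Real.exp (s₀ * eNorm z / 2) := by
      refine Real.exp_le_exp.2 ?_
      rw [abs_mul, abs_of_pos hs0]
      calc s * |(dot z u : ℝ)| ≤ s * (V * eNorm z) := by gcongr
        _ = s * V * eNorm z := by ring
        _ ≤ s₀ / 2 * eNorm z := by gcongr
        _ = _ := by ring
    have hc : (s * (dot z u : ℝ)) ^ 2 ≤ s ^ 2 * C * Real.exp (s₀ * eNorm z / 2) := by
      have h3 := Real.quadratic_le_exp_of_nonneg (x := s₀ * eNorm z / 2) (by positivity)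
      have h4 : (dot z u : ℝ) ^ 2 ≤ (V * eNorm z) ^ 2 := by
        rw [← sq_abs]
        gcongr
      have h5 : (V * eNorm z) ^ 2 = C * ((s₀ * eNorm z / 2) ^ 2 / 2) := by
        rw [hC]; field_simp; ring
      have h6 : (s₀ * eNorm z / 2) ^ 2 / 2 ≤ Real.exp (s₀ * eNorm z / 2) := by
        have : 0 ≤ s₀ * eNorm z / 2 := by positivity
        linarith
      rw [mul_pow, mul_assoc]
      gcongr
      rw [h5] at h4
      exact h4.trans (by gcongr)
    have hd : (s * (dot z u : ℝ)) ^ 2 * Real.exp |s * (dot z u : ℝ)|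
        ≤ s ^ 2 * C * Real.exp (s₀ * eNorm z) := by
      calc _ ≤ s ^ 2 * C * Real.exp (s₀ * eNorm z / 2) * Real.exp (s₀ * eNorm z / 2) := by
            gcongr
        _ = s ^ 2 * C * Real.exp (s₀ * eNorm z) := by
            rw [mul_assoc, ← Real.exp_add]; ring_nf
    have he : Real.exp (-s * dot z u) ≤ 1 - s * dot z u + s ^ 2 * C * Real.exp (s₀ * eNorm z) := by
      rw [neg_mul]; linarith
    calc _ ≤ trans ω 0 z * (1 - s * dot z u + s ^ 2 * C * Real.exp (s₀ * eNorm z)) :=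
          mul_le_mul_of_nonneg_left he (h0 z)
      _ = _ := by ring
  have hsumm := (h1.sub (hNω.1.hasSum.mul_left s)).add (hMω.1.hasSum.mul_left (s ^ 2 * C))
  have hn : ∀ z : Site d, 0 ≤ trans ω 0 z * Real.exp (-s * dot z u) := fun z =>
    mul_nonneg (h0 z) (Real.exp_pos _).le
  have hsl : Summable fun z : Site d => trans ω 0 z * Real.exp (-s * dot z u) :=
    Summable.of_nonneg_of_le hn hpt hsumm.summable
  have hle := hsl.hasSum.tsum_eq.symm ▸ hasSum_le hpt hsl.hasSum hsumm
  have e : ∑' z, ENNReal.ofReal (trans ω 0 z) * expWeight u s z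
      = ENNReal.ofReal (∑' z : Site d, trans ω 0 z * Real.exp (-s * dot z u)) := by
    rw [ENNReal.ofReal_tsum_of_nonneg hn hsl]
    exact tsum_congr fun z => (ENNReal.ofReal_mul (h0 z)).symm
  rw [ExpDrift, e]
  refine ENNReal.ofReal_le_ofReal (hle.trans ?_)
  have h2 := hNω.2
  have h3 := hMω.2
  have h4 : s * δ ≤ s * ∑' z : Site d, (dot z u : ℝ) * trans ω 0 z := by gcongr
  have h5 : s ^ 2 * C * (∑' z : Site d, Real.exp (s₀ * eNorm z) * trans ω 0 z)
      ≤ s ^ 2 * C * E := by gcongr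
  have h6 : s ^ 2 * C * E ≤ s * (δ / 2) := by
    calc s ^ 2 * C * E = s * (s * (C * E)) := by ring
      _ ≤ _ := by gcongr
  linarith

theorem uniformDrift_iidLaw {d : ℕ} {ν : Measure (ProbVec d)} [IsProbabilityMeasure ν]
    {u : Site d} {s : ℝ} {ρ : ℝ≥0∞} (h : ∀ᵐ ω ∂(iidLaw ν), ExpDrift u s ρ ω) :
    UniformDrift u s ρ (iidLaw ν) :=
  fun n => (envLaw_iidLaw_absolutelyContinuous ν n).ae_le h

theorem uniformDrift_of_invariant {d : ℕ} {μ : Measure (Env d)} [SFinite μ] (hμ : envLaw μ 1 = μ)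
    {u : Site d} {s : ℝ} {ρ : ℝ≥0∞} (h : ∀ᵐ ω ∂μ, ExpDrift u s ρ ω) :
    UniformDrift u s ρ μ := fun n => by rwa [envLaw_of_invariant hμ n]

/-! ### Regeneration times -/

/-- `k` is a regeneration time of the path `X`: a strict record in direction `u` below which the
path never falls afterwards. -/
def IsRegen {d : ℕ} (u : Site d) (X : Path d) (k : ℕ) : Prop :=
  X ∈ nearRecord u 0 k ∧ tail k X ∈ staysAbove u 0

theorem isRegen_iff {d : ℕ} {u : Site d} {X : Path d} {k : ℕ} :
    IsRegen u X k ↔ (∀ j < k, dot (X j) u < dot (X k) u) ∧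
      ∀ j, k ≤ j → dot (X k) u ≤ dot (X j) u := by
  simp only [IsRegen, nearRecord, staysAbove, tail, Set.mem_ofPred_eq, add_zero, dot_sub_left,
    sub_nonneg]
  refine and_congr_right fun _ => ⟨fun h j hj => ?_, fun h j => h _ (by omega)⟩
  have := h (j - k)
  rwa [Nat.add_sub_cancel' hj] at this

theorem measurableSet_isRegen {d : ℕ} (u : Site d) (k : ℕ) :
    MeasurableSet {X : Path d | IsRegen u X k} :=
  (measurableSet_nearRecord u 0 k).inter (measurable_tail k (measurableSet_staysAbove u 0))

/-- The regeneration times after a regeneration time are those of the path seen from there. -/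
theorem isRegen_tail_iff {d : ℕ} {u : Site d} {X : Path d} {k j : ℕ} (hk : IsRegen u X k)
    (hj : 0 < j) : IsRegen u (tail k X) j ↔ IsRegen u X (k + j) := by
  rw [isRegen_iff] at *
  rw [isRegen_iff]
  simp only [tail, dot_sub_left, sub_lt_sub_iff_right, sub_le_sub_iff_right]
  constructor
  · rintro ⟨h1, h2⟩
    refine ⟨fun i hi => ?_, fun i hi => ?_⟩
    · rcases lt_or_ge i k with h | h
      · exact (hk.1 i h).trans_le (hk.2 _ (by omega))
      · have := h1 (i - k) (by omega)
        rwa [Nat.add_sub_cancel' h] at this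
    · have := h2 (i - k) (by omega)
      rwa [Nat.add_sub_cancel' (by omega : k ≤ i)] at this
  · rintro ⟨h1, h2⟩
    exact ⟨fun i hi => h1 _ (by omega), fun i hi => h2 _ (by omega)⟩

theorem measurableSet_snd_staysAbove {d : ℕ} (u : Site d) (ℓ : ℤ) :
    MeasurableSet (Prod.snd ⁻¹' staysAbove u ℓ : Set (Env d × Path d)) :=
  measurable_snd (measurableSet_staysAbove u ℓ)

theorem exists_forall_dot_le {d : ℕ} {u : Site d} {X : Path d}
    (h : Tendsto (fun n => dot (X n) u) atTop atTop) : ∃ k, ∀ j, dot (X k) u ≤ dot (X j) u := by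
  rw [← Nat.cofinite_eq_atTop] at h
  exact h.exists_forall_le

/-- The walk never falls below its starting level with positive probability: otherwise it could
not attain its global minimum. -/
theorem averaged_staysAbove_pos {d : ℕ} {u : Site d} {s : ℝ} (hs : 0 ≤ s) {ρ : ℝ≥0∞} (hρ : ρ < 1)
    {μ : Measure (Env d)} [IsProbabilityMeasure μ] (h : UniformDrift u s ρ μ)
    (hac : ∀ n, envLaw μ n ≪ μ) :
    0 < averaged μ 0 (Prod.snd ⁻¹' staysAbove u 0) := by
  rw [pos_iff_ne_zero]
  intro h0
  have hk : ∀ k, averaged μ 0 (pairShift k ⁻¹' (Prod.snd ⁻¹' staysAbove u 0)) = 0 := by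
    intro k
    rw [averaged_preimage_pairShift μ k (measurableSet_snd_staysAbove u 0)]
    exact averaged_absolutelyContinuous (hac k) h0
  have h1 : ∀ᵐ p ∂(averaged μ 0), ∀ k, p ∉ pairShift k ⁻¹' (Prod.snd ⁻¹' staysAbove u 0) :=
    ae_all_iff.2 fun k => measure_eq_zero_iff_ae_notMem.1 (hk k)
  obtain ⟨p, hp1, hp2⟩ := (h1.and (ae_tendsto_dot hs hρ h)).exists
  obtain ⟨k, hk⟩ := exists_forall_dot_le hp2
  refine hp1 k fun j => ?_
  simp only [pairShift, tail, dot_sub_left]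
  have := hk (k + j)
  omega

/-- A Lévy 0-1 law: an event whose conditional probability given the past is infinitely often
bounded below almost surely happens. -/
theorem ae_mem_of_frequently {d : ℕ} (m : Measure (Path d)) [IsProbabilityMeasure m]
    {N : Set (Path d)} (hN : MeasurableSet N) {q : ℝ} (hq : 0 < q) {R : ℕ → Set (Path d)}
    (hR : ∀ n, MeasurableSet[Filtration.piLE (X := fun _ : ℕ => Site d) n] (R n))
    (hfreq : ∀ᵐ X ∂m, ∃ᶠ n in atTop, X ∈ R n)
    (hle : ∀ n S, MeasurableSet[Filtration.piLE (X := fun _ : ℕ => Site d) n] S →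
      q * m.real (S ∩ R n) ≤ m.real (S ∩ N)) :
    ∀ᵐ X ∂m, X ∈ N := by
  set ℱ := Filtration.piLE (X := fun _ : ℕ => Site d) with hℱ
  have hsup : ⨆ n, ℱ n = (inferInstance : MeasurableSpace (Path d)) := by
    apply le_antisymm
    · exact iSup_le fun n => ℱ.le n
    · refine iSup_le fun n => ?_
      refine le_trans ?_ (le_iSup _ n)
      rw [hℱ, Filtration.piLE_eq_comap_frestrictLe, ← measurable_iff_comap_le]
      have h1 : Measurable fun h : ((i : Finset.Iic n) → Site d) =>
          h ⟨n, Finset.mem_Iic.2 le_rfl⟩ := measurable_pi_apply _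
      exact h1.comp (comap_measurable _)
  have hint : Integrable (N.indicator (1 : Path d → ℝ)) m :=
    (integrable_const (1 : ℝ)).indicator hN
  have hlim := hint.tendsto_ae_condExp (ℱ := ℱ) (by
    rw [hsup]
    exact stronglyMeasurable_one.indicator hN)
  have hcond : ∀ n, ∀ᵐ X ∂m, (R n).indicator (fun _ => q) X
      ≤ (m[N.indicator (1 : Path d → ℝ) | ℱ n]) X := by
    intro n
    have hsm : StronglyMeasurable[ℱ n] ((R n).indicator (fun _ => q)) :=
      stronglyMeasurable_const.indicator (hR n)
    have hi1 : Integrable ((R n).indicator (fun _ => q)) m :=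
      (integrable_const q).indicator (ℱ.le n _ (hR n))
    refine ae_of_ae_trim (ℱ.le n) ?_
    refine ae_le_of_forall_setIntegral_le (hi1.trim (ℱ.le n) hsm)
      (integrable_condExp.trim (ℱ.le n) stronglyMeasurable_condExp) fun S hS _ => ?_
    rw [← setIntegral_trim (ℱ.le n) hsm hS,
      ← setIntegral_trim (ℱ.le n) stronglyMeasurable_condExp hS,
      setIntegral_condExp (ℱ.le n) hint hS, integral_indicator_const _ (ℱ.le n _ (hR n)),
      integral_indicator_one hN, smul_eq_mul, mul_comm]
    simp only [measureReal_def]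
    rw [Measure.restrict_apply (ℱ.le n _ (hR n)), Measure.restrict_apply hN, Set.inter_comm,
      Set.inter_comm N]
    exact hle n S hS
  filter_upwards [hlim, ae_all_iff.2 hcond, hfreq] with X h1 h2 h3
  by_contra hX
  rw [Set.indicator_of_notMem hX] at h1
  have h4 := h1.eventually_lt_const hq
  obtain ⟨n, hn1, hn2⟩ := (h3.and_eventually h4).exists
  have := h2 n
  rw [Set.indicator_of_mem hn1] at this
  linarith

theorem exists_record_ge {d : ℕ} {u : Site d} {X : Path d}
    (h : Tendsto (fun n => dot (X n) u) atTop atTop) (L : ℤ) (n₀ : ℕ) :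
    ∃ n, n₀ ≤ n ∧ X ∈ nearRecord u 0 n ∧ L ≤ dot (X n) u := by
  classical
  obtain ⟨B, hB⟩ : ∃ B : ℤ, ∀ j ≤ n₀, dot (X j) u < B := by
    obtain ⟨B, hB⟩ := ((Set.finite_Iic n₀).image fun j => dot (X j) u).bddAbove
    refine ⟨B + 1, fun j hj => ?_⟩
    have := hB ⟨j, hj, rfl⟩
    dsimp only at this
    omega
  have hex : ∃ n, max L B ≤ dot (X n) u := (h.eventually_ge_atTop (max L B)).exists
  refine ⟨Nat.find hex, ?_, fun j hj => ?_, (le_max_left _ _).trans (Nat.find_spec hex)⟩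
  · by_contra hlt
    have h1 := hB (Nat.find hex) (by omega)
    have h2 := (le_max_right L B).trans (Nat.find_spec hex)
    omega
  · have h1 := Nat.find_min hex hj
    have h2 := Nat.find_spec hex
    omega

/-- What happens after a strict record in the half-space above it is independent of the past
up to that record. -/
theorem averaged_record_fresh {d : ℕ} (ν : Measure (ProbVec d)) [IsProbabilityMeasure ν]
    (u : Site d) (n : ℕ) {E : Set (Env d)} (hE : MeasurableSet E) {L : ℤ}
    (hEL : ∀ ω ω' : Env d, (∀ x, dot x u < L → ω x = ω' x) → (ω ∈ E ↔ ω' ∈ E))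
    {S : Set (Path d)} (hS : MeasurableSet S)
    (hSp : ∀ X Y : Path d, (∀ i ≤ n, X i = Y i) → (X ∈ S ↔ Y ∈ S))
    {F : Set (Env d × Path d)} (hF : MeasurableSet F)
    (hFloc : ∀ ω, quenched (trunc u 0 ω) 0 (Prod.mk (trunc u 0 ω) ⁻¹' F)
      = quenched ω 0 (Prod.mk ω ⁻¹' F)) :
    averaged (iidLaw ν) 0 ({p | p.1 ∈ E ∧ p.2 ∈ S ∧ p.2 ∈ nearRecord u 0 n ∧ L ≤ dot (p.2 n) u}
        ∩ pairShift n ⁻¹' F)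
      = averaged (iidLaw ν) 0
          {p | p.1 ∈ E ∧ p.2 ∈ S ∧ p.2 ∈ nearRecord u 0 n ∧ L ≤ dot (p.2 n) u}
        * averaged (iidLaw ν) 0 F := by
  refine averaged_fresh ν u n 0 ?_ ?_ ?_ ?_ hF hFloc
  · exact (measurable_fst hE).inter ((measurable_snd hS).inter
      ((measurable_snd (measurableSet_nearRecord u 0 n)).inter (measurableSet_dot u n (Set.Ici L))))
  · intro ω X Y hXY
    simp only [Set.mem_ofPred_eq, hSp X Y hXY, nearRecord_congr hXY, hXY n le_rfl]
  · rintro ω X ⟨-, -, h, -⟩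
    exact h
  · intro ω ω' X hω
    simp only [Set.mem_ofPred_eq]
    constructor
    · rintro ⟨h1, h2, h3, h4⟩
      exact ⟨(hEL ω ω' fun x hx => hω x (by omega)).1 h1, h2, h3, h4⟩
    · rintro ⟨h1, h2, h3, h4⟩
      exact ⟨(hEL ω ω' fun x hx => hω x (by omega)).2 h1, h2, h3, h4⟩

/-- Almost surely there is a regeneration above every level. -/
theorem ae_exists_isRegen {d : ℕ} {ν : Measure (ProbVec d)} [IsProbabilityMeasure ν]
    {u : Site d} {s : ℝ} (hs : 0 ≤ s) {ρ : ℝ≥0∞} (hρ : ρ < 1)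
    (h : UniformDrift u s ρ (iidLaw ν)) (L : ℤ) :
    ∀ᵐ p ∂(averaged (iidLaw ν) 0), ∃ k, IsRegen u p.2 k ∧ L ≤ dot (p.2 k) u := by
  set m := (averaged (iidLaw ν) 0).map Prod.snd with hm
  have : IsProbabilityMeasure m := Measure.isProbabilityMeasure_map measurable_snd.aemeasurable
  set N : Set (Path d) := {X | ∃ k, IsRegen u X k ∧ L ≤ dot (X k) u} with hNdef
  have hN : MeasurableSet N := by
    rw [hNdef, Set.ofPred_exists]
    exact MeasurableSet.iUnion fun k => (measurableSet_isRegen u k).inter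
      (measurableSet_le measurable_const (measurable_dot_path u k))
  set q : ℝ := (averaged (iidLaw ν) 0).real (Prod.snd ⁻¹' staysAbove u 0) with hq
  have hq0 : 0 < q := by
    refine ENNReal.toReal_pos (averaged_staysAbove_pos hs hρ h
      (envLaw_iidLaw_absolutelyContinuous ν)).ne' (measure_ne_top _ _)
  -- Lévy zero-one law along the times at which the walk is at a strict record above level `L`:
  -- given the past of such a time, it is a regeneration time with probability at least `q`.
  set R : ℕ → Set (Path d) := fun n => {X | X ∈ nearRecord u 0 n ∧ L ≤ dot (X n) u}
  have hRm : ∀ n, MeasurableSet (R n) := fun n => (measurableSet_nearRecord u 0 n).inter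
    (measurableSet_le measurable_const (measurable_dot_path u n))
  suffices h' : ∀ᵐ X ∂m, X ∈ N from ae_of_ae_map measurable_snd.aemeasurable h'
  refine ae_mem_of_frequently m hN hq0 (R := R) ?_ ?_ ?_
  · intro n
    rw [Filtration.piLE_eq_comap_frestrictLe]
    refine ⟨{h | extend h ∈ R n}, (Set.to_countable _).measurableSet, ?_⟩
    ext X
    simp only [Set.mem_preimage, Set.mem_ofPred_eq, R]
    have hX : ∀ i ≤ n, extend (Preorder.frestrictLe (π := fun _ : ℕ => Site d) n X) i = X i :=
      fun i hi => ((mem_cyl_extend_iff _ X).2 rfl i hi).symm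
    rw [nearRecord_congr hX, hX n le_rfl]
  · rw [hm]
    refine (ae_map_iff measurable_snd.aemeasurable ?_).2 ?_
    · have : {X : Path d | ∃ᶠ n in atTop, X ∈ R n} = limsup R atTop := by
        rw [limsup_eq_iInf_iSup_of_nat]
        ext X
        simp [frequently_atTop]
      rw [this]
      exact MeasurableSet.measurableSet_limsup hRm
    · filter_upwards [ae_tendsto_dot hs hρ h] with p hp
      rw [frequently_atTop]
      intro n₀
      exact exists_record_ge hp L n₀
  · intro n S hS
    have hSm : MeasurableSet S := Filtration.piLE.le n _ hS
    rw [Filtration.piLE_eq_comap_frestrictLe] at hS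
    obtain ⟨T, -, rfl⟩ := hS
    have key := averaged_record_fresh ν u n (E := Set.univ) MeasurableSet.univ (L := L) (by simp)
      hSm (fun X Y hXY => by
        have : Preorder.frestrictLe (π := fun _ : ℕ => Site d) n X
            = Preorder.frestrictLe (π := fun _ : ℕ => Site d) n Y :=
          funext fun i => hXY i.1 (Finset.mem_Iic.1 i.2)
        simp only [Set.mem_preimage, this])
      (measurableSet_snd_staysAbove u 0) (fun ω => by
        have := quenched_trunc_staysAbove u 0 ω MeasurableSet.univ
        rw [Set.univ_inter] at this
        exact this)
    simp only [measureReal_def, hm]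
    rw [Measure.map_apply measurable_snd (hSm.inter (hRm n)),
      Measure.map_apply measurable_snd (hSm.inter hN), hq, measureReal_def, ← ENNReal.toReal_mul,
      mul_comm]
    refine ENNReal.toReal_mono (measure_ne_top _ _) ?_
    have e : (Prod.snd ⁻¹' (Preorder.frestrictLe (π := fun _ : ℕ => Site d) n ⁻¹' T ∩ R n)
        : Set (Env d × Path d))
        = {p | p.1 ∈ Set.univ ∧ p.2 ∈ Preorder.frestrictLe (π := fun _ : ℕ => Site d) n ⁻¹' T ∧
          p.2 ∈ nearRecord u 0 n ∧ L ≤ dot (p.2 n) u} := by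
      ext p
      simp [R]
    rw [e, ← key]
    refine measure_mono ?_
    rintro p ⟨⟨-, h1, h2, h3⟩, h4⟩
    exact ⟨h1, n, ⟨h2, h4⟩, h3⟩

/-! ### Cesàro averages of convolutions -/

/-- The averages `(1/N) ∑_{n < N} a n`. -/
noncomputable def cesaro (a : ℕ → ℝ) (N : ℕ) : ℝ := (N : ℝ)⁻¹ * ∑ n ∈ Finset.range N, a n

theorem cesaro_add (a b : ℕ → ℝ) (N : ℕ) :
    cesaro (fun n => a n + b n) N = cesaro a N + cesaro b N := by
  simp [cesaro, Finset.sum_add_distrib, mul_add]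

theorem cesaro_sub (a b : ℕ → ℝ) (N : ℕ) :
    cesaro (fun n => a n - b n) N = cesaro a N - cesaro b N := by
  simp [cesaro, Finset.sum_sub_distrib, mul_sub]

theorem cesaro_const_mul (c : ℝ) (a : ℕ → ℝ) (N : ℕ) :
    cesaro (fun n => c * a n) N = c * cesaro a N := by
  simp [cesaro, ← Finset.mul_sum, mul_left_comm]

theorem cesaro_mono {a b : ℕ → ℝ} (h : ∀ n, a n ≤ b n) (N : ℕ) : cesaro a N ≤ cesaro b N := by
  unfold cesaro
  gcongr
  exact h _

theorem tendsto_cesaro {a : ℕ → ℝ} {l : ℝ} (h : Tendsto a atTop (𝓝 l)) :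
    Tendsto (cesaro a) atTop (𝓝 l) := h.cesaro

theorem tendsto_cesaro_const (c : ℝ) : Tendsto (cesaro fun _ => c) atTop (𝓝 c) :=
  tendsto_cesaro tendsto_const_nhds

theorem abs_cesaro_le {a : ℕ → ℝ} {c : ℝ} (hc : 0 ≤ c) (h : ∀ n, |a n| ≤ c) (N : ℕ) :
    |cesaro a N| ≤ c := by
  rcases Nat.eq_zero_or_pos N with rfl | hN
  · simpa [cesaro] using hc
  · have hN' : (0 : ℝ) < N := Nat.cast_pos.2 hN
    rw [cesaro, abs_mul, abs_of_nonneg (inv_nonneg.2 hN'.le), inv_mul_le_iff₀ hN']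
    refine (Finset.abs_sum_le_sum_abs _ _).trans ?_
    refine (Finset.sum_le_sum fun n _ => h n).trans ?_
    simp

theorem sum_convolution (v h : ℕ → ℝ) (N : ℕ) :
    ∑ n ∈ Finset.range N, ∑ k ∈ Finset.range (n + 1), v k * h (n - k)
      = ∑ k ∈ Finset.range N, v k * ∑ m ∈ Finset.range (N - k), h m := by
  induction N with
  | zero => simp
  | succ N ih =>
    rw [Finset.sum_range_succ, ih, Finset.sum_range_succ, Finset.sum_range_succ, ← add_assoc,
      ← Finset.sum_add_distrib]
    congr 1
    · refine Finset.sum_congr rfl fun k hk => ?_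
      have hk := Finset.mem_range.1 hk
      rw [← mul_add, Nat.sub_add_comm hk.le, Finset.sum_range_succ]
    · simp

/-- The averages of a convolution with a summable nonnegative sequence. -/
theorem tendsto_cesaro_convolution_sub {v h : ℕ → ℝ} (hv : ∀ n, |v n| ≤ 1) (hh : ∀ n, 0 ≤ h n)
    (hs : Summable h) :
    Tendsto (fun N => (∑' m, h m) * cesaro v N
      - cesaro (fun n => ∑ k ∈ Finset.range (n + 1), v k * h (n - k)) N) atTop (𝓝 0) := by
  set r : ℕ → ℝ := fun j => (∑' m, h m) - ∑ m ∈ Finset.range j, h m with hr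
  have hr0 : ∀ j, 0 ≤ r j := fun j => sub_nonneg.2 (hs.sum_le_tsum _ fun i _ => hh i)
  have hrl : Tendsto (fun j => r (j + 1)) atTop (𝓝 0) := by
    have h1 : Tendsto r atTop (𝓝 ((∑' m, h m) - ∑' m, h m)) :=
      tendsto_const_nhds.sub hs.hasSum.tendsto_sum_nat
    rw [sub_self] at h1
    exact h1.comp (tendsto_add_atTop_nat 1)
  refine squeeze_zero_norm (fun N => ?_) (tendsto_cesaro hrl)
  rw [Real.norm_eq_abs]
  have e : (∑' m, h m) * cesaro v N
      - cesaro (fun n => ∑ k ∈ Finset.range (n + 1), v k * h (n - k)) N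
      = (N : ℝ)⁻¹ * ∑ k ∈ Finset.range N, v k * r (N - k) := by
    rw [cesaro, cesaro, sum_convolution]
    simp only [hr, mul_sub, Finset.sum_sub_distrib]
    rw [← Finset.sum_mul]
    ring
  rw [e, abs_mul, abs_of_nonneg (inv_nonneg.2 (Nat.cast_nonneg N)), cesaro]
  gcongr
  refine (Finset.abs_sum_le_sum_abs _ _).trans ?_
  rw [← Finset.sum_range_reflect (fun j => r (j + 1))]
  refine Finset.sum_le_sum fun k hk => ?_
  have hk := Finset.mem_range.1 hk
  rw [abs_mul, abs_of_nonneg (hr0 _), (by omega : N - 1 - k + 1 = N - k)]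
  exact mul_le_of_le_one_left (hr0 _) (hv k)

/-! ### The last regeneration and the local limits of the environment process -/

/-- The path is at level at least `b` at time `m`, and has no regeneration time in `(0, m]` at
depth at least `b` below that position. -/
def noLaterRegen {d : ℕ} (u : Site d) (b : ℤ) (m : ℕ) : Set (Path d) :=
  {Y | b ≤ dot (Y m) u ∧
    ∀ j, 0 < j → j ≤ m → dot (Y j) u + b ≤ dot (Y m) u → ¬ IsRegen u Y j}

theorem measurableSet_noLaterRegen {d : ℕ} (u : Site d) (b : ℤ) (m : ℕ) :
    MeasurableSet (noLaterRegen u b m) := by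
  have : noLaterRegen u b m = {Y : Path d | b ≤ dot (Y m) u} ∩
      ⋂ j, ⋂ (_ : 0 < j), ⋂ (_ : j ≤ m),
        ({Y : Path d | dot (Y j) u + b ≤ dot (Y m) u}ᶜ ∪ {Y : Path d | IsRegen u Y j}ᶜ) := by
    ext Y
    simp only [noLaterRegen, Set.mem_ofPred_eq, Set.mem_inter_iff, Set.mem_iInter, Set.mem_union,
      Set.mem_compl_iff]
    refine and_congr_right fun _ => forall_congr' fun j => forall₂_congr fun _ _ => ?_
    exact imp_iff_not_or
  rw [this]
  exact (measurableSet_le measurable_const (measurable_dot_path u m)).inter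
    (MeasurableSet.iInter fun j => MeasurableSet.iInter fun _ => MeasurableSet.iInter fun _ =>
      (measurableSet_le ((measurable_dot_path u j).add_const b) (measurable_dot_path u m)).compl.union
        (measurableSet_isRegen u j).compl)

/-- The event, for a walk that starts with a regeneration, that no regeneration of depth `b` below
the current position occurs in `(0, m]` and the environment seen at time `m` is in `A`. -/
def gapEvent {d : ℕ} (u : Site d) (b : ℤ) (A : Set (Env d)) (m : ℕ) : Set (Env d × Path d) :=
  {p | shift (p.2 m) p.1 ∈ A ∧ p.2 ∈ noLaterRegen u b m ∧ p.2 ∈ staysAbove u 0}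

theorem measurableSet_gapEvent {d : ℕ} (u : Site d) (b : ℤ) {A : Set (Env d)}
    (hA : MeasurableSet A) (m : ℕ) : MeasurableSet (gapEvent u b A m) :=
  (measurable_shift_path m hA).inter ((measurable_snd (measurableSet_noLaterRegen u b m)).inter
    (measurable_snd (measurableSet_staysAbove u 0)))

theorem quenched_gapEvent_trunc {d : ℕ} {u : Site d} {b : ℤ} {A : Set (Env d)}
    (hA : IsHalf u (-b) A) (m : ℕ) (ω : Env d) :
    quenched (trunc u 0 ω) 0 (Prod.mk (trunc u 0 ω) ⁻¹' gapEvent u b A m)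
      = quenched ω 0 (Prod.mk ω ⁻¹' gapEvent u b A m) := by
  set B : Set (Path d) := {X | shift (X m) ω ∈ A ∧ X ∈ noLaterRegen u b m} with hB
  have hBm : MeasurableSet B := by
    have h : Measurable fun X : Path d => shift (X m) ω :=
      (measurable_shift_path m).comp measurable_prodMk_left
    exact (h hA.1).inter (measurableSet_noLaterRegen u b m)
  have e1 : Prod.mk ω ⁻¹' gapEvent u b A m = B ∩ staysAbove u 0 := by
    ext X
    simp [gapEvent, hB, and_assoc]
  have e2 : Prod.mk (trunc u 0 ω) ⁻¹' gapEvent u b A m = B ∩ staysAbove u 0 := by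
    ext X
    simp only [gapEvent, hB, Set.mem_preimage, Set.mem_ofPred_eq, Set.mem_inter_iff, and_assoc]
    refine and_congr_left fun hX => ?_
    have hlev : 0 ≤ -b + dot (X m) u := by have := hX.1.1; omega
    exact ((hA.preimage_shift (X m)).mono hlev).mem_iff ω
  rw [e1, e2, quenched_trunc_staysAbove u 0 ω hBm]

/-- `k ≤ n` is a regeneration time at level at least `L`, at depth at least `b` below `X n`. -/
def IsDeepRegen {d : ℕ} (u : Site d) (L b : ℤ) (n : ℕ) (X : Path d) (k : ℕ) : Prop :=
  IsRegen u X k ∧ L ≤ dot (X k) u ∧ dot (X k) u + b ≤ dot (X n) u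

/-- The event that `k` is a strict record at level at least `L`, and that the environment is
in `E`. -/
def recordEvent {d : ℕ} (u : Site d) (E : Set (Env d)) (L : ℤ) (k : ℕ) : Set (Env d × Path d) :=
  {p | p.1 ∈ E ∧ p.2 ∈ nearRecord u 0 k ∧ L ≤ dot (p.2 k) u}

theorem measurableSet_recordEvent {d : ℕ} (u : Site d) {E : Set (Env d)} (hE : MeasurableSet E)
    (L : ℤ) (k : ℕ) : MeasurableSet (recordEvent u E L k) :=
  (measurable_fst hE).inter
    ((measurable_snd (measurableSet_nearRecord u 0 k)).inter (measurableSet_dot u k (Set.Ici L)))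

/-- The event that `k` is the last deep regeneration time up to time `n`. -/
theorem mem_recordEvent_inter_iff {d : ℕ} {u : Site d} {E A : Set (Env d)} {L b : ℤ} {k n : ℕ}
    (hkn : k ≤ n) (p : Env d × Path d) :
    p ∈ recordEvent u E L k ∩ pairShift k ⁻¹' gapEvent u b A (n - k) ↔
      p.1 ∈ E ∧ shift (p.2 n) p.1 ∈ A ∧ IsDeepRegen u L b n p.2 k ∧
        ∀ j, k < j → j ≤ n → ¬ IsDeepRegen u L b n p.2 j := by
  obtain ⟨m, rfl⟩ := Nat.exists_eq_add_of_le hkn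
  simp only [Set.mem_inter_iff, Set.mem_preimage, gapEvent, Set.mem_ofPred_eq, shift_pairShift,
    Nat.add_sub_cancel_left]
  simp only [recordEvent, Set.mem_ofPred_eq, pairShift, IsDeepRegen]
  constructor
  · rintro ⟨⟨h1, h2, h3⟩, h4, ⟨h5, h6⟩, h7⟩
    have hk : IsRegen u p.2 k := ⟨h2, h7⟩
    simp only [tail, dot_sub_left] at h5
    refine ⟨h1, h4, ⟨hk, h3, by omega⟩, fun j hj1 hj2 hj => ?_⟩
    obtain ⟨i, rfl⟩ := Nat.exists_eq_add_of_lt hj1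
    refine h6 (i + 1) (by omega) (by omega) ?_ ((isRegen_tail_iff hk (by omega)).2 hj.1)
    simp only [tail, dot_sub_left, ← add_assoc]
    have := hj.2.2
    omega
  · rintro ⟨h1, h2, ⟨h3, h4, h5⟩, h6⟩
    refine ⟨⟨h1, h3.1, h4⟩, h2, ⟨?_, fun j hj1 hj2 hj3 hj4 => ?_⟩, h3.2⟩
    · simp only [tail, dot_sub_left]
      omega
    · simp only [tail, dot_sub_left] at hj3
      rw [isRegen_tail_iff h3 hj1] at hj4
      have h7 := (isRegen_iff.1 h3).2 (k + j) (by omega)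
      exact h6 (k + j) (by omega) (by omega) ⟨hj4, by omega, by omega⟩

theorem averaged_last_regen {d : ℕ} (ν : Measure (ProbVec d)) [IsProbabilityMeasure ν]
    {u : Site d} {E A : Set (Env d)} {L b : ℤ} (hE : MeasurableSet E)
    (hEL : ∀ ω ω' : Env d, (∀ x, dot x u < L → ω x = ω' x) → (ω ∈ E ↔ ω' ∈ E))
    (hA : IsHalf u (-b) A) (k m : ℕ) :
    (averaged (iidLaw ν) 0).real (recordEvent u E L k ∩ pairShift k ⁻¹' gapEvent u b A m)
      = (averaged (iidLaw ν) 0).real (recordEvent u E L k)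
        * (averaged (iidLaw ν) 0).real (gapEvent u b A m) := by
  have key := averaged_record_fresh ν u k hE hEL (S := Set.univ) MeasurableSet.univ (by simp)
    (measurableSet_gapEvent u b hA.1 m) (quenched_gapEvent_trunc hA m)
  have e : recordEvent u E L k
      = {p | p.1 ∈ E ∧ p.2 ∈ Set.univ ∧ p.2 ∈ nearRecord u 0 k ∧ L ≤ dot (p.2 k) u} := by
    ext p
    simp [recordEvent]
  rw [measureReal_def, e, key, ENNReal.toReal_mul, measureReal_def, measureReal_def]

/-- The event that there is no deep regeneration time up to time `n`. -/
def noDeepRegen {d : ℕ} (u : Site d) (L b : ℤ) (n : ℕ) : Set (Env d × Path d) :=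
  {p | ∀ k ≤ n, ¬ IsDeepRegen u L b n p.2 k}

theorem measurableSet_noDeepRegen {d : ℕ} (u : Site d) (L b : ℤ) (n : ℕ) :
    MeasurableSet (noDeepRegen u L b n) := by
  have : noDeepRegen u L b n = Prod.snd ⁻¹' ⋂ k, ⋂ (_ : k ≤ n),
      ({X : Path d | IsRegen u X k} ∩ ({X : Path d | L ≤ dot (X k) u} ∩
        {X : Path d | dot (X k) u + b ≤ dot (X n) u}))ᶜ := by
    ext p
    simp [noDeepRegen, IsDeepRegen]
  rw [this]
  exact measurable_snd (MeasurableSet.iInter fun k => MeasurableSet.iInter fun _ =>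
    ((measurableSet_isRegen u k).inter ((measurableSet_le measurable_const
      (measurable_dot_path u k)).inter (measurableSet_le ((measurable_dot_path u k).add_const b)
        (measurable_dot_path u n)))).compl)

theorem tendsto_noDeepRegen {d : ℕ} {ν : Measure (ProbVec d)} [IsProbabilityMeasure ν]
    {u : Site d} {s : ℝ} (hs : 0 ≤ s) {ρ : ℝ≥0∞} (hρ : ρ < 1)
    (h : UniformDrift u s ρ (iidLaw ν)) (L b : ℤ) :
    Tendsto (fun n => (averaged (iidLaw ν) 0).real (noDeepRegen u L b n)) atTop (𝓝 0) := by
  have key := tendsto_measure_of_ae_tendsto_indicator_of_isFiniteMeasure (L := atTop)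
    (μ := averaged (iidLaw ν) 0) (A := ∅) (As := noDeepRegen u L b) MeasurableSet.empty
    (measurableSet_noDeepRegen u L b) (by
      filter_upwards [ae_exists_isRegen hs hρ h L, ae_tendsto_dot hs hρ h] with p hp1 hp2
      obtain ⟨k, hk1, hk2⟩ := hp1
      filter_upwards [hp2.eventually_ge_atTop (dot (p.2 k) u + b), eventually_ge_atTop k]
        with n hn1 hn2
      simp only [Set.mem_empty_iff_false, iff_false]
      exact fun hc => hc k hn2 ⟨hk1, hk2, hn1⟩)
  rw [measure_empty] at key
  have h2 := (ENNReal.tendsto_toReal ENNReal.zero_ne_top).comp key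
  rw [ENNReal.toReal_zero] at h2
  exact h2

/-- The renewal decomposition according to the last deep regeneration time. -/
theorem renewal_decomposition {d : ℕ} (ν : Measure (ProbVec d)) [IsProbabilityMeasure ν]
    {u : Site d} {E A : Set (Env d)} {L b : ℤ} (hE : MeasurableSet E)
    (hEL : ∀ ω ω' : Env d, (∀ x, dot x u < L → ω x = ω' x) → (ω ∈ E ↔ ω' ∈ E))
    (hA : IsHalf u (-b) A) (n : ℕ) :
    let Q := averaged (iidLaw ν) 0
    let c := ∑ k ∈ Finset.range (n + 1),
      Q.real (recordEvent u E L k) * Q.real (gapEvent u b A (n - k))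
    c ≤ Q.real {p | p.1 ∈ E ∧ shift (p.2 n) p.1 ∈ A} ∧
      Q.real {p | p.1 ∈ E ∧ shift (p.2 n) p.1 ∈ A} ≤ c + Q.real (noDeepRegen u L b n) := by
  classical
  intro Q c
  set V : ℕ → Set (Env d × Path d) :=
    fun k => recordEvent u E L k ∩ pairShift k ⁻¹' gapEvent u b A (n - k) with hV
  have hVm : ∀ k, MeasurableSet (V k) := fun k => (measurableSet_recordEvent u hE L k).inter
    (measurable_pairShift k (measurableSet_gapEvent u b hA.1 _))
  have hmem : ∀ k ≤ n, ∀ p, p ∈ V k ↔ _ := fun k hk p => mem_recordEvent_inter_iff hk p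
  have hdisj : Set.PairwiseDisjoint (↑(Finset.range (n + 1))) V := by
    intro i hi j hj hij
    refine Set.disjoint_left.2 fun p hpi hpj => ?_
    have hi' : i ≤ n := by simpa [Nat.lt_succ_iff] using hi
    have hj' : j ≤ n := by simpa [Nat.lt_succ_iff] using hj
    have h1 := (hmem i hi' p).1 hpi
    have h2 := (hmem j hj' p).1 hpj
    rcases lt_or_gt_of_ne hij with hlt | hlt
    · exact h1.2.2.2 j hlt hj' h2.2.2.1
    · exact h2.2.2.2 i hlt hi' h1.2.2.1
  have hc : Q.real (⋃ k ∈ Finset.range (n + 1), V k) = c := by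
    rw [measureReal_biUnion_finset hdisj fun k _ => hVm k]
    exact Finset.sum_congr rfl fun k _ => averaged_last_regen ν hE hEL hA k (n - k)
  have hsub : (⋃ k ∈ Finset.range (n + 1), V k) ⊆ {p | p.1 ∈ E ∧ shift (p.2 n) p.1 ∈ A} := by
    refine Set.iUnion₂_subset fun k hk p hp => ?_
    have h1 := (hmem k (Nat.lt_succ_iff.1 (Finset.mem_range.1 hk)) p).1 hp
    exact ⟨h1.1, h1.2.1⟩
  have hsup : {p | p.1 ∈ E ∧ shift (p.2 n) p.1 ∈ A}
      ⊆ (⋃ k ∈ Finset.range (n + 1), V k) ∪ noDeepRegen u L b n := by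
    rintro p ⟨h1, h2⟩
    by_cases hp : p ∈ noDeepRegen u L b n
    · exact Or.inr hp
    · left
      simp only [noDeepRegen, Set.mem_ofPred_eq, not_forall, not_not] at hp
      obtain ⟨k₀, hk₀, hd⟩ := hp
      set k := Nat.findGreatest (IsDeepRegen u L b n p.2) n with hk
      have hkn : k ≤ n := Nat.findGreatest_le n
      have hkd : IsDeepRegen u L b n p.2 k := Nat.findGreatest_spec hk₀ hd
      refine Set.mem_iUnion₂.2 ⟨k, Finset.mem_range.2 (by omega), (hmem k hkn p).2
        ⟨h1, h2, hkd, fun j hj1 hj2 => Nat.findGreatest_is_greatest hj1 hj2⟩⟩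
  rw [← hc]
  exact ⟨measureReal_mono hsub, (measureReal_mono hsup).trans (measureReal_union_le _ _)⟩

/-- By the decomposition at the last deep regeneration, `∑ k ≤ n, v k * h (n - k) ≤ 1`, where `h` is
the sequence in question and the record probabilities `v k` are bounded below for large `k`. -/
theorem summable_gapEvent {d : ℕ} {ν : Measure (ProbVec d)} [IsProbabilityMeasure ν]
    {u : Site d} {s : ℝ} (hs : 0 < s) {ρ : ℝ≥0∞} (hρ : ρ < 1)
    (h : UniformDrift u s ρ (iidLaw ν)) (b : ℤ) :
    Summable fun m => (averaged (iidLaw ν) 0).real (gapEvent u b Set.univ m) := by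
  set Q := averaged (iidLaw ν) 0
  obtain ⟨c, hc0, n₀, hc⟩ := exists_le_averaged_record hs hρ h
  have hc1 : c ≠ ∞ := ne_top_of_le_ne_top (measure_ne_top Q _) (hc n₀ le_rfl)
  have hcr : 0 < c.toReal := ENNReal.toReal_pos hc0.ne' hc1
  -- records of level at least `0` are just records, because the walk starts at level `0`
  have hrec : ∀ k, n₀ ≤ k → c.toReal ≤ Q.real (recordEvent u Set.univ 0 k) := by
    intro k hk
    refine (ENNReal.toReal_mono (measure_ne_top _ _) (hc k hk)).trans ?_
    refine ENNReal.toReal_mono (measure_ne_top _ _) (measure_mono_ae ?_)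
    filter_upwards [ae_averaged_zero (iidLaw ν)] with p hp hpk
    refine ⟨trivial, hpk, ?_⟩
    rcases Nat.eq_zero_or_pos k with rfl | hk
    · simp [hp]
    · have := hpk 0 hk
      rw [hp, dot_zero_left] at this
      omega
  refine summable_of_sum_range_le (c := c.toReal⁻¹) (fun m => measureReal_nonneg) fun N => ?_
  rw [← one_div, le_div_iff₀ hcr, Finset.sum_mul]
  have h1 := (renewal_decomposition ν (u := u) (E := Set.univ) (A := Set.univ) (L := 0) (b := b)
    MeasurableSet.univ (by simp) (isHalf_univ u _) (n₀ + N)).1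
  refine le_trans ?_ (h1.trans measureReal_le_one)
  calc ∑ m ∈ Finset.range N, Q.real (gapEvent u b Set.univ m) * c.toReal
      ≤ ∑ m ∈ Finset.range N, Q.real (recordEvent u Set.univ 0 (n₀ + N - m))
          * Q.real (gapEvent u b Set.univ m) := by
        refine Finset.sum_le_sum fun m hm => ?_
        have hm := Finset.mem_range.1 hm
        rw [mul_comm]
        gcongr
        exact hrec _ (by omega)
    _ ≤ ∑ m ∈ Finset.range (n₀ + N + 1), Q.real (recordEvent u Set.univ 0 (n₀ + N - m))
          * Q.real (gapEvent u b Set.univ m) :=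
        Finset.sum_le_sum_of_subset_of_nonneg (Finset.range_mono (by omega))
          fun m _ _ => mul_nonneg measureReal_nonneg measureReal_nonneg
    _ = _ := by
        rw [← Finset.sum_range_reflect]
        refine Finset.sum_congr rfl fun k hk => ?_
        have hk := Finset.mem_range.1 hk
        rw [(by omega : n₀ + N - (n₀ + N + 1 - 1 - k) = k),
          (by omega : n₀ + N + 1 - 1 - k = n₀ + N - k)]

theorem summable_gapEvent' {d : ℕ} {ν : Measure (ProbVec d)} [IsProbabilityMeasure ν]
    {u : Site d} {s : ℝ} (hs : 0 < s) {ρ : ℝ≥0∞} (hρ : ρ < 1)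
    (h : UniformDrift u s ρ (iidLaw ν)) (b : ℤ) (A : Set (Env d)) :
    Summable fun m => (averaged (iidLaw ν) 0).real (gapEvent u b A m) :=
  Summable.of_nonneg_of_le (fun _ => measureReal_nonneg)
    (fun m => measureReal_mono (show gapEvent u b A m ⊆ gapEvent u b Set.univ m from
      fun _ hp => ⟨trivial, hp.2⟩)) (summable_gapEvent hs hρ h b)

/-- For each `b`, the averaged laws of the environment seen from the walk converge on the events of
`{x · u ≥ -b}` to a probability measure, whatever event of the environment in a lower
half-space is conditioned upon. -/
theorem exists_local_limit {d : ℕ} {ν : Measure (ProbVec d)} [IsProbabilityMeasure ν]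
    {u : Site d} {s : ℝ} (hs : 0 < s) {ρ : ℝ≥0∞} (hρ : ρ < 1)
    (h : UniformDrift u s ρ (iidLaw ν)) (b : ℤ) :
    ∃ G : Measure (Env d), IsProbabilityMeasure G ∧
      ∀ (E A : Set (Env d)) (L : ℤ), MeasurableSet E →
        (∀ ω ω' : Env d, (∀ x, dot x u < L → ω x = ω' x) → (ω ∈ E ↔ ω' ∈ E)) →
        IsHalf u (-b) A →
        Tendsto (cesaro fun n => (averaged (iidLaw ν) 0).real
          {p | p.1 ∈ E ∧ shift (p.2 n) p.1 ∈ A}) atTop (𝓝 ((iidLaw ν).real E * G.real A)) := by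
  set P := iidLaw ν with hP
  set Q := averaged P 0
  set hh : Set (Env d) → ℕ → ℝ := fun A m => Q.real (gapEvent u b A m) with hhh
  have hsum : ∀ A, Summable (hh A) := summable_gapEvent' hs hρ h b
  -- The unnormalized limit law: the environment seen `m` steps after a regeneration time, by a
  -- walk that has met no later regeneration at depth `b`, summed over `m`.
  set H : Measure (Env d) := Measure.sum fun m =>
    (Q.restrict {p | p.2 ∈ noLaterRegen u b m ∧ p.2 ∈ staysAbove u 0}).map
      fun p => shift (p.2 m) p.1 with hH
  have hHA : ∀ A, MeasurableSet A → H A = ENNReal.ofReal (∑' m, hh A m) := by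
    intro A hA
    rw [hH, Measure.sum_apply _ hA, ENNReal.ofReal_tsum_of_nonneg (fun m => measureReal_nonneg)
      (hsum A)]
    refine tsum_congr fun m => ?_
    rw [Measure.map_apply (measurable_shift_path m) hA,
      Measure.restrict_apply (measurable_shift_path m hA)]
    rw [ofReal_measureReal]
    rfl
  have hHr : ∀ A, MeasurableSet A → H.real A = ∑' m, hh A m := by
    intro A hA
    rw [measureReal_def, hHA A hA, ENNReal.toReal_ofReal
      (tsum_nonneg fun m => measureReal_nonneg)]
  set T : ℝ := ∑' m, hh Set.univ m with hT
  -- the convolution structure of the joint probabilities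
  have hdec : ∀ (E A : Set (Env d)) (L : ℤ), MeasurableSet E →
      (∀ ω ω' : Env d, (∀ x, dot x u < L → ω x = ω' x) → (ω ∈ E ↔ ω' ∈ E)) →
      IsHalf u (-b) A →
      Tendsto (fun N => (∑' m, hh A m) * cesaro (fun k => Q.real (recordEvent u E L k)) N
        - cesaro (fun n => Q.real {p | p.1 ∈ E ∧ shift (p.2 n) p.1 ∈ A}) N) atTop (𝓝 0) := by
    intro E A L hE hEL hA
    have h1 := tendsto_cesaro_convolution_sub (v := fun k => Q.real (recordEvent u E L k))
      (h := hh A) (fun n => by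
        rw [abs_of_nonneg measureReal_nonneg]
        exact measureReal_le_one) (fun n => measureReal_nonneg) (hsum A)
    have h2 : Tendsto (fun n => Q.real {p | p.1 ∈ E ∧ shift (p.2 n) p.1 ∈ A}
        - ∑ k ∈ Finset.range (n + 1), Q.real (recordEvent u E L k) * hh A (n - k)) atTop
        (𝓝 0) := by
      refine squeeze_zero (fun n => ?_) (fun n => ?_) (tendsto_noDeepRegen hs.le hρ h L b)
      · have := (renewal_decomposition ν hE hEL hA n).1
        exact sub_nonneg.2 this
      · have := (renewal_decomposition ν hE hEL hA n).2
        rw [sub_le_iff_le_add, add_comm]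
        exact this
    have h3 := h1.sub (tendsto_cesaro h2)
    rw [sub_zero] at h3
    refine h3.congr fun N => ?_
    rw [cesaro_sub]
    ring
  -- With the whole space for `A`, the joint probability is that of `E`; comparing with the
  -- convolution then gives the Cesàro limit of the record frequencies.
  have hE1 : ∀ (E : Set (Env d)), MeasurableSet E →
      (fun n => Q.real {p : Env d × Path d | p.1 ∈ E ∧ shift (p.2 n) p.1 ∈ (Set.univ : Set (Env d))})
        = fun _ => P.real E := by
    intro E hE
    ext1 n
    have : {p : Env d × Path d | p.1 ∈ E ∧ shift (p.2 n) p.1 ∈ (Set.univ : Set (Env d))}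
        = Prod.fst ⁻¹' E := by
      ext p
      simp
    rw [this, measureReal_def, ← Measure.map_apply measurable_fst hE, averaged_fst, measureReal_def]
  -- If the total mass were zero, the Cesàro means of the probability of the whole space would
  -- tend to `0`, although they equal `1`.
  have hT0 : 0 < T := by
    rcases (tsum_nonneg fun m => measureReal_nonneg : 0 ≤ T).lt_or_eq with h0 | h0
    · exact h0
    · have h1 := hdec Set.univ Set.univ 0 MeasurableSet.univ (by simp) (isHalf_univ u _)
      rw [hE1 _ MeasurableSet.univ, show ∑' m, hh Set.univ m = 0 from h0.symm] at h1
      have h2 := (tendsto_cesaro_const (P.real Set.univ)).add h1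
      simp only [zero_mul, zero_sub, add_neg_cancel, add_zero] at h2
      have := tendsto_nhds_unique h2 tendsto_const_nhds
      simp at this
  have hHu : H Set.univ = ENNReal.ofReal T := hHA _ MeasurableSet.univ
  refine ⟨(H Set.univ)⁻¹ • H, ⟨?_⟩, fun E A L hE hEL hA => ?_⟩
  · rw [Measure.smul_apply, smul_eq_mul]
    refine ENNReal.inv_mul_cancel ?_ ?_
    · rw [hHu]
      exact (ENNReal.ofReal_pos.2 hT0).ne'
    · rw [hHu]
      exact ENNReal.ofReal_ne_top
  · have hval : ((H Set.univ)⁻¹ • H).real A = T⁻¹ * ∑' m, hh A m := by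
      rw [measureReal_ennreal_smul_apply, hHr A hA.1, hHu, ENNReal.toReal_inv,
        ENNReal.toReal_ofReal hT0.le]
    rw [hval]
    have h1 := hdec E Set.univ L hE hEL (isHalf_univ u _)
    rw [hE1 E hE] at h1
    have hrec : Tendsto (cesaro fun k => Q.real (recordEvent u E L k)) atTop
        (𝓝 (T⁻¹ * P.real E)) := by
      have h2 := ((tendsto_cesaro_const (P.real E)).add h1).const_mul T⁻¹
      rw [add_zero] at h2
      refine h2.congr fun N => ?_
      rw [add_sub_cancel, ← mul_assoc, inv_mul_cancel₀ hT0.ne', one_mul]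
    have h3 := (hrec.const_mul (∑' m, hh A m)).sub (hdec E A L hE hEL hA)
    rw [sub_zero] at h3
    have e : (∑' m, hh A m) * (T⁻¹ * P.real E) = P.real E * (T⁻¹ * ∑' m, hh A m) := by ring
    rw [← e]
    refine h3.congr fun N => ?_
    ring

/-! ### Extension of consistent half-space laws -/

theorem measurableSet_probVec (d : ℕ) :
    MeasurableSet {p : Site d → ℝ | (∀ z, 0 ≤ p z) ∧ HasSum p 1} := by
  have e : {p : Site d → ℝ | (∀ z, 0 ≤ p z) ∧ HasSum p 1}
      = {p | ∀ z, 0 ≤ p z} ∩ {p | ∑' z, ENNReal.ofReal (p z) = 1} := by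
    ext p
    simp only [Set.mem_ofPred_eq, Set.mem_inter_iff]
    refine and_congr_right fun h0 => ⟨fun h => ?_, fun h => ?_⟩
    · rw [← ENNReal.ofReal_tsum_of_nonneg h0 h.summable, h.tsum_eq, ENNReal.ofReal_one]
    · have hs : Summable p := by
        have := ENNReal.summable_toReal (f := fun z => ENNReal.ofReal (p z)) (by rw [h]; simp)
        simpa [ENNReal.toReal_ofReal (h0 _)] using this
      rw [← ENNReal.ofReal_tsum_of_nonneg h0 hs, ENNReal.ofReal_eq_one] at h
      exact h ▸ hs.hasSum
  rw [e]
  refine MeasurableSet.inter ?_ ?_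
  · rw [Set.ofPred_forall]
    exact MeasurableSet.iInter fun z => measurableSet_le measurable_const (measurable_pi_apply z)
  · exact (Measurable.tsum fun z => (measurable_pi_apply z).ennreal_ofReal)
      (measurableSet_singleton 1)

instance (d : ℕ) : StandardBorelSpace (ProbVec d) := (measurableSet_probVec d).standardBorel

instance (d : ℕ) : Nonempty (ProbVec d) := ⟨filler d⟩

theorem compProd_comap_map {α β γ : Type*} [MeasurableSpace α] [MeasurableSpace β]
    [MeasurableSpace γ] (μ : Measure α) [SFinite μ] {f : α → β} (hf : Measurable f)
    (η : Kernel β γ) [IsSFiniteKernel η] :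
    (μ ⊗ₘ (η.comap f hf)).map (Prod.map f id) = (μ.map f) ⊗ₘ η := by
  ext S hS
  rw [Measure.map_apply (hf.prodMap measurable_id) hS, Measure.compProd_apply
    ((hf.prodMap measurable_id) hS), Measure.compProd_apply hS,
    lintegral_map (Kernel.measurable_kernel_prodMk_left hS) hf]
  rfl

/-- Consistent laws on the events of the half-spaces `{x · u ≥ -b}` extend to a law on the whole
space of environments. The proof runs a Markov chain of environments whose step `n` redraws the
environment below level `-n`, with the conditional law given the rest under the law `n + 1`. -/
theorem exists_extension {d : ℕ} (u : Site d) (G : ℕ → Measure (Env d))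
    [∀ b, IsProbabilityMeasure (G b)]
    (hG : ∀ (b : ℕ) (A : Set (Env d)), IsHalf u (-b) A → G (b + 1) A = G b A) :
    ∃ m : Measure (Env d), IsProbabilityMeasure m ∧
      ∀ (b : ℕ) (A : Set (Env d)), IsHalf u (-b) A → m A = G b A := by
  have hmap : ∀ b : ℕ, (G (b + 1)).map (trunc u (-b)) = (G b).map (trunc u (-b)) := by
    intro b
    ext B hB
    rw [Measure.map_apply (measurable_trunc u _) hB, Measure.map_apply (measurable_trunc u _) hB]
    exact hG b _ (isHalf_preimage_trunc u _ hB)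
  let f : ∀ n : ℕ, ((i : Finset.Iic n) → (fun _ : ℕ => Env d) i) → Env d :=
    fun n h => trunc u (-n) (h ⟨n, Finset.mem_Iic.2 le_rfl⟩)
  have hf : ∀ n, Measurable (f n) := fun n => (measurable_trunc u _).comp (measurable_pi_apply _)
  let η : ∀ n : ℕ, Kernel (Env d) (Env d) := fun n => condDistrib id (trunc u (-n)) (G (n + 1))
  let κ : ∀ n : ℕ, Kernel ((i : Finset.Iic n) → (fun _ : ℕ => Env d) i) (Env d) :=
    fun n => (η n).comap (f n) (hf n)
  let m := Kernel.trajMeasure (X := fun _ : ℕ => Env d) (G 0) κ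
  have hjoint : ∀ n : ℕ, m.map (fun Y : ℕ → Env d => (trunc u (-n) (Y n), Y (n + 1)))
      = ((m.map fun Y => Y n).map (trunc u (-n))) ⊗ₘ η n := by
    intro n
    have h := Kernel.map_frestrictLe_trajMeasure_compProd_eq_map_trajMeasure
      (X := fun _ : ℕ => Env d) (μ₀ := G 0) (κ := κ) (a := n)
    have h2 := congrArg (fun μ => μ.map (Prod.map (f n) id)) h
    simp only [κ] at h2
    rw [compProd_comap_map, Measure.map_map ((hf n).prodMap measurable_id) (by fun_prop),
      Measure.map_map (hf n) (by fun_prop)] at h2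
    rw [Measure.map_map (measurable_trunc u _) (measurable_pi_apply n)]
    exact h2.symm
  have hpm : ∀ n : ℕ, Measurable fun Y : ℕ → Env d => (trunc u (-n) (Y n), Y (n + 1)) := fun n =>
    ((measurable_trunc u _).comp (measurable_pi_apply n)).prodMk (measurable_pi_apply (n + 1))
  have hlaw : ∀ n : ℕ, m.map (fun Y : ℕ → Env d => Y n) = G n := by
    intro n
    induction n with
    | zero =>
      have h1 : (Kernel.traj (X := fun _ : ℕ => Env d) κ 0).map
          (Preorder.frestrictLe 0) = Kernel.id := by
        rw [Kernel.traj_map_frestrictLe, Kernel.partialTraj_self]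
      have h2 : m.map (Preorder.frestrictLe (π := fun _ : ℕ => Env d) 0)
          = (G 0).map
            (MeasurableEquiv.piUnique (fun i : Finset.Iic 0 => (fun _ : ℕ => Env d) i)).symm := by
        simp only [m]
        rw [Kernel.trajMeasure, Measure.map_comp _ _ (by fun_prop), h1]
        exact Measure.id_comp
      have h3 := congrArg (fun μ => μ.map
        (fun h : (i : Finset.Iic 0) → (fun _ : ℕ => Env d) i =>
          h ⟨0, Finset.mem_Iic.2 le_rfl⟩)) h2
      simp only at h3
      rw [Measure.map_map (measurable_pi_apply _) (by fun_prop),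
        Measure.map_map (measurable_pi_apply _) (MeasurableEquiv.measurable _)] at h3
      refine Eq.trans ?_ (h3.trans ?_)
      · rfl
      · exact Measure.map_id
    | succ n ih =>
      have h1 := congrArg (fun μ => μ.map Prod.snd) (hjoint n)
      rw [Measure.map_map measurable_snd (hpm n), ih, ← hmap n,
        compProd_map_condDistrib measurable_id.aemeasurable,
        Measure.map_map measurable_snd ((measurable_trunc u _).prodMk measurable_id)] at h1
      refine h1.trans ?_
      exact Measure.map_id
  have hcons : ∀ n : ℕ, ∀ᵐ Y ∂m, trunc u (-n) (Y (n + 1)) = trunc u (-n) (Y n) := by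
    intro n
    have hms : MeasurableSet {q : Env d × Env d | trunc u (-n) q.2 = q.1} :=
      measurableSet_eq_fun ((measurable_trunc u _).comp measurable_snd) measurable_fst
    have h1 : ∀ᵐ q ∂(m.map (fun Y : ℕ → Env d => (trunc u (-n) (Y n), Y (n + 1)))),
        trunc u (-n) q.2 = q.1 := by
      rw [hjoint n, hlaw n, ← hmap n, compProd_map_condDistrib measurable_id.aemeasurable]
      rw [ae_map_iff ((measurable_trunc u _).prodMk measurable_id).aemeasurable hms]
      exact Eventually.of_forall fun ω => rfl
    exact ae_of_ae_map (hpm n).aemeasurable h1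
  -- The limit environment reads each site at a time after which the trajectory never
  -- redraws it.
  let W : (ℕ → Env d) → Env d := fun Y x => Y (-dot x u).toNat x
  have hW : Measurable W := measurable_pi_lambda _ fun x =>
    (measurable_pi_apply x).comp (measurable_pi_apply (-dot x u).toNat)
  have hWY : ∀ᵐ Y ∂m, ∀ n : ℕ, trunc u (-n) (W Y) = trunc u (-n) (Y n) := by
    filter_upwards [ae_all_iff.2 hcons] with Y hY n
    have hx : ∀ (x : Site d) (k : ℕ), Y ((-dot x u).toNat + k) x = Y (-dot x u).toNat x := by
      intro x k
      induction k with
      | zero => rfl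
      | succ k ih =>
        have h1 := congrFun (hY ((-dot x u).toNat + k)) x
        rw [trunc_apply_of_le _ (by omega), trunc_apply_of_le _ (by omega)] at h1
        rw [← ih, ← h1, add_assoc]
    ext1 x
    unfold trunc
    split_ifs with h
    · have := hx x (n - (-dot x u).toNat)
      rw [Nat.add_sub_cancel' (by omega)] at this
      exact this.symm
    · rfl
  have : IsProbabilityMeasure m := by simp only [m]; infer_instance
  refine ⟨m.map W, Measure.isProbabilityMeasure_map hW.aemeasurable, fun b A hA => ?_⟩
  rw [Measure.map_apply hW hA.1, ← hlaw b, Measure.map_apply (measurable_pi_apply b) hA.1]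
  refine measure_congr ?_
  filter_upwards [hWY] with Y hY
  refine propext ?_
  have h1 := hA.mem_iff (W Y)
  rw [hY b] at h1
  exact h1.symm.trans (hA.mem_iff (Y b))

/-- `G` is the limit law of the environment seen from the walk: in Cesàro average, events of the
environment in upper half-spaces have limiting probabilities given by `G`, independently of the
initial environment in lower half-spaces. -/
def IsLimitLaw {d : ℕ} (ν : Measure (ProbVec d)) [IsProbabilityMeasure ν] (u : Site d)
    (G : Measure (Env d)) : Prop :=
  ∀ (E A : Set (Env d)) (L : ℤ) (b : ℕ), MeasurableSet E →
    (∀ ω ω' : Env d, (∀ x, dot x u < L → ω x = ω' x) → (ω ∈ E ↔ ω' ∈ E)) →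
    IsHalf u (-b) A →
    Tendsto (cesaro fun n => (averaged (iidLaw ν) 0).real
      {p | p.1 ∈ E ∧ shift (p.2 n) p.1 ∈ A}) atTop (𝓝 ((iidLaw ν).real E * G.real A))

theorem exists_limit_law {d : ℕ} {ν : Measure (ProbVec d)} [IsProbabilityMeasure ν]
    {u : Site d} {s : ℝ} (hs : 0 < s) {ρ : ℝ≥0∞} (hρ : ρ < 1)
    (h : UniformDrift u s ρ (iidLaw ν)) :
    ∃ G : Measure (Env d), IsProbabilityMeasure G ∧ IsLimitLaw ν u G := by
  choose G hGp hG using fun b : ℕ => exists_local_limit hs hρ h b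
  obtain ⟨m, hm, hmG⟩ := exists_extension u G (fun b A hA => by
    have h1 := hG b Set.univ A 0 MeasurableSet.univ (by simp) hA
    have h2 := hG (b + 1) Set.univ A 0 MeasurableSet.univ (by simp)
      (hA.mono (by push_cast; omega))
    have h3 := tendsto_nhds_unique h1 h2
    rw [probReal_univ, one_mul, one_mul] at h3
    exact ((measureReal_eq_measureReal_iff).1 h3).symm)
  refine ⟨m, hm, fun E A L b hE hEL hA => ?_⟩
  rw [measureReal_def m, hmG b A hA]
  exact hG b E A L hE hEL hA

/-! ### Loss of memory -/

theorem measurableSet_and_shift {d : ℕ} {E A : Set (Env d)} (hE : MeasurableSet E)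
    (hA : MeasurableSet A) (n : ℕ) :
    MeasurableSet {p : Env d × Path d | p.1 ∈ E ∧ shift (p.2 n) p.1 ∈ A} :=
  (measurable_fst hE).inter (measurable_shift_path n hA)

theorem IsLimitLaw.tendsto {d : ℕ} {ν : Measure (ProbVec d)} [IsProbabilityMeasure ν]
    {u : Site d} {G : Measure (Env d)} (h : IsLimitLaw ν u G) {b : ℕ} {A : Set (Env d)}
    (hA : IsHalf u (-b) A) :
    Tendsto (cesaro fun n => (envLaw (iidLaw ν) n).real A) atTop (𝓝 (G.real A)) := by
  have h1 := h Set.univ A 0 b MeasurableSet.univ (by simp) hA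
  rw [probReal_univ, one_mul] at h1
  refine h1.congr fun N => ?_
  congr 1
  ext1 n
  rw [measureReal_def, measureReal_def, envLaw_apply _ _ hA.1]
  congr 2
  ext p
  simp

theorem tendsto_cesaro_hasSum {a : ℕ → ℕ → ℝ} {l c : ℕ → ℝ} (hc : Summable c)
    (hac : ∀ i n, |a i n| ≤ c i) (h : ∀ i, Tendsto (cesaro (a i)) atTop (𝓝 (l i))) :
    Tendsto (cesaro fun n => ∑' i, a i n) atTop (𝓝 (∑' i, l i)) := by
  have hsum : ∀ n, Summable fun i => a i n := fun n =>
    Summable.of_norm_bounded hc fun i => hac i n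
  have h1 := tendsto_tsum_of_dominated_convergence hc h (Eventually.of_forall fun N i => by
    rw [Real.norm_eq_abs]
    exact abs_cesaro_le ((abs_nonneg _).trans (hac i 0)) (hac i) N)
  refine h1.congr fun N => ?_
  simp only [cesaro]
  rw [tsum_mul_left, Summable.tsum_finsetSum fun n _ => hsum n]

/-- The locality assumption on the initial event can be dropped. -/
theorem IsLimitLaw.tendsto_inter {d : ℕ} {ν : Measure (ProbVec d)} [IsProbabilityMeasure ν]
    {u : Site d} {G : Measure (Env d)} (h : IsLimitLaw ν u G) {b : ℕ} {A : Set (Env d)}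
    (hA : IsHalf u (-b) A) {E : Set (Env d)} (hE : MeasurableSet E) :
    Tendsto (cesaro fun n => (averaged (iidLaw ν) 0).real
      {p | p.1 ∈ E ∧ shift (p.2 n) p.1 ∈ A}) atTop (𝓝 ((iidLaw ν).real E * G.real A)) := by
  set Q := averaged (iidLaw ν) 0
  let C : Set (Set (Env d)) := {E | MeasurableSet E ∧ ∃ L : ℤ,
    ∀ ω ω' : Env d, (∀ x, dot x u < L → ω x = ω' x) → (ω ∈ E ↔ ω' ∈ E)}
  have hgen : (inferInstance : MeasurableSpace (Env d)) = MeasurableSpace.generateFrom C := by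
    apply le_antisymm
    · refine iSup_le fun x => ?_
      rintro _ ⟨B, hB, rfl⟩
      refine MeasurableSpace.measurableSet_generateFrom
        ⟨measurable_pi_apply x hB, dot x u + 1, fun ω ω' hω => ?_⟩
      simp only [Set.mem_preimage, hω x (by omega)]
    · exact MeasurableSpace.generateFrom_le fun E hE => hE.1
  have hpi : IsPiSystem C := by
    rintro E ⟨hE, L, hL⟩ E' ⟨hE', L', hL'⟩ -
    refine ⟨hE.inter hE', max L L', fun ω ω' hω => ?_⟩
    exact and_congr (hL ω ω' fun x hx => hω x (hx.trans_le (le_max_left _ _)))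
      (hL' ω ω' fun x hx => hω x (hx.trans_le (le_max_right _ _)))
  refine MeasurableSpace.induction_on_inter (C := fun E _ => Tendsto (cesaro fun n => Q.real
    {p | p.1 ∈ E ∧ shift (p.2 n) p.1 ∈ A}) atTop (𝓝 ((iidLaw ν).real E * G.real A)))
    hgen hpi ?_ ?_ ?_ ?_ E hE
  · simpa using tendsto_cesaro_const 0
  · rintro E ⟨hE, L, hL⟩
    exact h E A L b hE hL hA
  · intro E hE ih
    have h1 := (h Set.univ A 0 b MeasurableSet.univ (by simp) hA).sub ih
    rw [probReal_univ, ← sub_mul, ← probReal_compl_eq_one_sub hE] at h1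
    refine h1.congr fun N => ?_
    rw [← cesaro_sub]
    congr 1
    ext1 n
    have := measureReal_sdiff (μ := Q) (s₁ := {p | p.1 ∈ Set.univ ∧ shift (p.2 n) p.1 ∈ A})
      (s₂ := {p | p.1 ∈ E ∧ shift (p.2 n) p.1 ∈ A}) (fun p hp => ⟨trivial, hp.2⟩)
      (measurableSet_and_shift hE hA.1 n)
    rw [← this]
    congr 1
    ext p
    simp only [Set.mem_sdiff, Set.mem_ofPred_eq, Set.mem_univ, true_and, Set.mem_compl_iff]
    tauto
  · intro E hd hE ih
    have hs : HasSum (fun i => (iidLaw ν).real (E i)) ((iidLaw ν).real (⋃ i, E i)) := by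
      rw [measureReal_def, measure_iUnion hd hE]
      have hne : ∑' i, iidLaw ν (E i) ≠ ∞ := by
        rw [← measure_iUnion hd hE]
        exact measure_ne_top (iidLaw ν) _
      rw [ENNReal.tsum_toReal_eq fun i => measure_ne_top (iidLaw ν) (E i)]
      exact ENNReal.hasSum_toReal hne
    have h1 := tendsto_cesaro_hasSum hs.summable (fun i n => by
      rw [abs_of_nonneg measureReal_nonneg]
      have e : (iidLaw ν).real (E i) = Q.real (Prod.fst ⁻¹' (E i)) := by
        rw [measureReal_def, measureReal_def, ← Measure.map_apply measurable_fst (hE i),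
          averaged_fst]
      rw [e]
      exact measureReal_mono (show {p : Env d × Path d | p.1 ∈ E i ∧ shift (p.2 n) p.1 ∈ A}
        ⊆ Prod.fst ⁻¹' (E i) from fun p hp => hp.1)) ih
    rw [tsum_mul_right, hs.tsum_eq] at h1
    refine h1.congr fun N => ?_
    congr 1
    ext1 n
    have hd' : Pairwise (Function.onFun Disjoint
        fun i => {p : Env d × Path d | p.1 ∈ E i ∧ shift (p.2 n) p.1 ∈ A}) := fun i j hij =>
      Set.disjoint_left.2 fun p hp hp' => Set.disjoint_left.1 (hd hij) hp.1 hp'.1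
    have e : {p : Env d × Path d | p.1 ∈ ⋃ i, E i ∧ shift (p.2 n) p.1 ∈ A}
        = ⋃ i, {p | p.1 ∈ E i ∧ shift (p.2 n) p.1 ∈ A} := by
      ext p
      simp
    rw [e, measureReal_def, measure_iUnion hd' fun i => measurableSet_and_shift (hE i) hA.1 n,
      ENNReal.tsum_toReal_eq fun i => measure_ne_top _ _]
    rfl

theorem integrable_quenched_real {d : ℕ} (μ : Measure (Env d)) [IsFiniteMeasure μ]
    {S : Set (Env d × Path d)} (hS : MeasurableSet S) :
    Integrable (fun ω => (quenched ω 0).real (Prod.mk ω ⁻¹' S)) μ := by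
  refine Integrable.of_bound (C := 1)
    (measurable_quenched_slice hS).ennreal_toReal.aestronglyMeasurable
    (Eventually.of_forall fun ω => ?_)
  rw [Real.norm_eq_abs, abs_of_nonneg measureReal_nonneg]
  exact measureReal_le_one

theorem averaged_real_eq_integral {d : ℕ} (μ : Measure (Env d)) [IsFiniteMeasure μ]
    {S : Set (Env d × Path d)} (hS : MeasurableSet S) :
    (averaged μ 0).real S = ∫ ω, (quenched ω 0).real (Prod.mk ω ⁻¹' S) ∂μ := by
  rw [measureReal_def, averaged_apply _ hS]
  exact (integral_toReal (measurable_quenched_slice hS).aemeasurable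
    (Eventually.of_forall fun ω => measure_lt_top _ _)).symm

/-- Loss of memory for an initial law with a density with respect to the product law. -/
theorem IsLimitLaw.tendsto_integral {d : ℕ} {ν : Measure (ProbVec d)} [IsProbabilityMeasure ν]
    {u : Site d} {G : Measure (Env d)} [IsProbabilityMeasure G] (h : IsLimitLaw ν u G) {b : ℕ}
    {A : Set (Env d)} (hA : IsHalf u (-b) A) {g : Env d → ℝ} (hg : Integrable g (iidLaw ν)) :
    Tendsto (cesaro fun n => ∫ ω, g ω * (quenched ω 0).real {X | shift (X n) ω ∈ A} ∂(iidLaw ν))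
      atTop (𝓝 ((∫ ω, g ω ∂(iidLaw ν)) * G.real A)) := by
  set P := iidLaw ν
  set k : ℕ → Env d → ℝ := fun n ω => (quenched ω 0).real {X | shift (X n) ω ∈ A} with hk
  have hkm : ∀ n, Measurable (k n) := fun n =>
    (measurable_quenched_slice (S := {p | shift (p.2 n) p.1 ∈ A})
      (measurable_shift_path n hA.1)).ennreal_toReal
  have hk0 : ∀ n ω, 0 ≤ k n ω := fun n ω => measureReal_nonneg
  have hk1 : ∀ n ω, k n ω ≤ 1 := fun n ω => measureReal_le_one
  have hint : ∀ (g : Env d → ℝ) n, Integrable g P → Integrable (fun ω => g ω * k n ω) P :=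
    fun g n hg => hg.mul_bdd (c := 1) (hkm n).aestronglyMeasurable
      (Eventually.of_forall fun ω => by
        rw [Real.norm_eq_abs, abs_of_nonneg (hk0 n ω)]; exact hk1 n ω)
  let Φ : (Env d → ℝ) → ℕ → ℝ := fun g N =>
    cesaro (fun n => ∫ ω, g ω * k n ω ∂P) N - (∫ ω, g ω ∂P) * G.real A
  -- The functional is Lipschitz for the `L¹` norm, so that it suffices to treat indicators.
  have hΦlip : ∀ f g : Env d → ℝ, Integrable f P → Integrable g P → ∀ N,
      |Φ f N - Φ g N| ≤ 2 * ∫ ω, |f ω - g ω| ∂P := by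
    intro f g hf hg N
    have e : Φ f N - Φ g N = cesaro (fun n => ∫ ω, (f ω - g ω) * k n ω ∂P) N
        - (∫ ω, (f ω - g ω) ∂P) * G.real A := by
      have e1 : ∀ n, ∫ ω, (f ω - g ω) * k n ω ∂P
          = (∫ ω, f ω * k n ω ∂P) - ∫ ω, g ω * k n ω ∂P := by
        intro n
        rw [← integral_sub (hint f n hf) (hint g n hg)]
        simp only [sub_mul]
      simp only [e1, cesaro_sub, integral_sub hf hg, Φ]
      ring
    have hI : 0 ≤ ∫ ω, |f ω - g ω| ∂P := integral_nonneg fun ω => abs_nonneg _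
    have h1 : |cesaro (fun n => ∫ ω, (f ω - g ω) * k n ω ∂P) N| ≤ ∫ ω, |f ω - g ω| ∂P := by
      refine abs_cesaro_le hI (fun n => ?_) N
      refine abs_integral_le_integral_abs.trans
        (integral_mono (hint _ n (hf.sub hg)).abs (hf.sub hg).abs fun ω => ?_)
      simp only [abs_mul, abs_of_nonneg (hk0 n ω)]
      exact mul_le_of_le_one_right (abs_nonneg _) (hk1 n ω)
    have h2 : |(∫ ω, (f ω - g ω) ∂P) * G.real A| ≤ ∫ ω, |f ω - g ω| ∂P := by
      rw [abs_mul, abs_of_nonneg (measureReal_nonneg (μ := G) (s := A))]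
      exact (mul_le_of_le_one_right (abs_nonneg _) measureReal_le_one).trans
        abs_integral_le_integral_abs
    rw [e]
    refine (abs_sub _ _).trans ?_
    linarith
  have key : Tendsto (Φ g) atTop (𝓝 0) := by
    refine Integrable.induction (fun g => Tendsto (Φ g) atTop (𝓝 0)) ?_ ?_ ?_ ?_ hg
    · intro c E hE _
      have h1 := ((h.tendsto_inter hA hE).const_mul c).sub_const (c * (P.real E * G.real A))
      rw [sub_self] at h1
      refine h1.congr fun N => ?_
      have e2 : ∀ n, ∫ ω, E.indicator (fun _ => c) ω * k n ω ∂P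
          = c * (averaged P 0).real {p | p.1 ∈ E ∧ shift (p.2 n) p.1 ∈ A} := by
        intro n
        rw [averaged_real_eq_integral P (measurableSet_and_shift hE hA.1 n), ← integral_const_mul]
        refine integral_congr_ae (Eventually.of_forall fun ω => ?_)
        by_cases hω : ω ∈ E <;> simp [hω, hk]
      simp only [Φ, e2, cesaro_const_mul, integral_indicator_const c hE, smul_eq_mul]
      ring
    · intro f g _ hf hg ihf ihg
      have h1 := ihf.add ihg
      rw [add_zero] at h1
      refine h1.congr fun N => ?_
      have e1 : ∀ n, ∫ ω, (f + g) ω * k n ω ∂P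
          = (∫ ω, f ω * k n ω ∂P) + ∫ ω, g ω * k n ω ∂P := by
        intro n
        rw [← integral_add (hint f n hf) (hint g n hg)]
        simp only [add_mul, Pi.add_apply]
      have e2 : ∫ ω, (f + g) ω ∂P = (∫ ω, f ω ∂P) + ∫ ω, g ω ∂P := integral_add hf hg
      simp only [Φ, e1, e2, cesaro_add]
      ring
    · refine isClosed_of_closure_subset fun f hf => ?_
      rw [Set.mem_ofPred_eq, Metric.tendsto_atTop]
      intro ε hε
      obtain ⟨g, hg, hfg⟩ := Metric.mem_closure_iff.1 hf (ε / 4) (by positivity)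
      obtain ⟨N₀, hN₀⟩ := Metric.tendsto_atTop.1 hg (ε / 2) (by positivity)
      refine ⟨N₀, fun N hN => ?_⟩
      have h1 := hN₀ N hN
      have h2 := hΦlip f g (L1.integrable_coeFn f) (L1.integrable_coeFn g) N
      rw [L1.dist_eq_integral_dist] at hfg
      simp only [Real.dist_eq] at hfg
      rw [Real.dist_eq, sub_zero] at h1 ⊢
      have h3 := abs_add_le (Φ f N - Φ g N) (Φ g N)
      rw [sub_add_cancel] at h3
      linarith
    · intro f g hfg _ ih
      refine ih.congr fun N => ?_
      have e1 : ∀ n, ∫ ω, f ω * k n ω ∂P = ∫ ω, g ω * k n ω ∂P := fun n =>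
        integral_congr_ae (by filter_upwards [hfg] with ω hω; rw [hω])
      simp only [Φ, e1, integral_congr_ae hfg]
  have h1 := key.add_const ((∫ ω, g ω ∂P) * G.real A)
  rw [zero_add] at h1
  exact h1.congr fun N => by simp only [Φ]; ring

theorem envLaw_real_eq_integral {d : ℕ} (μ : Measure (Env d)) [IsFiniteMeasure μ] (n : ℕ)
    {A : Set (Env d)} (hA : MeasurableSet A) :
    (envLaw μ n).real A = ∫ ω, (quenched ω 0).real {X | shift (X n) ω ∈ A} ∂μ := by
  have h1 : MeasurableSet {p : Env d × Path d | shift (p.2 n) p.1 ∈ A} :=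
    measurable_shift_path n hA
  rw [measureReal_def, envLaw_apply _ _ hA, ← measureReal_def, averaged_real_eq_integral μ h1]
  rfl

theorem IsLimitLaw.tendsto_of_ac {d : ℕ} {ν : Measure (ProbVec d)} [IsProbabilityMeasure ν]
    {u : Site d} {G : Measure (Env d)} [IsProbabilityMeasure G] (h : IsLimitLaw ν u G) {b : ℕ}
    {A : Set (Env d)} (hA : IsHalf u (-b) A) {m : Measure (Env d)} [IsProbabilityMeasure m]
    (hm : m ≪ iidLaw ν) :
    Tendsto (cesaro fun n => (envLaw m n).real A) atTop (𝓝 (G.real A)) := by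
  have h1 := h.tendsto_integral hA (Measure.integrable_toReal_rnDeriv (μ := m) (ν := iidLaw ν))
  rw [Measure.integral_toReal_rnDeriv hm, probReal_univ, one_mul] at h1
  refine h1.congr fun N => ?_
  congr 1
  ext1 n
  rw [envLaw_real_eq_integral m n hA.1, ← integral_rnDeriv_smul hm]
  rfl

/-- A law that is absolutely continuous on a half-space agrees there with an absolutely continuous
law. -/
theorem exists_ac_of_half {d : ℕ} (u : Site d) (ℓ : ℤ) (P μ : Measure (Env d))
    [IsProbabilityMeasure P] [IsProbabilityMeasure μ]
    (h : ∀ A, IsHalf u ℓ A → P A = 0 → μ A = 0) :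
    ∃ m : Measure (Env d), IsProbabilityMeasure m ∧ m ≪ P ∧
      m.map (trunc u ℓ) = μ.map (trunc u ℓ) := by
  have hρ := measurable_trunc u ℓ
  have hac : μ.map (trunc u ℓ) ≪ P.map (trunc u ℓ) := by
    refine Measure.AbsolutelyContinuous.mk fun B hB h0 => ?_
    rw [Measure.map_apply hρ hB] at h0 ⊢
    exact h _ (isHalf_preimage_trunc u ℓ hB) h0
  have : IsProbabilityMeasure (μ.map (trunc u ℓ)) := Measure.isProbabilityMeasure_map
    hρ.aemeasurable
  have : IsProbabilityMeasure (P.map (trunc u ℓ)) := Measure.isProbabilityMeasure_map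
    hρ.aemeasurable
  set g := (μ.map (trunc u ℓ)).rnDeriv (P.map (trunc u ℓ)) with hg
  have hgm : Measurable g := Measure.measurable_rnDeriv _ _
  set m := P.withDensity (g ∘ trunc u ℓ) with hm
  have hmap : m.map (trunc u ℓ) = μ.map (trunc u ℓ) := by
    ext B hB
    rw [Measure.map_apply hρ hB, hm, withDensity_apply _ (hρ hB)]
    conv_rhs => rw [← Measure.withDensity_rnDeriv_eq _ _ hac, withDensity_apply _ hB]
    exact (setLIntegral_map hB hgm hρ).symm
  refine ⟨m, ⟨?_⟩, withDensity_absolutelyContinuous _ _, hmap⟩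
  have h1 := congrArg (fun μ => μ Set.univ) hmap
  simpa [Measure.map_apply hρ MeasurableSet.univ] using h1

theorem averaged_staysAbove_congr {d : ℕ} {u : Site d} {ℓ : ℤ} {L b : ℕ} (hℓ : ℓ ≤ -L - b)
    {μ m : Measure (Env d)} [SFinite μ] [SFinite m]
    (hm : m.map (trunc u ℓ) = μ.map (trunc u ℓ)) {A : Set (Env d)} (hA : IsHalf u (-b) A)
    (n : ℕ) :
    averaged m 0 {p | shift (p.2 n) p.1 ∈ A ∧ p.2 ∈ staysAbove u (-L)}
      = averaged μ 0 {p | shift (p.2 n) p.1 ∈ A ∧ p.2 ∈ staysAbove u (-L)} := by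
  set F : Set (Env d × Path d) := {p | shift (p.2 n) p.1 ∈ A ∧ p.2 ∈ staysAbove u (-L)} with hF
  have hFm : MeasurableSet F := (measurable_shift_path n hA.1).inter
    (measurable_snd (measurableSet_staysAbove u (-L)))
  set g : Env d → ℝ≥0∞ := fun ω => quenched ω 0 (Prod.mk ω ⁻¹' F) with hg
  have hgm : Measurable g := measurable_quenched_slice hFm
  have hloc : ∀ ω, g (trunc u ℓ ω) = g ω := by
    intro ω
    have hBm : MeasurableSet {X : Path d | shift (X n) ω ∈ A} := by
      have h : Measurable fun X : Path d => shift (X n) ω :=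
        (measurable_shift_path n).comp measurable_prodMk_left
      exact h hA.1
    have e : Prod.mk (trunc u ℓ ω) ⁻¹' F = {X | shift (X n) ω ∈ A} ∩ staysAbove u (-L) := by
      ext X
      simp only [hF, Set.mem_preimage, Set.mem_ofPred_eq, Set.mem_inter_iff]
      refine and_congr_left fun hX => ?_
      have hlev : ℓ ≤ -b + dot (X n) u := by have := hX n; omega
      exact ((hA.preimage_shift (X n)).mono hlev).mem_iff ω
    have e' : Prod.mk ω ⁻¹' F = {X | shift (X n) ω ∈ A} ∩ staysAbove u (-L) := rfl
    simp only [hg, e, e']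
    exact quenched_inter_staysAbove_congr u (-L)
      (fun x hx => trunc_apply_of_le ω (by omega)) hBm
  have hi : ∀ μ : Measure (Env d), ∫⁻ ω, g ω ∂μ = ∫⁻ ω, g ω ∂(μ.map (trunc u ℓ)) := by
    intro μ
    rw [lintegral_map hgm (measurable_trunc u ℓ)]
    exact lintegral_congr fun ω => (hloc ω).symm
  rw [averaged_apply _ hFm, averaged_apply _ hFm, hi m, hi μ, hm]

/-- The walk started in an environment with law `μ` does not backtrack arbitrarily far. -/
def BoundedBacktrack {d : ℕ} (u : Site d) (μ : Measure (Env d)) : Prop :=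
  ∀ ε : ℝ, 0 < ε → ∃ L : ℕ, (averaged μ 0).real (Prod.snd ⁻¹' staysAbove u (-L))ᶜ ≤ ε

/-- Loss of memory: from every initial law that is absolutely continuous on half-spaces, the
environment seen from the walk converges to `G` in Cesàro average. -/
theorem IsLimitLaw.tendsto_envLaw {d : ℕ} {ν : Measure (ProbVec d)} [IsProbabilityMeasure ν]
    {u : Site d} {G : Measure (Env d)} [IsProbabilityMeasure G] (h : IsLimitLaw ν u G) {b : ℕ}
    {A : Set (Env d)} (hA : IsHalf u (-b) A) {μ : Measure (Env d)} [IsProbabilityMeasure μ]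
    (hac : ∀ (b : ℕ) (A : Set (Env d)), IsHalf u (-b) A → iidLaw ν A = 0 → μ A = 0)
    (hbt : BoundedBacktrack u μ) :
    Tendsto (cesaro fun n => (envLaw μ n).real A) atTop (𝓝 (G.real A)) := by
  rw [Metric.tendsto_atTop]
  intro ε hε
  obtain ⟨L, hL⟩ := hbt (ε / 4) (by positivity)
  obtain ⟨m, hm, hmP, hmap⟩ := exists_ac_of_half u (-((L + b : ℕ) : ℤ)) (iidLaw ν) μ (hac (L + b))
  obtain ⟨N₀, hN₀⟩ := Metric.tendsto_atTop.1 (h.tendsto_of_ac hA hmP) (ε / 4) (by positivity)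
  have hDm : MeasurableSet (Prod.snd ⁻¹' staysAbove u (-L) : Set (Env d × Path d)) :=
    measurableSet_snd_staysAbove u _
  have hDc : (averaged m 0).real (Prod.snd ⁻¹' staysAbove u (-L))ᶜ ≤ ε / 4 := by
    refine le_trans (le_of_eq ?_) hL
    rw [probReal_compl_eq_one_sub hDm, probReal_compl_eq_one_sub hDm]
    congr 1
    have := averaged_staysAbove_congr (n := 0) (b := b) (L := L) (by push_cast; omega) hmap
      (isHalf_univ u _)
    simp only [Set.mem_univ, true_and] at this
    exact congrArg ENNReal.toReal this
  have hsplit : ∀ (μ : Measure (Env d)) [IsProbabilityMeasure μ] (n : ℕ),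
      (averaged μ 0).real {p | shift (p.2 n) p.1 ∈ A ∧ p.2 ∈ staysAbove u (-L)}
        ≤ (envLaw μ n).real A ∧
      (envLaw μ n).real A
        ≤ (averaged μ 0).real {p | shift (p.2 n) p.1 ∈ A ∧ p.2 ∈ staysAbove u (-L)}
          + (averaged μ 0).real (Prod.snd ⁻¹' staysAbove u (-L))ᶜ := by
    intro μ _ n
    rw [measureReal_def (envLaw μ n), envLaw_apply _ _ hA.1, ← measureReal_def]
    refine ⟨measureReal_mono fun p hp => hp.1, ?_⟩
    refine le_trans (measureReal_mono ?_) (measureReal_union_le _ _)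
    intro p hp
    by_cases hp' : p.2 ∈ staysAbove u (-L)
    · exact Or.inl ⟨hp, hp'⟩
    · exact Or.inr hp'
  have hdiff : ∀ n, |(envLaw μ n).real A - (envLaw m n).real A| ≤ ε / 4 := by
    intro n
    have h1 := hsplit μ n
    have h2 := hsplit m n
    have h3 := averaged_staysAbove_congr (n := n) (b := b) (L := L) (by push_cast; omega) hmap hA
    rw [measureReal_def (averaged m 0) {p | shift (p.2 n) p.1 ∈ A ∧ p.2 ∈ staysAbove u (-L)},
      h3, ← measureReal_def] at h2
    rw [abs_le]
    constructor <;> linarith [h1.1, h1.2, h2.1, h2.2]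
  refine ⟨N₀, fun N hN => ?_⟩
  have h1 := hN₀ N hN
  have h2 := abs_cesaro_le (by positivity) hdiff N
  rw [cesaro_sub] at h2
  rw [Real.dist_eq] at h1 ⊢
  have h3 := abs_add_le (cesaro (fun n => (envLaw μ n).real A) N
    - cesaro (fun n => (envLaw m n).real A) N)
    (cesaro (fun n => (envLaw m n).real A) N - G.real A)
  rw [sub_add_sub_cancel] at h3
  linarith

theorem exists_forall_backtrack_le {d : ℕ} (u : Site d) {s : ℝ} (hs : 0 < s) {ρ : ℝ≥0∞}
    (hρ : ρ < 1) {ε : ℝ} (hε : 0 < ε) :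
    ∃ L : ℕ, ∀ (μ : Measure (Env d)) [IsProbabilityMeasure μ], UniformDrift u s ρ μ →
      (averaged μ 0).real (Prod.snd ⁻¹' staysAbove u (-L))ᶜ ≤ ε := by
  have hlim : Tendsto (fun L : ℕ => Real.exp (-s * L) * ((1 - ρ)⁻¹).toReal) atTop (𝓝 0) := by
    have h1 : Tendsto (fun L : ℕ => Real.exp (-s * L)) atTop (𝓝 0) :=
      Real.tendsto_exp_atBot.comp
        (tendsto_natCast_atTop_atTop.const_mul_atTop_of_neg (by linarith))
    simpa using h1.mul_const ((1 - ρ)⁻¹).toReal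
  obtain ⟨L, hL⟩ := (hlim.eventually_lt_const hε).exists
  refine ⟨L, fun μ _ h => le_trans ?_ hL.le⟩
  have h1 := averaged_exists_dot_le hs.le h (L : ℝ)
  have h2 := ENNReal.toReal_mono (ENNReal.mul_ne_top ENNReal.ofReal_ne_top
    (one_sub_inv_ne_top hρ)) h1
  rw [ENNReal.toReal_mul, ENNReal.toReal_ofReal (Real.exp_pos _).le] at h2
  refine le_trans (measureReal_mono ?_) h2
  intro p hp
  simp only [staysAbove, Set.mem_compl_iff, Set.mem_preimage, Set.mem_ofPred_eq, not_forall,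
    not_le] at hp
  obtain ⟨j, hj⟩ := hp
  refine ⟨j, ?_⟩
  have : dot (p.2 j) u ≤ -(L : ℤ) := hj.le
  exact_mod_cast this

theorem boundedBacktrack_of_uniformDrift {d : ℕ} {u : Site d} {s : ℝ} (hs : 0 < s) {ρ : ℝ≥0∞}
    (hρ : ρ < 1) {μ : Measure (Env d)} [IsProbabilityMeasure μ] (h : UniformDrift u s ρ μ) :
    BoundedBacktrack u μ := fun _ hε =>
  let ⟨L, hL⟩ := exists_forall_backtrack_le u hs hρ hε
  ⟨L, hL μ h⟩

/-! ### Absolute continuity and invariance of the limit law -/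

theorem IsLimitLaw.measure_eq_zero {d : ℕ} {ν : Measure (ProbVec d)} [IsProbabilityMeasure ν]
    {u : Site d} {G : Measure (Env d)} [IsProbabilityMeasure G] (h : IsLimitLaw ν u G) {b : ℕ}
    {A : Set (Env d)} (hA : IsHalf u (-b) A) (h0 : iidLaw ν A = 0) : G A = 0 := by
  have h1 : ∀ n, (envLaw (iidLaw ν) n).real A = 0 := fun n => by
    rw [measureReal_def, envLaw_iidLaw_absolutelyContinuous ν n h0, ENNReal.toReal_zero]
  have h2 := h.tendsto hA
  simp only [h1] at h2
  exact (measureReal_eq_zero_iff).1 (tendsto_nhds_unique h2 (tendsto_cesaro_const 0))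

theorem IsLimitLaw.ae_of_ae {d : ℕ} {ν : Measure (ProbVec d)} [IsProbabilityMeasure ν]
    {u : Site d} {G : Measure (Env d)} [IsProbabilityMeasure G] (h : IsLimitLaw ν u G)
    {p : Env d → Prop} (hp : IsHalf u 0 {ω | p ω}) (hae : ∀ᵐ ω ∂(iidLaw ν), p ω) :
    ∀ᵐ ω ∂G, p ω :=
  h.measure_eq_zero (b := 0) (A := {ω | p ω}ᶜ) (by simpa using hp.compl) hae

/-- Convergence in Cesàro average of the probabilities of the superlevel sets of a function with
values in `[0, 1]` implies convergence of its integrals. -/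
theorem tendsto_cesaro_integral {α : Type*} [MeasurableSpace α] {μ : ℕ → Measure α}
    [∀ n, IsProbabilityMeasure (μ n)] {G : Measure α} [IsProbabilityMeasure G] {f : α → ℝ}
    (hf : Measurable f) (h0 : ∀ a, 0 ≤ f a) (h1 : ∀ a, f a ≤ 1)
    (h : ∀ c : ℝ, Tendsto (cesaro fun n => (μ n).real {a | c ≤ f a}) atTop
      (𝓝 (G.real {a | c ≤ f a}))) :
    Tendsto (cesaro fun n => ∫ a, f a ∂(μ n)) atTop (𝓝 (∫ a, f a ∂G)) := by
  -- the discretization of `f` with mesh `1 / k`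
  let S : ℕ → Measure α → ℝ := fun k m =>
    (k : ℝ)⁻¹ * ∑ j ∈ Finset.range k, m.real {a | ((j : ℝ) + 1) / k ≤ f a}
  have hmeas : ∀ c : ℝ, MeasurableSet {a | c ≤ f a} := fun c => measurableSet_le measurable_const hf
  have hS : ∀ k : ℕ, 0 < k → ∀ (m : Measure α) [IsProbabilityMeasure m],
      |∫ a, f a ∂m - S k m| ≤ (k : ℝ)⁻¹ := by
    intro k hk m _
    have hk' : (0 : ℝ) < k := by exact_mod_cast hk
    have e1 : S k m = ∫ a, (k : ℝ)⁻¹ * ∑ j ∈ Finset.range k,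
        {a | ((j : ℝ) + 1) / k ≤ f a}.indicator (1 : α → ℝ) a ∂m := by
      rw [integral_const_mul, integral_finsetSum _ fun j _ =>
        (integrable_indicator_iff (f := (1 : α → ℝ)) (hmeas _)).2
          (integrable_const (1 : ℝ)).integrableOn]
      simp only [S, integral_indicator_one (hmeas _)]
    have hpt : ∀ a, |f a - (k : ℝ)⁻¹ * ∑ j ∈ Finset.range k,
        {a | ((j : ℝ) + 1) / k ≤ f a}.indicator (1 : α → ℝ) a| ≤ (k : ℝ)⁻¹ := by
      intro a
      have e2 : ∑ j ∈ Finset.range k, {a | ((j : ℝ) + 1) / k ≤ f a}.indicator (1 : α → ℝ) a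
          = (⌊k * f a⌋₊ : ℝ) := by
        have e3 : (Finset.range k).filter (fun j : ℕ => ((j : ℝ) + 1) / k ≤ f a)
            = Finset.range ⌊k * f a⌋₊ := by
          ext j
          have h3 : ((j : ℝ) + 1) / k ≤ f a ↔ j < ⌊k * f a⌋₊ := by
            rw [div_le_iff₀ hk', ← Nat.succ_le_iff, Nat.le_floor_iff (by
              have := h0 a; positivity), mul_comm]
            push_cast
            rfl
          rw [Finset.mem_filter, Finset.mem_range, Finset.mem_range, h3]
          refine ⟨fun h => h.2, fun h => ⟨h.trans_le ?_, h⟩⟩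
          exact Nat.floor_le_of_le (by nlinarith [h1 a])
        simp only [Set.indicator_apply, Set.mem_ofPred_eq, Pi.one_apply, Finset.sum_boole, e3,
          Finset.card_range]
      rw [e2]
      have h4 := Nat.floor_le (a := k * f a) (by have := h0 a; positivity)
      have h5 := (Nat.lt_floor_add_one (k * f a)).le
      have e4 : f a - (k : ℝ)⁻¹ * ⌊k * f a⌋₊ = (k : ℝ)⁻¹ * (k * f a - ⌊k * f a⌋₊) := by
        field_simp
      rw [e4, abs_of_nonneg (mul_nonneg (by positivity) (by linarith))]
      exact mul_le_of_le_one_right (by positivity) (by linarith)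
    have hSm : Measurable fun a => (k : ℝ)⁻¹ * ∑ j ∈ Finset.range k,
        {a | ((j : ℝ) + 1) / k ≤ f a}.indicator (1 : α → ℝ) a :=
      (Finset.measurable_fun_sum _ fun j _ => measurable_one.indicator (hmeas _)).const_mul _
    have hfi : Integrable f m := Integrable.of_bound (C := 1) hf.aestronglyMeasurable
      (Eventually.of_forall fun a => by rw [Real.norm_eq_abs, abs_of_nonneg (h0 a)]; exact h1 a)
    have hSi : Integrable (fun a => (k : ℝ)⁻¹ * ∑ j ∈ Finset.range k,
        {a | ((j : ℝ) + 1) / k ≤ f a}.indicator (1 : α → ℝ) a) m := by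
      have := hfi.sub (Integrable.of_bound (μ := m) (C := (k : ℝ)⁻¹)
        (hf.sub hSm).aestronglyMeasurable
        (Eventually.of_forall fun a => (Real.norm_eq_abs _).trans_le (hpt a)))
      refine this.congr (Eventually.of_forall fun a => ?_)
      simp only [Pi.sub_apply, sub_sub_cancel]
    rw [e1, ← integral_sub hfi hSi]
    refine (norm_integral_le_of_norm_le_const (C := (k : ℝ)⁻¹) (Eventually.of_forall fun a =>
      (Real.norm_eq_abs _).trans_le (hpt a))).trans ?_
    simp
  have hT : ∀ k, Tendsto (cesaro fun n => S k (μ n)) atTop (𝓝 (S k G)) := by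
    intro k
    have h2 := (tendsto_finsetSum (Finset.range k)
      fun j _ => h (((j : ℝ) + 1) / k)).const_mul (k : ℝ)⁻¹
    refine h2.congr fun N => ?_
    simp only [S, cesaro_const_mul]
    simp only [cesaro, Finset.mul_sum]
    rw [Finset.sum_comm]
  rw [Metric.tendsto_atTop]
  intro ε hε
  obtain ⟨k, hk⟩ := exists_nat_gt (3 / ε)
  have hk0 : (0 : ℝ) < k := lt_trans (by positivity) hk
  have hkε : (k : ℝ)⁻¹ ≤ ε / 3 := by
    rw [inv_le_comm₀ hk0 (by positivity), inv_div]
    exact hk.le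
  have hk1 : 0 < k := by exact_mod_cast hk0
  obtain ⟨N₀, hN₀⟩ := Metric.tendsto_atTop.1 (hT k) (ε / 3) (by positivity)
  refine ⟨N₀, fun N hN => ?_⟩
  have h2 := hN₀ N hN
  have h3 := abs_cesaro_le (by positivity) (fun n => hS k hk1 (μ n)) N
  have h4 := hS k hk1 G
  rw [cesaro_sub] at h3
  rw [Real.dist_eq] at h2 ⊢
  rw [abs_lt] at h2 ⊢
  rw [abs_le] at h3 h4
  constructor <;> linarith

theorem tendsto_cesaro_succ_iff {a : ℕ → ℝ} {l K : ℝ} (hb : ∀ n, |a n| ≤ K) :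
    Tendsto (cesaro fun n => a (n + 1)) atTop (𝓝 l) ↔ Tendsto (cesaro a) atTop (𝓝 l) := by
  have h1 : Tendsto (fun N : ℕ => (N : ℝ)⁻¹ * (a N - a 0)) atTop (𝓝 0) := by
    have h2 : Tendsto (fun N : ℕ => 2 * K * (N : ℝ)⁻¹) atTop (𝓝 0) := by
      simpa using tendsto_inv_atTop_nhds_zero_nat (𝕜 := ℝ).const_mul (2 * K)
    refine squeeze_zero_norm (fun N => ?_) h2
    rw [norm_mul, Real.norm_of_nonneg (by positivity : (0 : ℝ) ≤ (N : ℝ)⁻¹), mul_comm,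
      Real.norm_eq_abs]
    gcongr
    have := abs_sub (a N) (a 0)
    linarith [hb N, hb 0]
  have e : ∀ N, cesaro (fun n => a (n + 1)) N = cesaro a N + (N : ℝ)⁻¹ * (a N - a 0) := by
    intro N
    have h3 := Finset.sum_range_succ' a N
    rw [Finset.sum_range_succ] at h3
    simp only [cesaro]
    rw [← mul_add]
    congr 1
    linarith
  constructor
  · intro h
    have h2 := h.sub h1
    rw [sub_zero] at h2
    exact h2.congr fun N => by rw [e]; ring
  · intro h
    have h2 := h.add h1
    rw [add_zero] at h2
    exact h2.congr fun N => (e N).symm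

theorem quenched_dot_le {d : ℕ} {u : Site d} {s : ℝ} (hs : 0 ≤ s) {ρ : ℝ≥0∞} {ω : Env d}
    (h : ExpDrift u s ρ ω) (L : ℝ) :
    quenched ω 0 {X | (dot (X 1) u : ℝ) ≤ -L} ≤ ENNReal.ofReal (Real.exp (-s * L)) * ρ := by
  have hm : MeasurableSet {X : Path d | (dot (X 1) u : ℝ) ≤ -L} :=
    (measurable_dot_path u 1) (Set.to_countable {k : ℤ | (k : ℝ) ≤ -L}).measurableSet
  have hw : Measurable fun X : Path d => expWeight u s (X 1) :=
    (measurable_of_countable (expWeight u s)).comp (measurable_pi_apply 1)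
  calc quenched ω 0 {X | (dot (X 1) u : ℝ) ≤ -L}
      = ∫⁻ _ in {X : Path d | (dot (X 1) u : ℝ) ≤ -L}, 1 ∂(quenched ω 0) := by simp
    _ ≤ ∫⁻ X in {X : Path d | (dot (X 1) u : ℝ) ≤ -L},
          ENNReal.ofReal (Real.exp (-s * L)) * expWeight u s (X 1) ∂(quenched ω 0) :=
        setLIntegral_mono' hm fun p hp => one_le_mul_expWeight hs hp
    _ ≤ ∫⁻ X, ENNReal.ofReal (Real.exp (-s * L)) * expWeight u s (X 1) ∂(quenched ω 0) :=
        setLIntegral_le_lintegral _ _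
    _ ≤ _ := by
        rw [lintegral_const_mul _ hw, lintegral_quenched_step]
        gcongr
        exact h

/-- The probability that the next environment is in `A` and that the step goes down by at most `K`
levels. If `A` depends on the environment in an upper half-space only, then so does this function
(`stepProb_trunc`), whereas `envKernel d ω A` may depend on the whole environment. -/
noncomputable def stepProb {d : ℕ} (u : Site d) (K : ℕ) (A : Set (Env d)) (ω : Env d) : ℝ :=
  (quenched ω 0).real {X | shift (X 1) ω ∈ A ∧ -(K : ℤ) ≤ dot (X 1) u}

theorem stepProb_nonneg {d : ℕ} (u : Site d) (K : ℕ) (A : Set (Env d)) (ω : Env d) :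
    0 ≤ stepProb u K A ω := by
  unfold stepProb
  exact measureReal_nonneg

theorem stepProb_le_one {d : ℕ} (u : Site d) (K : ℕ) (A : Set (Env d)) (ω : Env d) :
    stepProb u K A ω ≤ 1 := by
  unfold stepProb
  exact measureReal_le_one

theorem measurableSet_step {d : ℕ} (u : Site d) (K : ℕ) {A : Set (Env d)}
    (hA : MeasurableSet A) :
    MeasurableSet {p : Env d × Path d | shift (p.2 1) p.1 ∈ A ∧ -(K : ℤ) ≤ dot (p.2 1) u} :=
  (measurable_shift_path 1 hA).inter (measurableSet_dot u 1 {k : ℤ | -(K : ℤ) ≤ k})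

theorem stepProb_eq {d : ℕ} (u : Site d) (K : ℕ) (A : Set (Env d)) :
    stepProb u K A = fun ω => (quenched ω 0).real (Prod.mk ω ⁻¹'
      {p : Env d × Path d | shift (p.2 1) p.1 ∈ A ∧ -(K : ℤ) ≤ dot (p.2 1) u}) := by
  funext ω
  unfold stepProb
  congr 1

theorem measurable_stepProb {d : ℕ} (u : Site d) (K : ℕ) {A : Set (Env d)}
    (hA : MeasurableSet A) : Measurable (stepProb u K A) := by
  rw [stepProb_eq]
  exact (measurable_quenched_slice (measurableSet_step u K hA)).ennreal_toReal

theorem stepProb_trunc {d : ℕ} {u : Site d} (K : ℕ) {b : ℕ} {A : Set (Env d)}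
    (hA : IsHalf u (-b) A) (ω : Env d) :
    stepProb u K A (trunc u (-((b + K : ℕ) : ℤ)) ω) = stepProb u K A ω := by
  have key : ∀ ω : Env d, quenched ω 0 {X | shift (X 1) ω ∈ A ∧ -(K : ℤ) ≤ dot (X 1) u}
      = ∑' z, ENNReal.ofReal (trans ω 0 z)
        * {z | shift z ω ∈ A ∧ -(K : ℤ) ≤ dot z u}.indicator 1 z := by
    intro ω
    have h2 : MeasurableSet {X : Path d | shift (X 1) ω ∈ A ∧ -(K : ℤ) ≤ dot (X 1) u} :=
      measurable_prodMk_left (measurableSet_step u K hA.1)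
    rw [← lintegral_quenched_step, ← lintegral_indicator_one h2]
    rfl
  rw [stepProb, measureReal_def, key, stepProb, measureReal_def, key]
  congr 1
  refine tsum_congr fun z => ?_
  have h1 : trans (trunc u (-((b + K : ℕ) : ℤ)) ω) 0 z = trans ω 0 z := by
    rw [trans, trunc_apply_of_le ω (by simp only [dot_zero_left]; omega)]
    rfl
  have h2 : z ∈ {z | shift z (trunc u (-((b + K : ℕ) : ℤ)) ω) ∈ A ∧ -(K : ℤ) ≤ dot z u}
      ↔ z ∈ {z | shift z ω ∈ A ∧ -(K : ℤ) ≤ dot z u} := by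
    simp only [Set.mem_ofPred_eq]
    refine and_congr_left fun hz => ?_
    exact ((hA.preimage_shift z).mono (by push_cast; omega)).mem_iff ω
  rw [h1]
  congr 1
  by_cases hz : z ∈ {z | shift z ω ∈ A ∧ -(K : ℤ) ≤ dot z u}
  · rw [Set.indicator_of_mem hz, Set.indicator_of_mem (h2.2 hz)]
  · rw [Set.indicator_of_notMem hz, Set.indicator_of_notMem (fun h => hz (h2.1 h))]

theorem abs_stepProb_sub_le {d : ℕ} {u : Site d} {s : ℝ} (hs : 0 ≤ s) {ρ : ℝ≥0∞}
    (hρ : ρ < 1) {ω : Env d} (h : ExpDrift u s ρ ω) (K : ℕ) (A : Set (Env d)) :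
    |stepProb u K A ω - (quenched ω 0).real {X | shift (X 1) ω ∈ A}| ≤ Real.exp (-s * K) := by
  have h4 := ENNReal.toReal_mono (b := ENNReal.ofReal (Real.exp (-s * K))) ENNReal.ofReal_ne_top
    ((quenched_dot_le hs h K).trans (mul_le_of_le_one_right' hρ.le))
  rw [ENNReal.toReal_ofReal (Real.exp_pos _).le, ← measureReal_def] at h4
  unfold stepProb
  have hm : IsProbabilityMeasure (quenched ω 0) := inferInstance
  generalize quenched ω 0 = m at *
  have h5 : m.real {X | shift (X 1) ω ∈ A ∧ -(K : ℤ) ≤ dot (X 1) u}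
      ≤ m.real {X | shift (X 1) ω ∈ A} :=
    measureReal_mono fun X hX => hX.1
  have h6 : m.real {X | shift (X 1) ω ∈ A} ≤
      m.real {X | shift (X 1) ω ∈ A ∧ -(K : ℤ) ≤ dot (X 1) u}
      + m.real {X | (dot (X 1) u : ℝ) ≤ -(K : ℝ)} := by
    refine le_trans (measureReal_mono ?_) (measureReal_union_le _ _)
    intro X hX
    by_cases hX' : -(K : ℤ) ≤ dot (X 1) u
    · exact Or.inl ⟨hX, hX'⟩
    · right
      have h7 : dot (X 1) u ≤ -(K : ℤ) := by omega
      have h8 : ((dot (X 1) u : ℤ) : ℝ) ≤ ((-(K : ℤ) : ℤ) : ℝ) := by exact_mod_cast h7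
      simpa using h8
  rw [abs_le]
  constructor <;> linarith [Real.exp_pos (-s * K)]

theorem abs_integral_stepProb_sub_le {d : ℕ} {u : Site d} {s : ℝ} (hs : 0 ≤ s) {ρ : ℝ≥0∞}
    (hρ : ρ < 1) {μ : Measure (Env d)} [IsProbabilityMeasure μ]
    (h : ∀ᵐ ω ∂μ, ExpDrift u s ρ ω) (K : ℕ) {A : Set (Env d)} (hA : MeasurableSet A) :
    |∫ ω, stepProb u K A ω ∂μ - (envLaw μ 1).real A| ≤ Real.exp (-s * K) := by
  rw [envLaw_real_eq_integral μ 1 hA]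
  have h1 : Integrable (stepProb u K A) μ := by
    rw [stepProb_eq]
    exact integrable_quenched_real μ (measurableSet_step u K hA)
  have h2 : Integrable (fun ω => (quenched ω 0).real {X | shift (X 1) ω ∈ A}) μ :=
    integrable_quenched_real μ (S := {p | shift (p.2 1) p.1 ∈ A}) (measurable_shift_path 1 hA)
  rw [← integral_sub h1 h2]
  have h3 : ∀ᵐ ω ∂μ, ‖stepProb u K A ω - (quenched ω 0).real {X | shift (X 1) ω ∈ A}‖
      ≤ Real.exp (-s * K) :=
    h.mono fun ω hω => (Real.norm_eq_abs _).trans_le (abs_stepProb_sub_le hs hρ hω K A)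
  refine (norm_integral_le_of_norm_le_const h3).trans ?_
  rw [probReal_univ, mul_one]

/-- The limit law is invariant for the environment process. The kernel of the environment process
is not local, since the walk may jump down arbitrarily far; large downward jumps are cut off, at an
exponentially small cost. -/
theorem IsLimitLaw.envLaw_one {d : ℕ} {ν : Measure (ProbVec d)} [IsProbabilityMeasure ν]
    {u : Site d} {G : Measure (Env d)} [IsProbabilityMeasure G] (h : IsLimitLaw ν u G)
    {s : ℝ} (hs : 0 < s) {ρ : ℝ≥0∞} (hρ : ρ < 1)
    (hd : ∀ᵐ ω ∂(iidLaw ν), ExpDrift u s ρ ω) : envLaw G 1 = G := by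
  refine env_measure_ext u fun b A hA => ?_
  have hGd : ∀ᵐ ω ∂G, ExpDrift u s ρ ω := h.ae_of_ae (isHalf_expDrift u s ρ) hd
  have key : ∀ K : ℕ, |(envLaw G 1).real A - G.real A| ≤ 2 * Real.exp (-s * K) := by
    intro K
    have h1 : Tendsto (cesaro fun n => ∫ ω, stepProb u K A ω ∂(envLaw (iidLaw ν) n)) atTop
        (𝓝 (∫ ω, stepProb u K A ω ∂G)) := by
      refine tendsto_cesaro_integral (measurable_stepProb u K hA.1) (stepProb_nonneg u K A)
        (stepProb_le_one u K A) fun c => ?_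
      have hH : IsHalf u (-((b + K : ℕ) : ℤ)) (stepProb u K A ⁻¹' Set.Ici c) :=
        isHalf_of_measurable (measurable_stepProb u K hA.1) (stepProb_trunc K hA) measurableSet_Ici
      exact h.tendsto hH
    have h2 : Tendsto (cesaro fun n => (envLaw (iidLaw ν) (n + 1)).real A) atTop
        (𝓝 (G.real A)) := (tendsto_cesaro_succ_iff (K := 1)
        (a := fun n => (envLaw (iidLaw ν) n).real A) fun n => by
          rw [abs_of_nonneg measureReal_nonneg]; exact measureReal_le_one).2 (h.tendsto hA)
    have h3 : ∀ N, |cesaro (fun n => ∫ ω, stepProb u K A ω ∂(envLaw (iidLaw ν) n)) N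
        - cesaro (fun n => (envLaw (iidLaw ν) (n + 1)).real A) N| ≤ Real.exp (-s * K) := by
      intro N
      rw [← cesaro_sub]
      refine abs_cesaro_le (Real.exp_pos _).le (fun n => ?_) N
      rw [envLaw_add]
      exact abs_integral_stepProb_sub_le hs.le hρ (uniformDrift_iidLaw hd n) K hA.1
    have h4 := le_of_tendsto (h1.sub h2).abs (Eventually.of_forall h3)
    have h5 := abs_integral_stepProb_sub_le hs.le hρ hGd K hA.1
    rw [abs_le] at h4 h5 ⊢
    constructor <;> linarith
  have hlim : Tendsto (fun K : ℕ => 2 * Real.exp (-s * K)) atTop (𝓝 0) := by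
    have h1 : Tendsto (fun L : ℕ => Real.exp (-s * L)) atTop (𝓝 0) :=
      Real.tendsto_exp_atBot.comp
        (tendsto_natCast_atTop_atTop.const_mul_atTop_of_neg (by linarith))
    simpa using h1.const_mul 2
  have h6 := ge_of_tendsto hlim (Eventually.of_forall key)
  have h7 : (envLaw G 1).real A = G.real A := by
    have := abs_nonpos_iff.1 h6
    linarith
  rwa [measureReal_def, measureReal_def,
    ENNReal.toReal_eq_toReal_iff' (measure_ne_top _ _) (measure_ne_top _ _)] at h7

/-! ### Closeness to the product law, drift and moments of the limit law -/

theorem envLaw_iidLaw_le {d : ℕ} {ν : Measure (ProbVec d)} [IsProbabilityMeasure ν]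
    {u : Site d} {s : ℝ} (hs : 0 < s) {ρ : ℝ≥0∞} (h : UniformDrift u s ρ (iidLaw ν)) (n : ℕ)
    {k : ℤ} {A : Set (Env d)} (hA : IsHalf u k A) :
    envLaw (iidLaw ν) n A
      ≤ iidLaw ν A + ENNReal.ofReal (Real.exp (-s * k)) * (1 - ρ)⁻¹ := by
  set P := iidLaw ν
  set S : Set (Env d × Path d) := Prod.snd ⁻¹' nearRecord u k n with hS
  have hSm : MeasurableSet S := measurable_snd (measurableSet_nearRecord u k n)
  have hF : MeasurableSet (Prod.fst ⁻¹' A : Set (Env d × Path d)) := measurable_fst hA.1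
  have hfresh := averaged_fresh ν u n k (S := S) (F := Prod.fst ⁻¹' A) hSm
    (fun ω X Y hXY => nearRecord_congr hXY) (fun ω X hX => hX) (fun ω ω' X _ => Iff.rfl) hF
    (fun ω => by
      have e : ∀ ω : Env d, (Prod.mk ω ⁻¹' (Prod.fst ⁻¹' A) : Set (Path d)) = {_X | ω ∈ A} :=
        fun ω => rfl
      rw [e, e]
      by_cases hω : ω ∈ A
      · have h2 := (hA.mem_iff ω).2 hω
        simp [hω, h2]
      · have h2 : trunc u k ω ∉ A := fun h => hω ((hA.mem_iff ω).1 h)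
        simp [hω, h2])
  have e1 : averaged P 0 (Prod.fst ⁻¹' A) = P A := by
    rw [← Measure.map_apply measurable_fst hA.1, averaged_fst]
  have e2 : averaged P 0 Sᶜ ≤ ENNReal.ofReal (Real.exp (-s * k)) * (1 - ρ)⁻¹ := by
    refine le_trans (measure_mono ?_) (averaged_exists_overshoot hs.le h n (k : ℝ))
    intro p hp
    simp only [hS, nearRecord, Set.mem_compl_iff, Set.mem_preimage, Set.mem_ofPred_eq, not_forall,
      not_lt] at hp
    obtain ⟨j, hj, hp⟩ := hp
    exact ⟨j, hj, by exact_mod_cast hp⟩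
  rw [envLaw_apply _ _ hA.1]
  calc averaged P 0 {p | shift (p.2 n) p.1 ∈ A}
      ≤ averaged P 0 (S ∩ pairShift n ⁻¹' (Prod.fst ⁻¹' A)) + averaged P 0 Sᶜ := by
        refine le_trans (measure_mono ?_) (measure_union_le _ _)
        intro p hp
        by_cases hpS : p ∈ S
        · exact Or.inl ⟨hpS, hp⟩
        · exact Or.inr hpS
    _ ≤ _ := by
        rw [hfresh, e1]
        gcongr
        exact mul_le_of_le_one_left' prob_le_one

theorem IsLimitLaw.dVar_le {d : ℕ} {ν : Measure (ProbVec d)} [IsProbabilityMeasure ν]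
    {u : Site d} {G : Measure (Env d)} [IsProbabilityMeasure G] (h : IsLimitLaw ν u G)
    {s : ℝ} (hs : 0 < s) {ρ : ℝ≥0∞} (hρ : ρ < 1) (hd : UniformDrift u s ρ (iidLaw ν)) {ℓ : ℝ}
    (hℓ : 0 ≤ ℓ) :
    dVar (levelSigma u ℓ) G (iidLaw ν) ≤ ((1 - ρ)⁻¹).toReal * Real.exp (-s * ℓ) := by
  have : Nonempty {A : Set (Env d) // MeasurableSet[levelSigma u ℓ] A} :=
    ⟨⟨∅, @MeasurableSet.empty _ (levelSigma u ℓ)⟩⟩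
  refine ciSup_le fun ⟨A, hA⟩ => ?_
  rw [measurableSet_levelSigma_iff] at hA
  have hk : (0 : ℤ) ≤ ⌈ℓ⌉ := Int.ceil_nonneg hℓ
  have h1 := h.tendsto (b := 0) (hA.mono (by simpa using hk))
  have h2 : ∀ n, (envLaw (iidLaw ν) n).real A
      ≤ (iidLaw ν).real A + ((1 - ρ)⁻¹).toReal * Real.exp (-s * ℓ) := by
    intro n
    have h3 := ENNReal.toReal_mono (ENNReal.add_ne_top.2 ⟨measure_ne_top _ _,
      ENNReal.mul_ne_top ENNReal.ofReal_ne_top (one_sub_inv_ne_top hρ)⟩)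
      (envLaw_iidLaw_le hs hd n hA)
    rw [ENNReal.toReal_add (measure_ne_top _ _) (ENNReal.mul_ne_top ENNReal.ofReal_ne_top
      (one_sub_inv_ne_top hρ)), ENNReal.toReal_mul, ENNReal.toReal_ofReal (Real.exp_pos _).le] at h3
    refine h3.trans ?_
    rw [mul_comm]
    gcongr ?_ + _ * Real.exp ?_
    · rfl
    · nlinarith [Int.le_ceil ℓ]
  have h4 := le_of_tendsto_of_tendsto h1 (tendsto_cesaro_const _)
    (Eventually.of_forall fun N => cesaro_mono h2 N)
  simp only
  linarith

theorem measurableSet_summable {α ι : Type*} [MeasurableSpace α] [Countable ι] {f : ι → α → ℝ}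
    (hf : ∀ i, Measurable (f i)) : MeasurableSet {a | Summable fun i => f i a} := by
  have h := StronglyMeasurable.measurableSet_exists_tendsto (l := atTop)
    (f := fun (s : Finset ι) a => ∑ i ∈ s, f i a)
    fun s => (Finset.measurable_fun_sum s fun i _ => hf i).stronglyMeasurable
  simpa [Summable, HasSum] using h

/-- Off the set of summability both sides of the approximation by partial sums vanish. -/
theorem measurable_tsum_real {α ι : Type*} [MeasurableSpace α] [Countable ι] {f : ι → α → ℝ}
    (hf : ∀ i, Measurable (f i)) : Measurable fun a => ∑' i, f i a := by
  refine measurable_of_tendsto_metrizable' (atTop : Filter (Finset ι))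
    (f := fun s => {a | Summable fun i => f i a}.indicator fun a => ∑ i ∈ s, f i a)
    (fun s => (Finset.measurable_fun_sum s fun i _ => hf i).indicator
      (measurableSet_summable hf)) ?_
  rw [tendsto_pi_nhds]
  intro a
  by_cases ha : Summable fun i => f i a
  · simpa [ha, HasSum] using ha.hasSum
  · simp [ha, tsum_eq_zero_of_not_summable ha]

theorem IsLimitLaw.hypothesisN {d : ℕ} {ν : Measure (ProbVec d)} [IsProbabilityMeasure ν]
    {u : Site d} {G : Measure (Env d)} [IsProbabilityMeasure G] (h : IsLimitLaw ν u G)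
    (hN : HypothesisN u (iidLaw ν)) : HypothesisN u G := by
  obtain ⟨δ, hδ, hN⟩ := hN
  refine ⟨δ, hδ, h.ae_of_ae ⟨?_, ?_⟩ hN⟩
  · have hm : ∀ z : Site d, Measurable fun ω : Env d => (dot z u : ℝ) * trans ω 0 z :=
      fun z => (measurable_trans 0 z).const_mul _
    exact (measurableSet_summable hm).inter
      (measurableSet_le measurable_const (measurable_tsum_real hm))
  · ext ω
    simp [trans, trunc_apply_of_le]

theorem IsLimitLaw.hypothesisM {d : ℕ} {ν : Measure (ProbVec d)} [IsProbabilityMeasure ν]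
    {u : Site d} {G : Measure (Env d)} [IsProbabilityMeasure G] (h : IsLimitLaw ν u G)
    (hM : HypothesisM (iidLaw ν)) : HypothesisM G := by
  obtain ⟨M, s₀, hM0, hs₀, hM⟩ := hM
  refine ⟨M, s₀, hM0, hs₀, h.ae_of_ae ⟨?_, ?_⟩ hM⟩
  · have hm : ∀ z : Site d, Measurable fun ω : Env d => Real.exp (s₀ * eNorm z) * trans ω 0 z :=
      fun z => (measurable_trans 0 z).const_mul _
    exact (measurableSet_summable hm).inter
      (measurableSet_le (measurable_tsum_real hm) measurable_const)
  · ext ω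
    simp [trans, trunc_apply_of_le]

/-! ### Ergodicity of the limit law -/

theorem exists_isHalf_symmDiff_lt {d : ℕ} (u : Site d) (μ : Measure (Env d)) [IsFiniteMeasure μ]
    {A : Set (Env d)} (hA : MeasurableSet A) {ε : ℝ≥0∞} (hε : 0 < ε) :
    ∃ (b : ℕ) (A' : Set (Env d)), IsHalf u (-b) A' ∧ μ (symmDiff A' A) < ε := by
  have hC : IsSetRing {A : Set (Env d) | ∃ b : ℕ, IsHalf u (-b) A} := by
    refine ⟨⟨0, by simpa using (isHalf_univ u 0).compl⟩, ?_, ?_⟩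
    · rintro A B ⟨a, hA⟩ ⟨b, hB⟩
      refine ⟨max a b, ?_⟩
      have := ((hA.mono (ℓ' := -((max a b : ℕ) : ℤ)) (by push_cast; omega)).compl.inter
        (hB.mono (ℓ' := -((max a b : ℕ) : ℤ)) (by push_cast; omega)).compl).compl
      simpa [Set.compl_inter] using this
    · rintro A B ⟨a, hA⟩ ⟨b, hB⟩
      refine ⟨max a b, ?_⟩
      exact (hA.mono (ℓ' := -((max a b : ℕ) : ℤ)) (by push_cast; omega)).inter
        (hB.mono (ℓ' := -((max a b : ℕ) : ℤ)) (by push_cast; omega)).compl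
  obtain ⟨A', ⟨b, hA'⟩, h⟩ := exists_measure_symmDiff_lt_of_generateFrom_isSetRing (μ := μ) hC
    ⟨{Set.univ}, Set.countable_singleton _, by simpa using ⟨0, isHalf_univ u 0⟩, by simp⟩
    (generateFrom_isHalf u) hA hε
  exact ⟨b, A', hA', h⟩

theorem averaged_le_of_le {d : ℕ} {μ μ' : Measure (Env d)} [SFinite μ] [SFinite μ'] {c : ℝ≥0∞}
    (h : μ ≤ c • μ') {S : Set (Env d × Path d)} (hS : MeasurableSet S) :
    averaged μ 0 S ≤ c * averaged μ' 0 S := by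
  rw [averaged_apply _ hS, averaged_apply _ hS, ← smul_eq_mul, ← lintegral_smul_measure]
  exact lintegral_mono' h le_rfl

theorem BoundedBacktrack.of_le {d : ℕ} {u : Site d} {μ μ' : Measure (Env d)}
    [IsProbabilityMeasure μ] [IsProbabilityMeasure μ'] {c : ℝ≥0∞} (hc : c ≠ ∞) (h : μ ≤ c • μ')
    (hb : BoundedBacktrack u μ') : BoundedBacktrack u μ := by
  intro ε hε
  obtain ⟨L, hL⟩ := hb (ε / (c.toReal + 1)) (by positivity)
  refine ⟨L, ?_⟩
  have h1 := ENNReal.toReal_mono (ENNReal.mul_ne_top hc (measure_ne_top _ _))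
    (averaged_le_of_le h (measurableSet_snd_staysAbove u (-L)).compl)
  rw [ENNReal.toReal_mul] at h1
  refine h1.trans ?_
  calc c.toReal * _ ≤ c.toReal * (ε / (c.toReal + 1)) := by
        gcongr
        exact hL
    _ = (c.toReal / (c.toReal + 1)) * ε := by ring
    _ ≤ 1 * ε := by
        gcongr
        rw [div_le_one (by positivity)]
        linarith
    _ = ε := one_mul ε

theorem envLaw_compl_eq_zero {d : ℕ} {G μ : Measure (Env d)} [IsProbabilityMeasure G]
    [IsProbabilityMeasure μ] (hG : envLaw G 1 = G) (hμ : μ ≪ G) {A : Set (Env d)}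
    (hA : MeasurableSet A) (hinv : ∀ᵐ ω ∂G, envKernel d ω A = A.indicator 1 ω) (h0 : μ Aᶜ = 0)
    (n : ℕ) : envLaw μ n Aᶜ = 0 := by
  induction n with
  | zero => rwa [envLaw_zero]
  | succ n ih =>
    have hac : envLaw μ n ≪ G := by
      have := envLaw_absolutelyContinuous hμ n
      rwa [envLaw_of_invariant hG n] at this
    rw [envLaw_add, envLaw_one_apply _ hA.compl, lintegral_eq_zero_iff
      (Kernel.measurable_coe (envKernel d) hA.compl)]
    filter_upwards [hac.ae_le hinv, measure_eq_zero_iff_ae_notMem.1 ih] with ω h1 h2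
    have h3 : ω ∈ A := by simpa using h2
    rw [Set.indicator_of_mem h3, Pi.one_apply, envKernel_apply _ hA] at h1
    have hm : MeasurableSet {X : Path d | shift (X 1) ω ∈ A} :=
      ((measurable_shift_path 1).comp measurable_prodMk_left) hA
    rw [envKernel_apply _ hA.compl]
    exact (prob_compl_eq_zero_iff hm).2 h1

/-- The limit law is ergodic: started from the limit law conditioned on an invariant event `A`, the
environment process stays in `A`, but by loss of memory it still converges to the limit law. -/
theorem IsLimitLaw.isErgodicFor {d : ℕ} {ν : Measure (ProbVec d)} [IsProbabilityMeasure ν]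
    {u : Site d} {G : Measure (Env d)} [IsProbabilityMeasure G] (h : IsLimitLaw ν u G)
    (hG : envLaw G 1 = G) (hbt : BoundedBacktrack u G) : IsErgodicFor (envKernel d) G := by
  intro A hA hinv
  by_cases hA0 : G A = 0
  · exact Or.inl hA0
  refine Or.inr (le_antisymm prob_le_one ?_)
  set μ := ProbabilityTheory.cond G A with hμ
  have : IsProbabilityMeasure μ := cond_isProbabilityMeasure hA0
  have hμG : μ ≤ (G A)⁻¹ • G := by
    rw [hμ, ProbabilityTheory.cond]
    gcongr
    exact Measure.restrict_le_self
  have hcA : (G A)⁻¹ ≠ ∞ := ENNReal.inv_ne_top.2 hA0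
  have hμac : μ ≪ G := cond_absolutelyContinuous
  have hstay := envLaw_compl_eq_zero hG hμac hA hinv (by
    rw [hμ, ProbabilityTheory.cond_apply hA]
    simp)
  set c := ((G A)⁻¹).toReal with hc
  have key : ∀ ε : ℝ, 0 < ε → 1 - G.real A ≤ (c + 1) * ε := by
    intro ε hε
    obtain ⟨b, A', hA', hd⟩ := exists_isHalf_symmDiff_lt u G hA (ENNReal.ofReal_pos.2 hε)
    have hd' : G.real (symmDiff A' A) ≤ ε := by
      rw [measureReal_def]
      exact (ENNReal.toReal_mono ENNReal.ofReal_ne_top hd.le).trans_eq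
        (ENNReal.toReal_ofReal hε.le)
    have h1 := h.tendsto_envLaw hA' (μ := μ)
      (fun b B hB h0 => hμac (h.measure_eq_zero hB h0)) (hbt.of_le hcA hμG)
    have h2 : ∀ n, 1 - c * ε ≤ (envLaw μ n).real A' := by
      intro n
      have hle : (envLaw μ n).real (symmDiff A' A) ≤ c * ε := by
        have hm : MeasurableSet (symmDiff A' A) := hA'.1.symmDiff hA
        have h4 : envLaw μ n (symmDiff A' A) ≤ (G A)⁻¹ * G (symmDiff A' A) := by
          have h3 := averaged_le_of_le hμG (measurable_shift_path n hm)
          have e1 := envLaw_apply G n hm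
          rw [envLaw_of_invariant hG n] at e1
          rw [envLaw_apply _ _ hm, e1]
          exact h3
        have h5 := ENNReal.toReal_mono (ENNReal.mul_ne_top hcA (measure_ne_top _ _)) h4
        rw [ENNReal.toReal_mul] at h5
        exact h5.trans (by gcongr; exact hd')
      have huniv : (1 : ℝ) ≤ (envLaw μ n).real A' + ((envLaw μ n).real (symmDiff A' A)
          + (envLaw μ n).real Aᶜ) := by
        refine (probReal_univ (μ := envLaw μ n)).symm.le.trans ?_
        refine le_trans (measureReal_mono (s₂ := A' ∪ (symmDiff A' A ∪ Aᶜ)) ?_)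
          ((measureReal_union_le _ _).trans (by gcongr; exact measureReal_union_le _ _))
        intro ω _
        simp only [Set.mem_union, Set.mem_symmDiff, Set.mem_compl_iff]
        tauto
      have h0 : (envLaw μ n).real Aᶜ = 0 := by rw [measureReal_def, hstay, ENNReal.toReal_zero]
      linarith
    have h3 := le_of_tendsto_of_tendsto (tendsto_cesaro_const _) h1
      (Eventually.of_forall fun N => cesaro_mono h2 N)
    have h4 : G.real A' ≤ G.real A + G.real (symmDiff A' A) := by
      refine le_trans (measureReal_mono ?_) (measureReal_union_le _ _)
      intro ω hω
      simp only [Set.mem_union, Set.mem_symmDiff]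
      tauto
    linarith
  have hc0 : 0 ≤ c := ENNReal.toReal_nonneg
  have h1 : 1 - G.real A ≤ 0 := by
    refine le_of_forall_pos_le_add fun ε hε => ?_
    have := key (ε / (c + 1)) (by positivity)
    rwa [mul_div_cancel₀ _ (by positivity), ← zero_add ε] at this
  rw [← ENNReal.ofReal_one, ← ofReal_measureReal (μ := G) (s := A)]
  exact ENNReal.ofReal_le_ofReal (by linarith)

theorem exists_isInvariantLimit {d : ℕ} {ν : Measure (ProbVec d)} [IsProbabilityMeasure ν]
    {u : Site d} (hN : HypothesisN u (iidLaw ν)) (hM : HypothesisM (iidLaw ν)) :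
    ∃ G : Measure (Env d), IsInvariantLimit u (iidLaw ν) G := by
  obtain ⟨s, ρ, hs, hρ, hd⟩ := exists_expDrift hN hM
  obtain ⟨G, hGp, h⟩ := exists_limit_law hs hρ (uniformDrift_iidLaw hd)
  have h1 : envLaw G 1 = G := h.envLaw_one hs hρ hd
  have h2 : UniformDrift u s ρ G :=
    uniformDrift_of_invariant h1 (h.ae_of_ae (isHalf_expDrift u s ρ) hd)
  refine ⟨G, hGp, (invariant_iff G).2 h1,
    h.isErgodicFor h1 (boundedBacktrack_of_uniformDrift hs hρ h2), ⟨s, ((1 - ρ)⁻¹).toReal, hs, ?_,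
      fun ℓ hℓ => h.dVar_le hs hρ (uniformDrift_iidLaw hd) hℓ⟩, h.hypothesisN hN, h.hypothesisM hM⟩
  refine ENNReal.toReal_pos (ENNReal.inv_ne_zero.2 ?_) (one_sub_inv_ne_top hρ)
  exact (tsub_le_self.trans_lt ENNReal.one_lt_top).ne

/-! ### Uniqueness of the invariant measure -/

theorem le_dVar {d : ℕ} {u : Site d} {ℓ : ℝ} (μ μ' : Measure (Env d)) [IsProbabilityMeasure μ]
    [IsProbabilityMeasure μ'] {A : Set (Env d)} (hA : IsHalf u ⌈ℓ⌉ A) :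
    μ.real A - μ'.real A ≤ dVar (levelSigma u ℓ) μ μ' := by
  refine le_ciSup (f := fun A : {A : Set (Env d) // MeasurableSet[levelSigma u ℓ] A} =>
    μ.real A.1 - μ'.real A.1) ⟨1, ?_⟩ ⟨A, (measurableSet_levelSigma_iff u ℓ A).2 hA⟩
  rintro _ ⟨B, rfl⟩
  have h1 : μ.real B.1 ≤ 1 := measureReal_le_one
  have h2 : 0 ≤ μ'.real B.1 := measureReal_nonneg
  simp only
  linarith

/-- An invariant measure that is close to the product law far up is absolutely continuous on
half-spaces: the walk moves a null event far up, where it can only be charged by the small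
difference between the two laws. -/
theorem IsInvariantLimit.measure_eq_zero {d : ℕ} {ν : Measure (ProbVec d)} [IsProbabilityMeasure ν]
    {u : Site d} {G : Measure (Env d)} (h : IsInvariantLimit u (iidLaw ν) G) {b : ℕ}
    {A : Set (Env d)} (hA : IsHalf u (-b) A) (h0 : iidLaw ν A = 0) : G A = 0 := by
  have := h.prob
  obtain ⟨s, ρ, hs, hρ, hd⟩ := exists_expDrift h.nonnestling h.moment
  have hG := (invariant_iff G).1 h.invariant
  have hU : UniformDrift u s ρ G := uniformDrift_of_invariant hG hd
  obtain ⟨c, C, hc, hC, hclose⟩ := h.close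
  have key : ∀ ℓ : ℕ, G.real A ≤ C * Real.exp (-c * ℓ) := by
    intro ℓ
    set Z : Set (Site d) := {z | ((b + ℓ : ℕ) : ℤ) ≤ dot z u} with hZ
    set B : Set (Env d) := ⋃ z ∈ Z, shift z ⁻¹' A with hB
    have hBH : IsHalf u (ℓ : ℤ) B := by
      refine isHalf_biUnion Z Z.to_countable fun z hz => (hA.preimage_shift z).mono ?_
      have : ((b + ℓ : ℕ) : ℤ) ≤ dot z u := hz
      push_cast at this
      omega
    have hB0 : iidLaw ν B = 0 := by
      rw [hB, measure_biUnion_null_iff Z.to_countable]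
      intro z _
      rw [← Measure.map_apply (measurable_shift z) hA.1, map_shift_iidLaw, h0]
    have hGB : G.real B ≤ C * Real.exp (-c * ℓ) := by
      have h1 := le_dVar (u := u) (ℓ := (ℓ : ℝ)) G (iidLaw ν) (A := B) (by simpa using hBH)
      rw [measureReal_def (iidLaw ν), hB0, ENNReal.toReal_zero, sub_zero] at h1
      exact h1.trans (hclose ℓ (by positivity))
    have hn : ∀ n, G A ≤ ENNReal.ofReal (Real.exp (-s * (-((b + ℓ : ℕ) : ℝ)))) * ρ ^ n + G B := by
      intro n
      have e1 := envLaw_apply G n hA.1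
      rw [envLaw_of_invariant hG n] at e1
      have e2 : G B = averaged G 0 (Prod.fst ⁻¹' B) := by
        rw [← Measure.map_apply measurable_fst hBH.1, averaged_fst]
      rw [e1, e2]
      refine le_trans (measure_mono ?_) ((measure_union_le _ _).trans
        (add_le_add_left (averaged_dot_le hs.le hU n (-((b + ℓ : ℕ) : ℝ))) _))
      intro p hp
      by_cases hz : ((b + ℓ : ℕ) : ℤ) ≤ dot (p.2 n) u
      · exact Or.inr (Set.mem_biUnion (x := p.2 n) hz hp)
      · left
        have h2 : dot (p.2 n) u ≤ ((b + ℓ : ℕ) : ℤ) := by omega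
        have h3 : ((dot (p.2 n) u : ℤ) : ℝ) ≤ (((b + ℓ : ℕ) : ℤ) : ℝ) := by exact_mod_cast h2
        simpa using h3
    have hlim : Tendsto (fun n : ℕ =>
        ENNReal.ofReal (Real.exp (-s * (-((b + ℓ : ℕ) : ℝ)))) * ρ ^ n + G B) atTop (𝓝 (G B)) := by
      have h2 := ENNReal.Tendsto.const_mul (ENNReal.tendsto_pow_atTop_nhds_zero_of_lt_one hρ)
        (Or.inr (ENNReal.ofReal_ne_top (r := Real.exp (-s * (-((b + ℓ : ℕ) : ℝ))))))
      simpa using h2.add_const (G B)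
    have h3 := ge_of_tendsto' hlim hn
    exact (ENNReal.toReal_mono (measure_ne_top _ _) h3).trans hGB
  have hlim : Tendsto (fun ℓ : ℕ => C * Real.exp (-c * ℓ)) atTop (𝓝 0) := by
    have h1 : Tendsto (fun L : ℕ => Real.exp (-c * L)) atTop (𝓝 0) :=
      Real.tendsto_exp_atBot.comp
        (tendsto_natCast_atTop_atTop.const_mul_atTop_of_neg (by linarith))
    simpa using h1.const_mul C
  exact (measureReal_eq_zero_iff (measure_ne_top _ _)).1 (le_antisymm (ge_of_tendsto' hlim key) measureReal_nonneg)

/-- The invariant measure is the limit law of the environment process: by loss of memory, the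
environment process started from it converges to the limit law. -/
theorem IsInvariantLimit.isLimitLaw {d : ℕ} {ν : Measure (ProbVec d)} [IsProbabilityMeasure ν]
    {u : Site d} (hN : HypothesisN u (iidLaw ν)) (hM : HypothesisM (iidLaw ν))
    {G : Measure (Env d)} (h : IsInvariantLimit u (iidLaw ν) G) : IsLimitLaw ν u G := by
  have := h.prob
  obtain ⟨s, ρ, hs, hρ, hd⟩ := exists_expDrift hN hM
  obtain ⟨G', hGp, hlim⟩ := exists_limit_law hs hρ (uniformDrift_iidLaw hd)
  obtain ⟨s', ρ', hs', hρ', hd'⟩ := exists_expDrift h.nonnestling h.moment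
  have hG := (invariant_iff G).1 h.invariant
  have e : G = G' := by
    refine env_measure_ext u fun b A hA => ?_
    have h1 := hlim.tendsto_envLaw hA (fun b A hA h0 => h.measure_eq_zero hA h0)
      (boundedBacktrack_of_uniformDrift hs' hρ' (uniformDrift_of_invariant hG hd'))
    simp only [envLaw_of_invariant hG] at h1
    have h2 := tendsto_nhds_unique (tendsto_cesaro_const _) h1
    rwa [measureReal_def, measureReal_def,
      ENNReal.toReal_eq_toReal_iff' (measure_ne_top _ _) (measure_ne_top _ _)] at h2
  rw [e]
  exact hlim

/-! ### The pointwise ergodic theorem for bounded functions -/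

section Birkhoff

variable {α : Type*}

/-- The running maximum `max (0, S₁, …, Sₙ)` of the Birkhoff sums, by recursion on `n`. -/
noncomputable def maxBirkhoff (T : α → α) (f : α → ℝ) : ℕ → α → ℝ
  | 0, _ => 0
  | n + 1, x => max 0 (f x + maxBirkhoff T f n (T x))

theorem maxBirkhoff_nonneg (T : α → α) (f : α → ℝ) (n : ℕ) (x : α) : 0 ≤ maxBirkhoff T f n x := by
  cases n with
  | zero => exact le_rfl
  | succ n => exact le_max_left _ _

theorem maxBirkhoff_le_succ (T : α → α) (f : α → ℝ) (n : ℕ) (x : α) :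
    maxBirkhoff T f n x ≤ maxBirkhoff T f (n + 1) x := by
  induction n generalizing x with
  | zero => exact maxBirkhoff_nonneg T f 1 x
  | succ n ih =>
    rw [maxBirkhoff, maxBirkhoff]
    gcongr
    exact ih (T x)

theorem birkhoffSum_le_maxBirkhoff (T : α → α) (f : α → ℝ) (n : ℕ) (x : α) :
    birkhoffSum T f n x ≤ maxBirkhoff T f n x := by
  induction n generalizing x with
  | zero => simp [maxBirkhoff]
  | succ n ih =>
    rw [birkhoffSum_succ', maxBirkhoff]
    exact (add_le_add_right (ih (T x)) _).trans (le_max_right _ _)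

variable [MeasurableSpace α] {m : Measure α} {T : α → α} {f : α → ℝ}

theorem integrable_maxBirkhoff (hT : MeasurePreserving T m m) (hf : Integrable f m) (n : ℕ) :
    Integrable (maxBirkhoff T f n) m := by
  induction n with
  | zero => exact integrable_zero _ _ _
  | succ n ih =>
    exact (integrable_zero _ _ _).sup (hf.add (hT.integrable_comp_of_integrable ih))

theorem measurable_maxBirkhoff (hT : Measurable T) (hf : Measurable f) (n : ℕ) :
    Measurable (maxBirkhoff T f n) := by
  induction n with
  | zero => exact measurable_const
  | succ n ih => exact measurable_const.max (hf.add (ih.comp hT))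

variable [IsProbabilityMeasure m]

/-- If `f` has negative mean, its Birkhoff sums are almost surely bounded above. Otherwise the
running maxima `Mₙ` tend to infinity almost surely, by ergodicity, so that
`Mₙ₊₁ - Mₙ ∘ T = max (-Mₙ ∘ T, f)` decreases to `f`; but its integral is nonnegative. -/
theorem ae_bddAbove_birkhoffSum (hT : Ergodic T m) (hf : Measurable f) (hfi : Integrable f m)
    (hneg : ∫ x, f x ∂m < 0) : ∀ᵐ x ∂m, ∃ K : ℝ, ∀ n, birkhoffSum T f n x ≤ K := by
  set M := maxBirkhoff T f with hM
  have hMm : ∀ n, Measurable (M n) := measurable_maxBirkhoff hT.measurable hf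
  have hMi : ∀ n, Integrable (M n) m := integrable_maxBirkhoff hT.toMeasurePreserving hfi
  have hmono : ∀ x, Monotone fun n => M n x := fun x =>
    monotone_nat_of_le_succ fun n => maxBirkhoff_le_succ T f n x
  set A : Set α := {x | ∀ K : ℕ, ∃ n, (K : ℝ) < M n x} with hA
  have hAm : MeasurableSet A := by
    have : A = ⋂ K : ℕ, ⋃ n, {x | (K : ℝ) < M n x} := by
      ext x; simp [hA]
    rw [this]
    exact MeasurableSet.iInter fun K => MeasurableSet.iUnion fun n =>
      measurableSet_lt measurable_const (hMm n)
  have hAT : T ⁻¹' A = A := by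
    ext x
    simp only [hA, Set.mem_preimage, Set.mem_ofPred_eq]
    constructor
    · intro h K
      obtain ⟨K', hK'⟩ := exists_nat_gt (K - f x)
      obtain ⟨n, hn⟩ := h K'
      exact ⟨n + 1, lt_of_lt_of_le (by linarith) (le_max_right 0 (f x + M n (T x)))⟩
    · intro h K
      obtain ⟨K', hK'⟩ := exists_nat_gt (|f x| + K)
      obtain ⟨n, hn⟩ := h K'
      have hK0 : (0 : ℝ) ≤ K := Nat.cast_nonneg K
      cases n with
      | zero =>
        have h0 : M 0 x = 0 := rfl
        have := abs_nonneg (f x)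
        linarith
      | succ n =>
        have h1 : M (n + 1) x = max 0 (f x + M n (T x)) := rfl
        rw [h1] at hn
        refine ⟨n, ?_⟩
        have := abs_nonneg (f x)
        have := le_abs_self (f x)
        rcases lt_max_iff.1 hn with h2 | h2 <;> linarith
  have hA0 : m A = 0 := by
    refine (hT.toPreErgodic.prob_eq_zero_or_one hAm hAT).resolve_right fun hA1 => ?_
    have hAae : ∀ᵐ x ∂m, x ∈ A := (prob_compl_eq_zero_iff hAm).2 hA1
    have hdiff : ∀ n x, M (n + 1) x - M n (T x) = max (-M n (T x)) (f x) := by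
      intro n x
      have h1 : M (n + 1) x = max 0 (f x + M n (T x)) := rfl
      rw [h1, ← max_sub_sub_right]
      congr 1 <;> ring
    have hint : ∀ n, 0 ≤ ∫ x, max (-M n (T x)) (f x) ∂m := by
      intro n
      have h1 : ∫ x, M n (T x) ∂m = ∫ x, M n x ∂m := by
        have h2 := integral_map (μ := m) (f := M n) hT.measurable.aemeasurable
          (hMm n).aestronglyMeasurable
        rw [hT.map_eq] at h2
        exact h2.symm
      simp only [← hdiff]
      have h3 : Integrable (fun x => M n (T x)) m :=
        hT.toMeasurePreserving.integrable_comp_of_integrable (hMi n)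
      rw [integral_sub (hMi (n + 1)) h3, h1, sub_nonneg]
      exact integral_mono (hMi n) (hMi (n + 1)) fun x => hmono x (Nat.le_succ n)
    have hlim : Tendsto (fun n => ∫ x, max (-M n (T x)) (f x) ∂m) atTop (𝓝 (∫ x, f x ∂m)) := by
      refine tendsto_integral_of_dominated_convergence (fun x => |f x|)
        (fun n => (((hMm n).comp hT.measurable).neg.max hf).aestronglyMeasurable) hfi.abs
        (fun n => Eventually.of_forall fun x => ?_) ?_
      · have h0 : 0 ≤ M n (T x) := maxBirkhoff_nonneg T f n (T x)
        rw [Real.norm_eq_abs, abs_le]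
        exact ⟨(neg_abs_le _).trans (le_max_right _ _),
          max_le (by linarith [abs_nonneg (f x)]) (le_abs_self _)⟩
      · filter_upwards [hAae] with x hx
        have hx' : T x ∈ A := by rwa [← Set.mem_preimage, hAT]
        refine tendsto_const_nhds.congr' ?_
        obtain ⟨K, hK⟩ := exists_nat_gt (-f x)
        obtain ⟨n₀, hn₀⟩ := hx' K
        filter_upwards [eventually_ge_atTop n₀] with n hn
        have h3 := hmono (T x) hn
        simp only at h3
        exact (max_eq_right (by linarith)).symm
    linarith [ge_of_tendsto' hlim hint]
  filter_upwards [measure_eq_zero_iff_ae_notMem.1 hA0] with x hx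
  simp only [hA, Set.mem_ofPred_eq, not_forall, not_exists, not_lt] at hx
  obtain ⟨K, hK⟩ := hx
  exact ⟨K, fun n => (birkhoffSum_le_maxBirkhoff T f n x).trans (hK n)⟩

theorem ae_eventually_birkhoffSum_le (hT : Ergodic T m) (hf : Measurable f) (hfi : Integrable f m)
    {c : ℝ} (hc : ∫ x, f x ∂m < c) :
    ∀ᵐ x ∂m, ∀ᶠ n : ℕ in atTop, (n : ℝ)⁻¹ * birkhoffSum T f n x ≤ c := by
  obtain ⟨c', hc', hcc'⟩ := exists_between hc
  have hg : Integrable (fun x => f x - c') m := hfi.sub (integrable_const c')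
  have h1 := ae_bddAbove_birkhoffSum hT (f := fun x => f x - c') (hf.sub_const c') hg (by
    rw [integral_sub hfi (integrable_const c')]
    simpa using hc')
  filter_upwards [h1] with x hx
  obtain ⟨K, hK⟩ := hx
  have h2 : ∀ n, birkhoffSum T f n x ≤ K + n * c' := by
    intro n
    have := hK n
    simp only [birkhoffSum, Finset.sum_sub_distrib, Finset.sum_const, Finset.card_range,
      nsmul_eq_mul] at this ⊢
    linarith
  have h3 : Tendsto (fun n : ℕ => (n : ℝ)⁻¹ * K) atTop (𝓝 0) := by
    simpa using tendsto_inv_atTop_nhds_zero_nat (𝕜 := ℝ).mul_const K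
  filter_upwards [h3.eventually_lt_const (sub_pos.2 hcc'), eventually_gt_atTop 0] with n hn hn0
  have hn0' : (0 : ℝ) < n := by exact_mod_cast hn0
  calc (n : ℝ)⁻¹ * birkhoffSum T f n x ≤ (n : ℝ)⁻¹ * (K + n * c') := by
        gcongr
        exact h2 n
    _ = (n : ℝ)⁻¹ * K + c' := by field_simp
    _ ≤ c := by linarith

/-- The pointwise ergodic theorem of Birkhoff, for an ergodic map. -/
theorem ae_tendsto_birkhoff (hT : Ergodic T m) (hf : Measurable f) (hfi : Integrable f m) :
    ∀ᵐ x ∂m, Tendsto (fun n : ℕ => (n : ℝ)⁻¹ * birkhoffSum T f n x) atTop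
      (𝓝 (∫ x, f x ∂m)) := by
  have hup : ∀ᵐ x ∂m, ∀ k : ℕ, ∀ᶠ n : ℕ in atTop,
      (n : ℝ)⁻¹ * birkhoffSum T f n x ≤ ∫ x, f x ∂m + 1 / ((k : ℝ) + 1) :=
    ae_all_iff.2 fun k => ae_eventually_birkhoffSum_le hT hf hfi
      (lt_add_of_pos_right _ (by positivity))
  have hlo : ∀ᵐ x ∂m, ∀ k : ℕ, ∀ᶠ n : ℕ in atTop,
      (n : ℝ)⁻¹ * birkhoffSum T (fun x => -f x) n x ≤ ∫ x, -f x ∂m + 1 / ((k : ℝ) + 1) :=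
    ae_all_iff.2 fun k => ae_eventually_birkhoffSum_le hT hf.neg hfi.neg
      (lt_add_of_pos_right _ (by positivity))
  filter_upwards [hup, hlo] with x h1 h2
  rw [Metric.tendsto_atTop]
  intro ε hε
  obtain ⟨k, hk⟩ := exists_nat_one_div_lt hε
  obtain ⟨N, hN⟩ := eventually_atTop.1 ((h1 k).and (h2 k))
  refine ⟨N, fun n hn => ?_⟩
  have h3 := hN n hn
  have e : birkhoffSum T (fun x => -f x) n x = -birkhoffSum T f n x := by
    simp [birkhoffSum]
  rw [e, integral_neg, mul_neg] at h3
  rw [Real.dist_eq, abs_lt]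
  constructor <;> linarith [h3.1, h3.2]

end Birkhoff

/-! ### Ergodicity of the walk seen together with its environment -/

theorem pairShift_one_iterate {d : ℕ} (n : ℕ) (p : Env d × Path d) :
    (pairShift 1)^[n + 1] p = pairShift (n + 1) p := by
  induction n with
  | zero => rfl
  | succ n ih => rw [Function.iterate_succ_apply', ih, pairShift_pairShift]

theorem preimage_pairShift_of_invariant {d : ℕ} {B : Set (Env d × Path d)}
    (hB : pairShift 1 ⁻¹' B = B) (n : ℕ) : pairShift (n + 1) ⁻¹' B = B := by
  ext p
  induction n with
  | zero => exact Set.ext_iff.1 hB p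
  | succ n ih =>
    have h := Set.ext_iff.1 hB (pairShift (n + 1) p)
    rw [Set.mem_preimage, pairShift_pairShift] at h
    exact h.trans ih

/-- `S` is an event of the environment and of the walk up to time `n`. -/
def IsPast {d : ℕ} (n : ℕ) (S : Set (Env d × Path d)) : Prop :=
  MeasurableSet S ∧
    ∀ ω, ∀ X Y : Path d, (∀ i ≤ n, X i = Y i) → ((ω, X) ∈ S ↔ (ω, Y) ∈ S)

theorem IsPast.mono {d : ℕ} {m n : ℕ} {S : Set (Env d × Path d)} (hS : IsPast m S) (h : m ≤ n) :
    IsPast n S :=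
  ⟨hS.1, fun ω X Y hXY => hS.2 ω X Y fun i hi => hXY i (hi.trans h)⟩

theorem isPiSystem_isPast (d : ℕ) :
    IsPiSystem {S : Set (Env d × Path d) | ∃ n, IsPast n S} := by
  rintro S ⟨m, hS⟩ S' ⟨n, hS'⟩ -
  have h1 := hS.mono (le_max_left m n)
  have h2 := hS'.mono (le_max_right m n)
  exact ⟨max m n, h1.1.inter h2.1, fun ω X Y hXY => and_congr (h1.2 ω X Y hXY) (h2.2 ω X Y hXY)⟩

theorem generateFrom_isPast (d : ℕ) :
    (inferInstance : MeasurableSpace (Env d × Path d))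
      = MeasurableSpace.generateFrom {S : Set (Env d × Path d) | ∃ n, IsPast n S} := by
  apply le_antisymm
  · refine sup_le ?_ ?_
    · rintro _ ⟨E, hE, rfl⟩
      exact MeasurableSpace.measurableSet_generateFrom
        ⟨0, measurable_fst hE, fun ω X Y _ => Iff.rfl⟩
    · rw [← measurable_iff_comap_le]
      refine (@measurable_pi_iff _ _ _ (_) _ _).2 fun n B hB => ?_
      refine MeasurableSpace.measurableSet_generateFrom
        ⟨n, ((measurable_pi_apply n).comp measurable_snd) hB, fun ω X Y hXY => ?_⟩
      simp only [Set.mem_preimage, hXY n le_rfl]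
  · refine MeasurableSpace.generateFrom_le ?_
    rintro S ⟨n, hS⟩
    exact hS.1

/-- A bounded harmonic function is almost surely constant along the stationary environment process:
the two sides have the same second moment, which is also their correlation. -/
theorem ae_harmonic_step {d : ℕ} {G : Measure (Env d)} [IsProbabilityMeasure G]
    (hG : envLaw G 1 = G) {g : Env d → ℝ≥0∞} (hgm : Measurable g) (hg1 : ∀ ω, g ω ≤ 1)
    (hharm : ∀ ω, ∫⁻ X, g (shift (X 1) ω) ∂(quenched ω 0) = g ω) :
    ∀ᵐ p ∂(averaged G 0), g (shift (p.2 1) p.1) = g p.1 := by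
  have ham : Measurable fun p : Env d × Path d => g p.1 := hgm.comp measurable_fst
  have hbm : Measurable fun p : Env d × Path d => g (shift (p.2 1) p.1) :=
    hgm.comp (measurable_shift_path 1)
  have haa : ∫⁻ p, g p.1 * g p.1 ∂(averaged G 0) = ∫⁻ ω, g ω * g ω ∂G := by
    have := lintegral_map (μ := averaged G 0) (f := fun ω => g ω * g ω) (hgm.mul hgm)
      measurable_fst
    rw [averaged_fst] at this
    exact this.symm
  have hab : ∫⁻ p, g p.1 * g (shift (p.2 1) p.1) ∂(averaged G 0) = ∫⁻ ω, g ω * g ω ∂G := by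
    rw [lintegral_averaged (f := fun p => g p.1 * g (shift (p.2 1) p.1)) G (ham.mul hbm)]
    refine lintegral_congr fun ω => ?_
    have h1 : Measurable fun X : Path d => g (shift (X 1) ω) := hbm.comp measurable_prodMk_left
    have h2 := lintegral_const_mul (μ := quenched ω 0) (g ω) h1
    rw [hharm] at h2
    exact h2
  have hbb : ∫⁻ p, g (shift (p.2 1) p.1) * g (shift (p.2 1) p.1) ∂(averaged G 0)
      = ∫⁻ ω, g ω * g ω ∂G := by
    have := lintegral_map (μ := averaged G 0) (f := fun ω => g ω * g ω) (hgm.mul hgm)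
      (measurable_shift_path 1)
    have e : (averaged G 0).map (fun p : Env d × Path d => shift (p.2 1) p.1) = G := hG
    rw [e] at this
    exact this.symm
  have hint : ∀ {f h : Env d × Path d → ℝ≥0∞}, Measurable f → Measurable h →
      (∀ p, f p ≤ 1) → (∀ p, h p ≤ 1) →
      Integrable (fun p => (f p).toReal * (h p).toReal) (averaged G 0) ∧
        ∫ p, (f p).toReal * (h p).toReal ∂(averaged G 0)
          = (∫⁻ p, f p * h p ∂(averaged G 0)).toReal := by
    intro f h hf hh hf1 hh1
    have hlt : ∀ p, f p * h p < ∞ := fun p =>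
      ENNReal.mul_lt_top ((hf1 p).trans_lt ENNReal.one_lt_top)
        ((hh1 p).trans_lt ENNReal.one_lt_top)
    constructor
    · refine Integrable.of_bound (C := 1) (hf.ennreal_toReal.mul
        hh.ennreal_toReal).aestronglyMeasurable (Eventually.of_forall fun p => ?_)
      rw [← ENNReal.toReal_mul, Real.norm_eq_abs, abs_of_nonneg ENNReal.toReal_nonneg]
      exact ENNReal.toReal_le_of_le_ofReal zero_le_one
        (by simpa using mul_le_one' (hf1 p) (hh1 p))
    · have h1 := integral_toReal (μ := averaged G 0) (f := fun p => f p * h p)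
        (hf.mul hh).aemeasurable (Eventually.of_forall hlt)
      simpa only [ENNReal.toReal_mul] using h1
  obtain ⟨i1, e1⟩ := hint ham ham (fun p => hg1 _) (fun p => hg1 _)
  obtain ⟨i2, e2⟩ := hint ham hbm (fun p => hg1 _) (fun p => hg1 _)
  obtain ⟨i3, e3⟩ := hint hbm hbm (fun p => hg1 _) (fun p => hg1 _)
  rw [haa] at e1
  rw [hab] at e2
  rw [hbb] at e3
  have hsq : ∀ p : Env d × Path d, ((g (shift (p.2 1) p.1)).toReal - (g p.1).toReal) ^ 2
      = ((g p.1).toReal * (g p.1).toReal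
        - 2 * ((g p.1).toReal * (g (shift (p.2 1) p.1)).toReal))
        + (g (shift (p.2 1) p.1)).toReal * (g (shift (p.2 1) p.1)).toReal := fun p => by ring
  have hi : Integrable (fun p : Env d × Path d =>
      ((g (shift (p.2 1) p.1)).toReal - (g p.1).toReal) ^ 2) (averaged G 0) := by
    simp only [hsq]
    exact (i1.sub (i2.const_mul 2)).add i3
  have h0 : ∫ p, ((g (shift (p.2 1) p.1)).toReal - (g p.1).toReal) ^ 2 ∂(averaged G 0) = 0 := by
    have h1 := integral_add (i1.sub (i2.const_mul 2)) i3
    have h2 := integral_sub i1 (i2.const_mul 2)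
    simp only [Pi.sub_apply] at h1
    simp only [hsq]
    rw [h1, h2, integral_const_mul, e1, e2, e3]
    ring
  have h1 := (integral_eq_zero_iff_of_nonneg (fun p => sq_nonneg _) hi).1 h0
  filter_upwards [h1] with p hp
  have h2 : (g (shift (p.2 1) p.1)).toReal = (g p.1).toReal :=
    sub_eq_zero.1 (pow_eq_zero_iff two_ne_zero |>.1 hp)
  exact (ENNReal.toReal_eq_toReal_iff' ((hg1 _).trans_lt ENNReal.one_lt_top).ne
    ((hg1 _).trans_lt ENNReal.one_lt_top).ne).1 h2

theorem ae_harmonic {d : ℕ} {G : Measure (Env d)} [IsProbabilityMeasure G]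
    (hG : envLaw G 1 = G) {g : Env d → ℝ≥0∞} (hgm : Measurable g) (hg1 : ∀ ω, g ω ≤ 1)
    (hharm : ∀ ω, ∫⁻ X, g (shift (X 1) ω) ∂(quenched ω 0) = g ω) (n : ℕ) :
    ∀ᵐ p ∂(averaged G 0), g (shift (p.2 n) p.1) = g p.1 := by
  induction n with
  | zero =>
    filter_upwards [ae_averaged_zero G] with p hp
    simp [hp]
  | succ n ih =>
    have e : (averaged G 0).map (pairShift n) = averaged G 0 := by
      rw [map_pairShift, envLaw_of_invariant hG]
    have h1 := ae_harmonic_step hG hgm hg1 hharm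
    rw [← e] at h1
    have h2 := ae_of_ae_map (measurable_pairShift n).aemeasurable h1
    filter_upwards [ih, h2] with p h3 h4
    rw [shift_pairShift] at h4
    rw [h4]
    exact h3

theorem lintegral_quenched_invariant {d : ℕ} {B : Set (Env d × Path d)} (hB : MeasurableSet B)
    (hinv : pairShift 1 ⁻¹' B = B) (ω : Env d) :
    ∫⁻ X, quenched (shift (X 1) ω) 0 (Prod.mk (shift (X 1) ω) ⁻¹' B) ∂(quenched ω 0)
      = quenched ω 0 (Prod.mk ω ⁻¹' B) := by
  have h := lintegral_quenched_markov ω 1 (f := fun _ => 1) (fun _ _ _ => rfl)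
    (F := fun z Y => B.indicator (1 : Env d × Path d → ℝ≥0∞) (shift z ω, Y))
    (fun z => (measurable_one.indicator hB).comp measurable_prodMk_left)
  simp only [one_mul] at h
  have e1 : ∀ ω' : Env d, ∫⁻ Y, B.indicator (1 : Env d × Path d → ℝ≥0∞) (ω', Y) ∂(quenched ω' 0)
      = quenched ω' 0 (Prod.mk ω' ⁻¹' B) := by
    intro ω'
    rw [← lintegral_indicator_one (measurable_prodMk_left hB)]
    rfl
  simp only [e1] at h
  rw [← h, ← e1 ω]
  refine lintegral_congr fun X => ?_
  have e2 : (shift (X 1) ω, tail 1 X) ∈ B ↔ (ω, X) ∈ B := Set.ext_iff.1 hinv (ω, X)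
  by_cases hX : (ω, X) ∈ B
  · rw [Set.indicator_of_mem hX, Set.indicator_of_mem (e2.2 hX)]
    rfl
  · rw [Set.indicator_of_notMem hX, Set.indicator_of_notMem fun h => hX (e2.1 h)]

/-- The conditional probability of a shift invariant event given the environment is its
indicator. By the Markov property and harmonicity, it is the conditional probability given the past
at every time. -/
theorem ae_quenched_invariant_eq_indicator {d : ℕ} {G : Measure (Env d)} [IsProbabilityMeasure G]
    (hG : envLaw G 1 = G) {B : Set (Env d × Path d)} (hB : MeasurableSet B)
    (hinv : pairShift 1 ⁻¹' B = B) :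
    ∀ᵐ p ∂(averaged G 0), quenched p.1 0 (Prod.mk p.1 ⁻¹' B) = B.indicator 1 p := by
  have hgm := measurable_quenched_slice hB
  have ham : Measurable fun p : Env d × Path d => quenched p.1 0 (Prod.mk p.1 ⁻¹' B) :=
    hgm.comp measurable_fst
  have hconst := ae_harmonic hG hgm (fun ω => prob_le_one) (lintegral_quenched_invariant hB hinv)
  have hcond : (averaged G 0).restrict B
      = (averaged G 0).withDensity fun p => quenched p.1 0 (Prod.mk p.1 ⁻¹' B) := by
    refine ext_of_generate_finite _ (generateFrom_isPast d) (isPiSystem_isPast d) ?_ ?_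
    · rintro S ⟨n, hS⟩
      have hS' := hS.mono (Nat.le_succ n)
      rw [Measure.restrict_apply hS.1, withDensity_apply _ hS.1]
      have h1 := averaged_markov G (n + 1) hS'.1 hS'.2 hB
      rw [preimage_pairShift_of_invariant hinv] at h1
      rw [h1]
      exact lintegral_congr_ae (ae_restrict_of_ae (hconst (n + 1)))
    · rw [Measure.restrict_apply_univ, withDensity_apply _ MeasurableSet.univ,
        Measure.restrict_univ, averaged_apply _ hB, lintegral_averaged G ham]
      refine lintegral_congr fun ω => ?_
      simp
  have h1 : (averaged G 0).withDensity (B.indicator 1)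
      = (averaged G 0).withDensity fun p => quenched p.1 0 (Prod.mk p.1 ⁻¹' B) := by
    rw [withDensity_indicator_one hB, hcond]
  exact ((withDensity_eq_iff_of_sigmaFinite (measurable_one.indicator hB).aemeasurable
    ham.aemeasurable).1 h1).mono fun p hp => hp.symm

theorem lintegral_eq_zero_or_one_of_harmonic {d : ℕ} {G : Measure (Env d)}
    [IsProbabilityMeasure G] (herg : IsErgodicFor (envKernel d) G) {g : Env d → ℝ≥0∞}
    (hgm : Measurable g) (hconst : ∀ᵐ p ∂(averaged G 0), g (shift (p.2 1) p.1) = g p.1)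
    (hg01 : ∀ᵐ ω ∂G, g ω = 0 ∨ g ω = 1) : ∫⁻ ω, g ω ∂G = 0 ∨ ∫⁻ ω, g ω ∂G = 1 := by
  set A : Set (Env d) := g ⁻¹' {1} with hA
  have hAm : MeasurableSet A := hgm (measurableSet_singleton 1)
  have hAinv : ∀ᵐ ω ∂G, envKernel d ω A = A.indicator 1 ω := by
    have h1 := Measure.ae_ae_of_ae_compProd
      (p := fun p : Env d × Path d => g (shift (p.2 1) p.1) = g p.1) hconst
    filter_upwards [h1] with ω hω
    rw [envKernel_apply _ hAm]
    by_cases hωA : ω ∈ A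
    · rw [Set.indicator_of_mem hωA, Pi.one_apply]
      have hall : ∀ᵐ X ∂(quenched ω 0), shift (X 1) ω ∈ A := by
        filter_upwards [hω] with X hX
        exact hX.trans hωA
      have hmsX : MeasurableSet {X : Path d | shift (X 1) ω ∈ A} :=
        ((measurable_shift_path 1).comp measurable_prodMk_left) hAm
      exact (prob_compl_eq_zero_iff hmsX).1 hall
    · rw [Set.indicator_of_notMem hωA]
      refine measure_eq_zero_iff_ae_notMem.2 ?_
      filter_upwards [hω] with X hX h
      exact hωA (hX.symm.trans h)
  have hval : ∫⁻ ω, g ω ∂G = G A := by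
    rw [← lintegral_indicator_one hAm]
    refine lintegral_congr_ae ?_
    filter_upwards [hg01] with ω hω
    by_cases hωA : ω ∈ A
    · rw [Set.indicator_of_mem hωA]
      exact hωA
    · rw [Set.indicator_of_notMem hωA]
      exact hω.resolve_right hωA
  rw [hval]
  exact herg A hAm hAinv

/-- If the environment process is ergodic, so is the joint shift of the environment and the walk:
the environments from which a shift invariant event has quenched probability one form an invariant
event of the environment process. -/
theorem ergodic_pairShift {d : ℕ} {G : Measure (Env d)} [IsProbabilityMeasure G]
    (hG : envLaw G 1 = G) (herg : IsErgodicFor (envKernel d) G) :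
    Ergodic (pairShift 1) (averaged G 0) := by
  refine ⟨⟨measurable_pairShift 1, by rw [map_pairShift, hG]⟩, ⟨fun B hB hinv => ?_⟩⟩
  have hgm := measurable_quenched_slice hB
  have hconst := ae_harmonic_step hG hgm (fun ω => prob_le_one)
    (lintegral_quenched_invariant hB hinv)
  have hg01 : ∀ᵐ ω ∂G, quenched ω 0 (Prod.mk ω ⁻¹' B) = 0 ∨ quenched ω 0 (Prod.mk ω ⁻¹' B) = 1 := by
    have hms := (hgm (measurableSet_singleton 0)).union (hgm (measurableSet_singleton 1))
    rw [← averaged_fst G]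
    refine (ae_map_iff measurable_fst.aemeasurable hms).2 ?_
    filter_upwards [ae_quenched_invariant_eq_indicator hG hB hinv] with p hp
    by_cases hpB : p ∈ B
    · right
      rw [Set.indicator_of_mem hpB] at hp
      exact hp
    · left
      rw [Set.indicator_of_notMem hpB] at hp
      exact hp
  have h01 := lintegral_eq_zero_or_one_of_harmonic herg hgm hconst hg01
  rw [← averaged_apply G hB] at h01
  rw [eventuallyConst_set]
  rcases h01 with h | h
  · exact Or.inr (measure_eq_zero_iff_ae_notMem.1 h)
  · exact Or.inl ((prob_compl_eq_zero_iff hB).2 h)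

/-! ### The law of large numbers along the walk -/

theorem ae_tendsto_of_ergodic {d : ℕ} {G : Measure (Env d)} [IsProbabilityMeasure G]
    (hG : envLaw G 1 = G) (herg : IsErgodicFor (envKernel d) G) {Ψ : Env d → ℝ}
    (hΨ : Measurable Ψ) {K : ℝ} (hK : ∀ ω, |Ψ ω| ≤ K) :
    ∀ᵐ p ∂(averaged G 0), Tendsto (cesaro fun j => Ψ (shift (p.2 j) p.1)) atTop
      (𝓝 (∫ ω, Ψ ω ∂G)) := by
  have hf : Measurable fun p : Env d × Path d => Ψ p.1 := hΨ.comp measurable_fst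
  have hfi : Integrable (fun p : Env d × Path d => Ψ p.1) (averaged G 0) :=
    Integrable.of_bound (C := K) hf.aestronglyMeasurable (Eventually.of_forall fun p => hK p.1)
  have e : ∫ p, Ψ p.1 ∂(averaged G 0) = ∫ ω, Ψ ω ∂G := by
    have h1 := integral_map (μ := averaged G 0) (f := Ψ) measurable_fst.aemeasurable
      hΨ.aestronglyMeasurable
    rw [averaged_fst] at h1
    exact h1.symm
  have h := ae_tendsto_birkhoff (ergodic_pairShift hG herg) hf hfi
  rw [e] at h
  filter_upwards [h, ae_averaged_zero G] with p hp hp0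
  refine hp.congr fun n => ?_
  simp only [cesaro, birkhoffSum]
  congr 1
  refine Finset.sum_congr rfl fun j _ => ?_
  cases j with
  | zero => simp [hp0]
  | succ j =>
    rw [pairShift_one_iterate]
    rfl

/-- The event that the averages of `Ψ` along the environment process do not converge to `c`. -/
def diverges {d : ℕ} (Ψ : Env d → ℝ) (c : ℝ) : Set (Env d × Path d) :=
  {p | ¬ Tendsto (cesaro fun j => Ψ (shift (p.2 j) p.1)) atTop (𝓝 c)}

theorem measurableSet_diverges {d : ℕ} {Ψ : Env d → ℝ} (hΨ : Measurable Ψ) (c : ℝ) :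
    MeasurableSet (diverges Ψ c) := by
  refine (measurableSet_tendsto (𝓝 c) fun n => ?_).compl
  exact (Finset.measurable_fun_sum _ fun j _ =>
    hΨ.comp (measurable_shift_path j)).const_mul _

theorem mem_diverges_pairShift {d : ℕ} {Ψ : Env d → ℝ} {K : ℝ} (hK : ∀ ω, |Ψ ω| ≤ K) (c : ℝ)
    (n : ℕ) (p : Env d × Path d) : pairShift n p ∈ diverges Ψ c ↔ p ∈ diverges Ψ c := by
  refine not_congr ?_
  simp only [shift_pairShift]
  induction n with
  | zero => simp only [zero_add]
  | succ n ih =>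
    rw [← ih, ← tendsto_cesaro_succ_iff (a := fun j => Ψ (shift (p.2 (n + j)) p.1))
      fun j => hK _]
    refine iff_of_eq ?_
    congr 2
    ext j
    rw [add_right_comm, add_assoc]

/-- The quenched probability that the averages diverge along a walk that does not go below level
`-L` reads the environment in a half-space only. -/
theorem quenched_diverges_trunc {d : ℕ} {u : Site d} {Ψ : Env d → ℝ} (hΨ : Measurable Ψ) (c : ℝ)
    {b L : ℕ} (hb : ∀ ω, Ψ (trunc u (-b) ω) = Ψ ω) (ω : Env d) :
    quenched (trunc u (-((L + b : ℕ) : ℤ)) ω) 0 (Prod.mk (trunc u (-((L + b : ℕ) : ℤ)) ω) ⁻¹'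
        (diverges Ψ c ∩ Prod.snd ⁻¹' staysAbove u (-L)))
      = quenched ω 0 (Prod.mk ω ⁻¹' (diverges Ψ c ∩ Prod.snd ⁻¹' staysAbove u (-L))) := by
  set ω' := trunc u (-((L + b : ℕ) : ℤ)) ω with hω'
  have e : ∀ ω : Env d, Prod.mk ω ⁻¹' (diverges Ψ c ∩ Prod.snd ⁻¹' staysAbove u (-L))
      = (Prod.mk ω ⁻¹' diverges Ψ c) ∩ staysAbove u (-L) := fun ω => rfl
  have e1 : (Prod.mk ω' ⁻¹' diverges Ψ c) ∩ staysAbove u (-L)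
      = (Prod.mk ω ⁻¹' diverges Ψ c) ∩ staysAbove u (-L) := by
    ext X
    refine and_congr_left fun hX => ?_
    have h1 : ∀ j, Ψ (shift (X j) ω') = Ψ (shift (X j) ω) := by
      intro j
      have hj := hX j
      rw [← hb (shift (X j) ω'), ← hb (shift (X j) ω), ← shift_trunc, ← shift_trunc, hω',
        trunc_trunc u (by push_cast; omega)]
    simp only [diverges, Set.mem_preimage, Set.mem_ofPred_eq, h1]
  rw [e, e, e1]
  exact quenched_inter_staysAbove_congr u (-L)
    (fun x hx => trunc_apply_of_le ω (by push_cast; omega))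
    (measurable_prodMk_left (measurableSet_diverges hΨ c))

/-- The averages that converge almost surely under the limit law also converge almost surely under
the product law. The environments for which a walk that does not backtrack far has divergent
averages with positive probability form a half-space event that is null for the limit law, hence
is seldom seen by the walk in an environment with the product law. -/
theorem IsLimitLaw.averaged_diverges {d : ℕ} {ν : Measure (ProbVec d)} [IsProbabilityMeasure ν]
    {u : Site d} {G : Measure (Env d)} [IsProbabilityMeasure G] (h : IsLimitLaw ν u G)
    {s : ℝ} (hs : 0 < s) {ρ : ℝ≥0∞} (hρ : ρ < 1) (hd : UniformDrift u s ρ (iidLaw ν))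
    {Ψ : Env d → ℝ} (hΨ : Measurable Ψ) {b : ℕ} (hb : ∀ ω, Ψ (trunc u (-b) ω) = Ψ ω) {K : ℝ}
    (hK : ∀ ω, |Ψ ω| ≤ K) {c : ℝ} (h0 : averaged G 0 (diverges Ψ c) = 0) :
    averaged (iidLaw ν) 0 (diverges Ψ c) = 0 := by
  set P := iidLaw ν
  have hDm := measurableSet_diverges hΨ c
  refine (measureReal_eq_zero_iff (measure_ne_top _ _)).1
    (le_antisymm (le_of_forall_pos_le_add fun ε hε => ?_) measureReal_nonneg)
  rw [zero_add]
  obtain ⟨L, hL⟩ := exists_forall_backtrack_le u hs hρ hε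
  set S : Set (Env d × Path d) := diverges Ψ c ∩ Prod.snd ⁻¹' staysAbove u (-L) with hS
  have hSm : MeasurableSet S := hDm.inter (measurableSet_snd_staysAbove u (-L))
  set A : Set (Env d) := (fun ω => quenched ω 0 (Prod.mk ω ⁻¹' S)) ⁻¹' {0}ᶜ with hA
  have hAH : IsHalf u (-((L + b : ℕ) : ℤ)) A :=
    isHalf_of_measurable (measurable_quenched_slice hSm) (quenched_diverges_trunc hΨ c hb)
      (measurableSet_singleton 0).compl
  have hGA : G A = 0 := by
    have h1 : averaged G 0 S = 0 := measure_mono_null Set.inter_subset_left h0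
    rw [averaged_apply _ hSm, lintegral_eq_zero_iff (measurable_quenched_slice hSm)] at h1
    exact h1
  have hle : ∀ μ : Measure (Env d), ∀ [IsProbabilityMeasure μ], averaged μ 0 S ≤ μ A := by
    intro μ _
    rw [averaged_apply _ hSm, ← lintegral_indicator_one hAH.1]
    refine lintegral_mono fun ω => ?_
    by_cases hω : ω ∈ A
    · rw [Set.indicator_of_mem hω]
      exact prob_le_one
    · rw [Set.indicator_of_notMem hω]
      exact (not_not.1 hω : quenched ω 0 (Prod.mk ω ⁻¹' S) = 0).le
  have hn : ∀ n, (averaged P 0).real (diverges Ψ c) - ε ≤ (envLaw P n).real A := by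
    intro n
    have e1 : (averaged P 0).real (diverges Ψ c)
        = (averaged (envLaw P n) 0).real (diverges Ψ c) := by
      rw [measureReal_def, measureReal_def, ← averaged_preimage_pairShift P n hDm]
      congr 2
      ext p
      exact (mem_diverges_pairShift hK c n p).symm
    have h1 : (averaged (envLaw P n) 0).real (diverges Ψ c)
        ≤ (averaged (envLaw P n) 0).real S
          + (averaged (envLaw P n) 0).real (Prod.snd ⁻¹' staysAbove u (-L))ᶜ := by
      refine le_trans (measureReal_mono ?_) (measureReal_union_le _ _)
      intro p hp
      by_cases hp' : p ∈ (Prod.snd ⁻¹' staysAbove u (-L) : Set (Env d × Path d))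
      · exact Or.inl ⟨hp, hp'⟩
      · exact Or.inr hp'
    have h2 := hL (envLaw P n) (hd.envLaw n)
    have h3 : (averaged (envLaw P n) 0).real S ≤ (envLaw P n).real A :=
      ENNReal.toReal_mono (measure_ne_top _ _) (hle (envLaw P n))
    linarith
  have h1 := h.tendsto hAH
  rw [measureReal_def, hGA, ENNReal.toReal_zero] at h1
  have h2 := le_of_tendsto_of_tendsto (tendsto_cesaro_const _) h1
    (Eventually.of_forall fun N => cesaro_mono hn N)
  linarith

/-- The law of large numbers for the environment seen from the walk. -/
theorem IsInvariantLimit.ae_tendsto {d : ℕ} {ν : Measure (ProbVec d)} [IsProbabilityMeasure ν]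
    {u : Site d} (hN : HypothesisN u (iidLaw ν)) (hM : HypothesisM (iidLaw ν))
    {G : Measure (Env d)} (h : IsInvariantLimit u (iidLaw ν) G) {a : ℝ} {Ψ : Env d → ℝ}
    (hΨ : Measurable[levelSigma u (-a)] Ψ) {K : ℝ} (hK : ∀ ω, |Ψ ω| ≤ K) :
    ∀ᵐ p ∂(averaged (iidLaw ν) 0), Tendsto (cesaro fun j => Ψ (shift (p.2 j) p.1)) atTop
      (𝓝 (∫ ω, Ψ ω ∂G)) := by
  have := h.prob
  obtain ⟨s, ρ, hs, hρ, hd⟩ := exists_expDrift hN hM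
  obtain ⟨hΨm, hΨt⟩ := measurable_levelSigma hΨ
  have hb : ∀ ω, Ψ (trunc u (-((⌈-a⌉.natAbs : ℕ) : ℤ)) ω) = Ψ ω := fun ω => by
    rw [← hΨt, trunc_trunc u (by omega), hΨt]
  exact (h.isLimitLaw hN hM).averaged_diverges hs hρ (uniformDrift_iidLaw hd) hΨm hb hK
    (ae_tendsto_of_ergodic ((invariant_iff G).1 h.invariant) h.ergodic hΨm hK)

end RWRE


theorem theorem4p2 {d : ℕ} (u : RWRE.Site d) (hu : u ≠ 0)
    (ν : Measure (RWRE.ProbVec d)) [IsProbabilityMeasure ν]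
    (P : Measure (RWRE.Env d)) (hP : P = Measure.infinitePi fun _ : RWRE.Site d => ν)
    (hN : RWRE.HypothesisN u P) (hM : RWRE.HypothesisM P) :
    (∃ Pinf : Measure (RWRE.Env d), RWRE.IsInvariantLimit u P Pinf) ∧
    ∀ Pinf : Measure (RWRE.Env d), RWRE.IsInvariantLimit u P Pinf →
      ∀ (a : ℝ) (Ψ : RWRE.Env d → ℝ), Measurable[RWRE.levelSigma u (-a)] Ψ →
        (∃ K : ℝ, ∀ ω, |Ψ ω| ≤ K) →
        ∀ᵐ p ∂(RWRE.averaged P 0),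
          Tendsto
            (fun n : ℕ => (n : ℝ)⁻¹ * ∑ j ∈ Finset.range n, Ψ (RWRE.shift (p.2 j) p.1))
            atTop (𝓝 (∫ ω, Ψ ω ∂Pinf)) := by
  subst hP
  exact ⟨RWRE.exists_isInvariantLimit hN hM, fun Pinf h a Ψ hΨ ⟨K, hK⟩ =>
    h.ae_tendsto hN hM hΨ hK⟩
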